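/- **Setting.** Let $d\ge 3$, let $\omega_{d-1}$ be the rotation-invariant probability measure on $\mathbb S^{d-1}\subset\mathbb R^d$, put $\langle f_1,f_2\rangle=\int_{\mathbb S^{d-1}} f_1\overline{f_2}\,d\omega_{d-1}$ for $f_1,f_2\in L^2(\mathbb S^{d-1})$ (complex valued), and identify $SO(d-1)$ with $\{h\in SO(d): he^d=e^d\}$, equipped with its Haar probability measure $\mu_{d-1}$. For $g\in SO(d)$ let $T^d(g)f(\eta)=f(g^{-1}\eta)$. For $n\in\mathbb N_0$ let $\mathcal I_n^d$ be the set of $k=(k_1,\dots,k_{d-2})\in\mathbb N_0^{d-3}\times\mathbb Z$ with $n\ge k_1\ge\dots\ge k_{d-3}\ge|k_{d-2}|$, and put $k_0=n$. In spherical coordinates ($x_1=\prod_{m=1}^{d-1}\sin\theta_m$ and $x_i=\cos\theta_{i-1}\prod_{m=i}^{d-1}\sin\theta_m$ for $2\le i\le d$) the spherical harmonics are $$Y_k^{d,n}=A_k^n\prod_{j=0}^{d-3}C^{\frac{d-j-2}2+|k_{j+1}|}_{k_j-|k_{j+1}|}(\cos\theta_{d-j-1})\,\sin^{|k_{j+1}|}(\theta_{d-j-1})\;e^{\mathrm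 i k_{d-2}\theta_1},\qquad k\in\mathcal I_n^d,$$ where $C_m^\lambda(t)=\sum_{i=0}^{\lfloor m/2\rfloor}(-1)^i\frac{\Gamma(m-i+\lambda)}{\Gamma(\lambda)\,i!\,(m-2i)!}(2t)^{m-2i}$ are the Gegenbauer polynomials and $A_k^n>0$ is given by $$(A_k^n)^2=\frac{2^{(d-4)(d-2)}}{\Gamma(\frac d2)}\prod_{j=0}^{d-3}\frac{2^{2|k_{j+1}|-j}\,(k_j-|k_{j+1}|)!\,(2k_j+d-j-2)\,\Gamma(\frac{d-j-2}2+|k_{j+1}|)^2}{\sqrt\pi\;\Gamma(k_j+|k_{j+1}|+d-j-2)}.$$ Let $\mathcal H_n^d=\mathrm{span}\{Y_k^{d,n}:k\in\mathcal I_n^d\}$ and $\Pi_N(\mathbb S^{d-1})=\mathrm{span}\{Y_k^{d,n}:n\le N,\ k\in\mathcal I_n^d\}$, and let $\Pi_N(SO(d-1))$ be the space of restrictions to $SO(d-1)$ of complex polynomials of degree at most $N$ in the matrix entries. Let $\phi\in C^q([0,\infty))$, $q\in\mathbb N_0$, be real valued and non-increasing with $\phi=1$ on $[0,1/2]$ and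 $\phi=0$ on $[1,\infty)$, and let $\kappa(t)=\sqrt{\phi^2(t/2)-\phi^2(t)}$. Let $K\in\mathbb N_0$ and let $\zeta_{K,k}^{d,n}\in\mathbb C$ ($n\in\mathbb N_0$, $k\in\mathcal I_n^d$) be such that $\zeta_{K,k}^{d,n}$ does not depend on $n$ for $n\ge K$, $\zeta_{K,k}^{d,n}=0$ whenever $|k_1|>K$, and $\sum_{k\in\mathcal I_n^d}|\zeta_{K,k}^{d,n}|^2=1$ for all $n\ge1$. For $j\ge1$ define $$\Psi_K^j=\sum_{n=0}^\infty\sum_{k\in\mathcal I_n^d}\sqrt{\dim\mathcal H_n^d}\;\kappa\!\left(\frac n{2^{j-1}}\right)\zeta_{K,k}^{d,n}\,Y_k^{d,n}.$$ For every $j\ge1$ let points $\eta_{j,\ell}\in\mathbb S^{d-1}$ and weights $\omega_{j,\ell}\ge0$ ($\ell=1,\dots,s_j$), and points $h_{j,m}\in SO(d-1)$ and weights $\mu_{j,m}>0$ ($m=1,\dots,r_j$), be given with $$\sum_{\ell=1}^{s_j}\omega_{j,\ell}f(\eta_{j,\ell})=\int_{\mathbb S^{d-1}}f\,d\omega_{d-1}\quad\text{for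 all } f\in\Pi_{2^{j+1}}(\mathbb S^{d-1}),$$ $$\sum_{m=1}^{r_j}\mu_{j,m}f(h_{j,m})=\int_{SO(d-1)}f\,d\mu_{d-1}\quad\text{for all } f\in\Pi_{2\min(K,2^j)}(SO(d-1)),$$ and let $g_{\eta_{j,\ell}}\in SO(d)$ be arbitrary rotations with $g_{\eta_{j,\ell}}e^d=\eta_{j,\ell}$. Put $s_0=r_0=1$, $\Psi_K^{0,1,1}\equiv1$, and $$\Psi_K^{j,\ell,m}=\sqrt{\omega_{j,\ell}\,\mu_{j,m}}\;T^d(g_{\eta_{j,\ell}}h_{j,m})\Psi_K^j,\qquad j\ge1.$$ **Proposition.** The functions $\Psi_K^{j,\ell,m}$ belong to $L^2(\mathbb S^{d-1})$ and form a tight frame for it with frame bound $1$: for every $f\in L^2(\mathbb S^{d-1})$, $$\sum_{j=0}^\infty\sum_{\ell=1}^{s_j}\sum_{m=1}^{r_j}\bigl|\langle f,\Psi_K^{j,\ell,m}\rangle\bigr|^2=\int_{\mathbb S^{d-1}}|f|^2\,d\omega_{d-1}.$$ -/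

import Mathlib

open MeasureTheory Set

noncomputable section

namespace SphereWavelet

/-! ## The sphere, the rotation groups and their invariant probability measures -/

/-- The unit sphere `𝕊^{d-1}` of `ℝ^d`. -/
abbrev Sphere (d : ℕ) : Type := Metric.sphere (0 : EuclideanSpace ℝ (Fin d)) 1

/-- The rotation invariant surface measure on `𝕊^{d-1}`, normalised to total mass one. -/
def surfaceMeasure (d : ℕ) : Measure (Sphere d) :=
  ((volume : Measure (EuclideanSpace ℝ (Fin d))).toSphere univ)⁻¹ •
    (volume : Measure (EuclideanSpace ℝ (Fin d))).toSphere

/-- The rotation group `SO(d)`. -/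
abbrev SO (d : ℕ) : Type := Matrix.specialOrthogonalGroup (Fin d) ℝ

/-- The last canonical basis vector `e^d` of `ℝ^d`. -/
def lastBasis (d : ℕ) : Fin d → ℝ := fun i => if (i : ℕ) + 1 = d then 1 else 0

theorem SO.transpose_mul_self {d : ℕ} (g : SO d) :
    (g : Matrix (Fin d) (Fin d) ℝ).transpose * (g : Matrix (Fin d) (Fin d) ℝ) = 1 :=
  (Matrix.mem_orthogonalGroup_iff' _ _).mp (Matrix.mem_specialOrthogonalGroup_iff.mp g.2).1

/-- The action `η ↦ g η` of a rotation on the sphere. -/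
def rotate {d : ℕ} (g : SO d) (x : Sphere d) : Sphere d :=
  ⟨WithLp.toLp 2 ((g : Matrix (Fin d) (Fin d) ℝ).mulVec (x : EuclideanSpace ℝ (Fin d)).ofLp), by
    have hx : ‖(x : EuclideanSpace ℝ (Fin d))‖ = 1 := by simp
    have key : ∀ v : EuclideanSpace ℝ (Fin d), ‖v‖ ^ 2 = v.ofLp ⬝ᵥ v.ofLp := fun v => by
      rw [EuclideanSpace.norm_sq_eq]
      simp [dotProduct, sq]
    have h2 : ‖(WithLp.toLp 2 ((g : Matrix (Fin d) (Fin d) ℝ).mulVec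
        (x : EuclideanSpace ℝ (Fin d)).ofLp) : EuclideanSpace ℝ (Fin d))‖ ^ 2 = 1 := by
      rw [key]
      change (g : Matrix (Fin d) (Fin d) ℝ).mulVec _ ⬝ᵥ
        (g : Matrix (Fin d) (Fin d) ℝ).mulVec _ = 1
      rw [Matrix.dotProduct_mulVec, ← Matrix.mulVec_transpose, Matrix.mulVec_mulVec,
        SO.transpose_mul_self, Matrix.one_mulVec, ← key, hx, one_pow]
    rw [mem_sphere_zero_iff_norm]
    nlinarith [norm_nonneg (WithLp.toLp 2 ((g : Matrix (Fin d) (Fin d) ℝ).mulVec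
        (x : EuclideanSpace ℝ (Fin d)).ofLp) : EuclideanSpace ℝ (Fin d))]⟩

/-- The representation `T^d(g) f (η) = f (g⁻¹ η)`. -/
def rotateFun {d : ℕ} (g : SO d) (f : Sphere d → ℂ) : Sphere d → ℂ :=
  fun x => f (rotate g⁻¹ x)

theorem SO.coe_inv {d : ℕ} (g : SO d) :
    ((g⁻¹ : SO d) : Matrix (Fin d) (Fin d) ℝ) =
      (g : Matrix (Fin d) (Fin d) ℝ).transpose := rfl

instance (d : ℕ) : IsTopologicalGroup (SO d) where
  continuous_inv := by
    refine Continuous.subtype_mk (f := fun g : SO d =>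
      (g : Matrix (Fin d) (Fin d) ℝ).transpose) ?_ _
    fun_prop

instance (d : ℕ) : MeasurableSpace (SO d) := borel _

instance (d : ℕ) : BorelSpace (SO d) := ⟨rfl⟩

instance (d : ℕ) : CompactSpace (SO d) := by
  have hK : IsCompact (Set.pi univ fun _ : Fin d => Set.pi univ fun _ : Fin d =>
      Icc (-1 : ℝ) 1) :=
    isCompact_univ_pi fun _ => isCompact_univ_pi fun _ => isCompact_Icc
  have hset : ((Matrix.specialOrthogonalGroup (Fin d) ℝ : Submonoid _) :
      Set (Matrix (Fin d) (Fin d) ℝ)) = {A | A.transpose * A = 1 ∧ A.det = 1} := by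
    ext A
    rw [SetLike.mem_coe, Matrix.mem_specialOrthogonalGroup_iff, Matrix.mem_orthogonalGroup_iff']
    rfl
  have hclosed : IsClosed {A : Matrix (Fin d) (Fin d) ℝ | A.transpose * A = 1 ∧ A.det = 1} := by
    refine IsClosed.inter (isClosed_eq (by fun_prop) continuous_const)
      (isClosed_eq ?_ continuous_const)
    exact Continuous.matrix_det continuous_id
  refine isCompact_iff_compactSpace.mp (IsCompact.of_isClosed_subset hK
    (hset ▸ hclosed) ?_)
  intro A hA
  rw [hset] at hA
  intro i _ j _
  have h1 : ∑ l, A l j * A l j = 1 := by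
    have := congrFun (congrFun hA.1 j) j
    simpa [Matrix.mul_apply] using this
  have h2 : A i j * A i j ≤ 1 := h1 ▸
    Finset.single_le_sum (f := fun l => A l j * A l j) (fun l _ => mul_self_nonneg _)
      (Finset.mem_univ i)
  exact abs_le.mp (abs_le_one_iff_mul_self_le_one.mpr h2)

/-- `SO(d-1)`, identified with the subgroup of all `h ∈ SO(d)` with `h e^d = e^d`. -/
def SOsub (d : ℕ) : Subgroup (SO d) where
  carrier := {h | (h : Matrix (Fin d) (Fin d) ℝ).mulVec (lastBasis d) = lastBasis d}
  mul_mem' {a b} ha hb := by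
    simp only [Set.mem_ofPred_eq] at ha hb ⊢
    rw [Submonoid.coe_mul, ← Matrix.mulVec_mulVec, hb, ha]
  one_mem' := by simp
  inv_mem' {a} ha := by
    simp only [Set.mem_ofPred_eq] at ha ⊢
    conv_lhs => rw [← ha]
    rw [SO.coe_inv, Matrix.mulVec_mulVec, SO.transpose_mul_self, Matrix.one_mulVec]

instance (d : ℕ) : CompactSpace (SOsub d) := by
  refine isCompact_iff_compactSpace.mp (IsClosed.isCompact ?_)
  change IsClosed {h : SO d |
    (h : Matrix (Fin d) (Fin d) ℝ).mulVec (lastBasis d) = lastBasis d}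
  exact isClosed_eq (Continuous.matrix_mulVec continuous_subtype_val continuous_const)
    continuous_const

/-- The Haar measure on `SO(d-1)`, normalised to total mass one. -/
def haarSOsub (d : ℕ) : Measure (SOsub d) :=
  Measure.haarMeasure (⊤ : TopologicalSpace.PositiveCompacts (SOsub d))

/-- The inner product `⟨f₁, f₂⟩ = ∫ f₁ · conj f₂` of `L²(𝕊^{d-1})`. -/
def innerL2 (d : ℕ) (f₁ f₂ : Sphere d → ℂ) : ℂ :=
  ∫ x, f₁ x * (starRingEnd ℂ) (f₂ x) ∂(surfaceMeasure d)

/-! ## Spherical coordinates -/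

/-- The coordinate `x_{i+1}` of `x ∈ ℝ^d` (zero for `i ≥ d`). -/
def coord {d : ℕ} (x : EuclideanSpace ℝ (Fin d)) (i : ℕ) : ℝ :=
  if h : i < d then x ⟨i, h⟩ else 0

/-- The point with spherical coordinates `θ_1, …, θ_{d-1}`:
its first coordinate is `∏_{m=1}^{d-1} sin θ_m`, and for `2 ≤ i ≤ d` its `i`-th coordinate is
`cos θ_{i-1} ∏_{m=i}^{d-1} sin θ_m`. -/
def sphericalPoint (d : ℕ) (θ : ℕ → ℝ) : EuclideanSpace ℝ (Fin d) :=
  WithLp.toLp 2 fun i => (if (i : ℕ) = 0 then 1 else Real.cos (θ i)) *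
    ∏ m ∈ Finset.Ico ((i : ℕ) + 1) d, Real.sin (θ m)

/-- The norm of `(x_1, …, x_i)`. -/
def partialNorm {d : ℕ} (x : EuclideanSpace ℝ (Fin d)) (i : ℕ) : ℝ :=
  √(∑ l ∈ Finset.range i, coord x l ^ 2)

/-- Spherical coordinates of a point of the sphere: `θ_1` is the angle with
`(x_1, x_2) = |(x_1, x_2)| (sin θ_1, cos θ_1)`, taken modulo `2π`, and
`θ_m = arccos (x_{m+1} / |(x_1, …, x_{m+1})|) ∈ [0, π]` for `m ≥ 2`. -/
def angle {d : ℕ} (x : EuclideanSpace ℝ (Fin d)) (m : ℕ) : ℝ :=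
  if m = 1 then Complex.arg ⟨coord x 1, coord x 0⟩
  else Real.arccos (coord x m / partialNorm x (m + 1))

/-- The angles above are spherical coordinates of `x`. -/
theorem sphericalPoint_angle {d : ℕ} (hd : 2 ≤ d) (x : Sphere d) :
    sphericalPoint d (angle (x : EuclideanSpace ℝ (Fin d))) = x := by
  obtain ⟨y, hy⟩ := x
  have hy1 : ‖y‖ = 1 := by simpa using hy
  change sphericalPoint d (angle y) = y
  have hsq : ∀ i, partialNorm y i ^ 2 = ∑ l ∈ Finset.range i, coord y l ^ 2 := fun i =>
    Real.sq_sqrt (Finset.sum_nonneg fun _ _ => sq_nonneg _)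
  have hnn : ∀ i, 0 ≤ partialNorm y i := fun i => Real.sqrt_nonneg _
  have hsucc : ∀ i, partialNorm y (i + 1) ^ 2 = partialNorm y i ^ 2 + coord y i ^ 2 := fun i => by
    rw [hsq, hsq, Finset.sum_range_succ]
  have hd1 : partialNorm y d = 1 := by
    have h1 : partialNorm y d ^ 2 = ‖y‖ ^ 2 := by
      rw [hsq, EuclideanSpace.norm_sq_eq, Finset.sum_range]
      refine Finset.sum_congr rfl fun i _ => ?_
      simp [coord]
    rw [hy1] at h1
    nlinarith [hnn d]
  have hle : ∀ i, |coord y i| ≤ partialNorm y (i + 1) := fun i =>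
    abs_le_of_sq_le_sq (by nlinarith [hsucc i, sq_nonneg (partialNorm y i)]) (hnn _)
  have hdiv : ∀ i, -1 ≤ coord y i / partialNorm y (i + 1) ∧
      coord y i / partialNorm y (i + 1) ≤ 1 := fun i => by
    refine abs_le.mp ?_
    rw [abs_div, abs_of_nonneg (hnn _)]
    exact div_le_one_of_le₀ (hle i) (hnn _)
  have hcos : ∀ m, 2 ≤ m → partialNorm y (m + 1) * Real.cos (angle y m) = coord y m := by
    intro m hm
    rw [angle, if_neg (by omega), Real.cos_arccos (hdiv m).1 (hdiv m).2]
    rcases eq_or_ne (partialNorm y (m + 1)) 0 with h0 | h0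
    · have := hle m
      rw [h0] at this ⊢
      rw [zero_mul, abs_nonpos_iff.mp this]
    · field_simp
  have hsin : ∀ m, 2 ≤ m → partialNorm y (m + 1) * Real.sin (angle y m) = partialNorm y m := by
    intro m hm
    have h0 : 0 ≤ Real.sin (angle y m) := by
      rw [angle, if_neg (by omega), Real.sin_arccos]
      exact Real.sqrt_nonneg _
    refine (sq_eq_sq₀ (mul_nonneg (hnn _) h0) (hnn _)).mp ?_
    have h1 := hcos m hm
    have h2 := hsucc m
    have h3 := Real.sin_sq_add_cos_sq (angle y m)
    rw [mul_pow]
    rw [← h1] at h2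
    linear_combination h2 + partialNorm y (m + 1) ^ 2 * h3
  have hprod : ∀ t, ∀ i, 2 ≤ i → i + t = d →
      ∏ m ∈ Finset.Ico i d, Real.sin (angle y m) = partialNorm y i := by
    intro t
    induction t with
    | zero => intro i _ h; rw [show i = d by omega, Finset.Ico_self, Finset.prod_empty, hd1]
    | succ t ih =>
      intro i hi h
      rw [Finset.prod_eq_prod_Ico_succ_bot (by omega), ih (i + 1) (by omega) (by omega),
        mul_comm, hsin i hi]
  have hz : ‖(⟨coord y 1, coord y 0⟩ : ℂ)‖ = partialNorm y 2 := by
    rw [Complex.norm_def, partialNorm, Complex.normSq_mk]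
    simp [Finset.sum_range_succ]
    ring_nf
  ext i
  obtain ⟨i, hi⟩ := i
  have hc : coord y i = y ⟨i, hi⟩ := by simp [coord, hi]
  rw [← hc]
  simp only [sphericalPoint]
  rcases i with _ | _ | i
  · rw [if_pos rfl, one_mul, Finset.prod_eq_prod_Ico_succ_bot (by omega),
      hprod (d - 2) 2 le_rfl (by omega), angle, if_pos rfl, ← hz, mul_comm]
    exact Complex.norm_mul_sin_arg _
  · rw [if_neg (by simp), hprod (d - 2) 2 le_rfl (by omega), angle, if_pos rfl, ← hz, mul_comm]
    exact Complex.norm_mul_cos_arg _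
  · rw [if_neg (by simp), hprod (d - (i + 3)) (i + 3) (by omega) (by omega), mul_comm]
    exact hcos (i + 2) (by omega)

/-! ## Spherical harmonics -/

/-- The Gegenbauer polynomial
`C_m^λ(t) = ∑_{i ≤ m/2} (-1)^i Γ(m-i+λ) / (Γ(λ) i! (m-2i)!) (2t)^{m-2i}`. -/
def gegenbauer (m : ℕ) (lam t : ℝ) : ℝ :=
  ∑ i ∈ Finset.range (m / 2 + 1),
    (-1) ^ i * Real.Gamma ((m - i : ℕ) + lam) /
      (Real.Gamma lam * (i.factorial : ℝ) * ((m - 2 * i).factorial : ℝ)) * (2 * t) ^ (m - 2 * i)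

/-- The sequence `k_0 = n, k_1, …, k_{d-2}` attached to `k = (k_1, …, k_{d-2})`
(continued by zero). -/
def extIndex {d : ℕ} (n : ℕ) (k : Fin (d - 2) → ℤ) : ℕ → ℤ
  | 0 => n
  | i + 1 => if h : i < d - 2 then k ⟨i, h⟩ else 0

/-- The index set `𝓘_n^d` of all `(k_1, …, k_{d-2}) ∈ ℕ₀^{d-3} × ℤ` with
`n ≥ k_1 ≥ … ≥ k_{d-3} ≥ |k_{d-2}|`; see `mem_indexSet` below. -/
def indexSet (d n : ℕ) : Finset (Fin (d - 2) → ℤ) :=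
  (Fintype.piFinset fun _ => Finset.Icc (-(n : ℤ)) n).filter fun k =>
    ∀ i < d - 2, |extIndex n k (i + 1)| ≤ extIndex n k i

/-- Membership in `indexSet` is the chain `|k_{i+1}| ≤ k_i` for `0 ≤ i ≤ d-3`, which contains
`0 ≤ k_i` for `i ≤ d-3`. -/
theorem mem_indexSet {d n : ℕ} {k : Fin (d - 2) → ℤ} :
    k ∈ indexSet d n ↔ ∀ i < d - 2, |extIndex n k (i + 1)| ≤ extIndex n k i := by
  simp only [indexSet, Finset.mem_filter, Fintype.mem_piFinset, Finset.mem_Icc, and_iff_right_iff_imp]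
  intro h
  have key : ∀ i, i < d - 2 → |extIndex n k (i + 1)| ≤ n := by
    intro i
    induction i with
    | zero => exact fun hi => h 0 hi
    | succ i ih => exact fun hi => (h _ hi).trans ((le_abs_self _).trans (ih (by omega)))
  intro i
  have := key i i.2
  simpa [extIndex, abs_le] using this

/-- The normalisation constant `A_k^n`. -/
def normConst (d n : ℕ) (k : Fin (d - 2) → ℤ) : ℝ :=
  let a : ℕ → ℕ := fun j => (extIndex n k j).natAbs
  √((2 : ℝ) ^ (((d : ℤ) - 4) * ((d : ℤ) - 2)) / Real.Gamma ((d : ℝ) / 2) *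
    ∏ j ∈ Finset.range (d - 2),
      (2 : ℝ) ^ (2 * (a (j + 1) : ℤ) - (j : ℤ)) * ((a j - a (j + 1)).factorial : ℝ) *
        (2 * (a j : ℝ) + d - j - 2) * Real.Gamma (((d : ℝ) - j - 2) / 2 + a (j + 1)) ^ 2 /
        (√Real.pi * Real.Gamma ((a j : ℝ) + a (j + 1) + d - j - 2)))

/-- The spherical harmonic `Y_k^{d,n}` as a function of the angles:
`A_k^n ∏_{j=0}^{d-3} C_{k_j-|k_{j+1}|}^{(d-j-2)/2+|k_{j+1}|}(cos θ_{d-j-1})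
sin^{|k_{j+1}|}(θ_{d-j-1}) e^{i k_{d-2} θ_1}`. -/
def harmonicAngles (d n : ℕ) (k : Fin (d - 2) → ℤ) (θ : ℕ → ℝ) : ℂ :=
  let a : ℕ → ℕ := fun j => (extIndex n k j).natAbs
  ((normConst d n k * ∏ j ∈ Finset.range (d - 2),
    (gegenbauer (a j - a (j + 1)) (((d : ℝ) - j - 2) / 2 + a (j + 1)) (Real.cos (θ (d - j - 1))) *
      Real.sin (θ (d - j - 1)) ^ a (j + 1)) : ℝ) : ℂ) *
    Complex.exp (Complex.I * (extIndex n k (d - 2) : ℂ) * (θ 1 : ℂ))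

/-- The spherical harmonic `Y_k^{d,n}` on `𝕊^{d-1}`. -/
def Y (d n : ℕ) (k : Fin (d - 2) → ℤ) (x : Sphere d) : ℂ :=
  harmonicAngles d n k (angle (x : EuclideanSpace ℝ (Fin d)))

/-- The space `𝓗_n^d` of spherical harmonics of degree `n`. -/
def harmonicSpace (d n : ℕ) : Submodule ℂ (Sphere d → ℂ) :=
  Submodule.span ℂ {f | ∃ k ∈ indexSet d n, f = Y d n k}

/-- The space `Π_N(𝕊^{d-1})` of spherical polynomials of degree at most `N`. -/
def sphericalPoly (d N : ℕ) : Submodule ℂ (Sphere d → ℂ) :=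
  Submodule.span ℂ {f | ∃ n ≤ N, ∃ k ∈ indexSet d n, f = Y d n k}

/-- The space `Π_N(SO(d-1))` of restrictions to `SO(d-1)` of complex algebraic polynomials of
degree at most `N` in the matrix entries. (The last row and column of `h ∈ SO(d-1) ⊂ SO(d)` are
constant, so that using all `d²` entries gives the same functions as using the `(d-1)²` entries of
the upper left block; for `d = 3` it is the span of the exponentials of frequency at most `N` in
the rotation angle.) -/
def polySOsub (d N : ℕ) : Set (SOsub d → ℂ) :=
  {f | ∃ P : MvPolynomial (Fin d × Fin d) ℂ, P.totalDegree ≤ N ∧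
    ∀ h : SOsub d, f h =
      MvPolynomial.eval (fun p => (((h : SO d) : Matrix (Fin d) (Fin d) ℝ) p.1 p.2 : ℂ)) P}

/-! ## The wavelets -/

/-- The profile `κ(t) = √(φ²(t/2) - φ²(t))`. -/
def kappa (φ : ℝ → ℝ) (t : ℝ) : ℝ := √(φ (t / 2) ^ 2 - φ t ^ 2)

/-- The admissible directionality components `ζ_{K,k}^{d,n}`, written `ζ n k`. -/
structure IsDirectionality (d K : ℕ) (ζ : ℕ → (Fin (d - 2) → ℤ) → ℂ) : Prop where
  /-- `ζ` does not depend on `n` for `n ≥ K`. -/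
  indep : ∀ n n' k, K ≤ n → K ≤ n' → k ∈ indexSet d n → k ∈ indexSet d n' → ζ n k = ζ n' k
  /-- `ζ` vanishes whenever `|k_1| > K`. -/
  vanish : ∀ n, ∀ k ∈ indexSet d n, (K : ℤ) < |extIndex n k 1| → ζ n k = 0
  /-- `ζ` is normalised in each degree `n ≥ 1`. -/
  normalized : ∀ n, 1 ≤ n → ∑ k ∈ indexSet d n, ‖ζ n k‖ ^ 2 = 1

/-- The wavelet
`Ψ_K^j = ∑_n ∑_{k ∈ 𝓘_n^d} √(dim 𝓗_n^d) κ(n / 2^{j-1}) ζ_{K,k}^{d,n} Y_k^{d,n}`. -/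
def wavelet (d : ℕ) (φ : ℝ → ℝ) (ζ : ℕ → (Fin (d - 2) → ℤ) → ℂ) (j : ℕ) (x : Sphere d) : ℂ :=
  ∑' n : ℕ, ∑ k ∈ indexSet d n,
    ((√(Module.finrank ℂ (harmonicSpace d n)) * kappa φ (n / (2 : ℝ) ^ ((j : ℤ) - 1)) : ℝ) : ℂ) *
      ζ n k * Y d n k x

/-- The discretised wavelet `√(w u) T^d(g h) Ψ_K^j` at scale `j ≥ 1`, and the constant `1` at
scale `j = 0`. -/
def discreteWavelet (d : ℕ) (φ : ℝ → ℝ) (ζ : ℕ → (Fin (d - 2) → ℤ) → ℂ) (j : ℕ)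
    (w u : ℝ) (g : SO d) (h : SOsub d) : Sphere d → ℂ :=
  if j = 0 then fun _ => 1
  else fun x => (√(w * u) : ℂ) * rotateFun (g * (h : SO d)) (wavelet d φ ζ j) x

/-- The nodes `η_ℓ` and non-negative weights `w_ℓ` integrate `Π_N(𝕊^{d-1})` exactly. -/
def IsSphereQuadrature (d N : ℕ) {s : ℕ} (η : Fin s → Sphere d) (w : Fin s → ℝ) : Prop :=
  (∀ l, 0 ≤ w l) ∧
    ∀ f ∈ sphericalPoly d N, ∑ l, (w l : ℂ) * f (η l) = ∫ x, f x ∂(surfaceMeasure d)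

/-- The nodes `h_m` and positive weights `u_m` integrate `Π_N(SO(d-1))` exactly. -/
def IsRotationQuadrature (d N : ℕ) {r : ℕ} (h : Fin r → SOsub d) (u : Fin r → ℝ) : Prop :=
  (∀ m, 0 < u m) ∧
    ∀ f ∈ polySOsub d N, ∑ m, (u m : ℂ) * f (h m) = ∫ x, f x ∂(haarSOsub d)

end SphereWavelet

end

open MeasureTheory Set SphereWavelet

/-!
Why the wavelets form a tight frame.

**The spherical harmonics.** On the sphere, `Y d n k` is the restriction of a homogeneous polynomial
of degree `n`, the solid harmonic `solid`, which is built by adding one variable at a time: the step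
from `p + 2` to `p + 3` variables multiplies by a homogenised Gegenbauer polynomial. Surface integrals
of homogeneous polynomials are constant multiples of Gaussian expectations
(`gaussConst_mul_integral_evalSphere`), and under the Gaussian the new variable splits off
(`gaussFunctional_gegenbauerSolid_mul`), so that orthonormality, `innerL2_Y`, follows from the
orthogonality of the Gegenbauer polynomials and a telescoping product of Gamma functions. Conversely,
every polynomial is a combination of solid harmonics and powers of `|x|²` (`mem_solidSpan`), so the
spherical polynomials are exactly the restrictions of polynomials (`sphericalPoly_eq_polyFun`). They
are dense by the Stone–Weierstrass theorem, which gives Parseval's identity `hasSum_norm_innerL2_Y`.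

**Invariant kernels.** Since rotations preserve the degree of a polynomial, the reproducing kernel
`harmonicKernel d n` of the harmonics of degree `n` is rotation invariant. Conversely a rotation
invariant kernel that is a polynomial of degree `N` in one variable is a combination of these kernels
with `n ≤ N` (`exists_eq_sum_harmonicKernel`): its value at `(x, e^d)` is a polynomial in the height
of `x`, hence a combination of zonal harmonics.

**One scale.** For a finite family of functions `a_i`, the sum `∑ |⟨f, a_i⟩|²` depends only on the
kernel `∑ a_i(x) conj (a_i(y))` (`sum_norm_sq_innerL2`). For the wavelets `Ψ` of scale `j` this kernel
is a quadrature sum over `g_η h`. In `h` the summand has degree at most `2 min(K, 2^j)`, because the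
orders satisfy `|k_1| ≤ K` (`wavelet_rotate_inv_mem`), so the sum over `h` is the average over
`SO(d-1)`. The average depends on `g_η` only through `η = g_η e^d`, and as a function of `η` it is a
spherical polynomial of degree `2 · 2^j` (`exists_sphericalPoly_averagedKernel`). The latter is not
obvious, as there is no polynomial choice of `g_η`; it rests on
`mem_sphericalPoly_of_comp_rotate_pole`: a function on the sphere whose pullback to `SO(d)` is a
polynomial of degree `N` in the matrix entries is orthogonal to all harmonics of degree above `N`,
hence a spherical polynomial. So the sum over `η` is an integral as well, and the discretised kernel is rotation invariant, that is, a
combination of reproducing kernels (`exists_discreteKernel_eq`). Its coefficients are found by testing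
with the harmonics: the coefficient in degree `n` is the squared norm of the degree `n` part of `Ψ`
divided by `dim H_n`, which is `κ(n / 2^{j-1})²` (`sum_norm_sq_innerL2_discrete`,
`sum_norm_sq_innerL2_wavelet`).

**All scales.** As `κ(t)² = φ(t/2)² - φ(t)²`, the sum over the scales telescopes to Parseval's
identity (`hasSum_scales`).
-/

noncomputable section

namespace SphereWavelet

/-! ### Gegenbauer polynomials and their orthogonality -/

/-- The moments of the symmetric beta weight `(1 - t²)^{λ - 1/2}` on `[-1, 1]`, normalised to
total mass one, defined through the recursion that they satisfy. -/
def betaMoment (lam : ℝ) : ℕ → ℝ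
  | 0 => 1
  | 1 => 0
  | i + 2 => (i + 1) / (i + 2 + 2 * lam) * betaMoment lam i

/-- Integration of polynomials against the normalised weight `(1 - t²)^{λ - 1/2}`, as a linear
functional given by its moments. -/
def betaFunctional (lam : ℝ) : Polynomial ℝ →ₗ[ℝ] ℝ :=
  (Polynomial.basisMonomials ℝ).constr ℝ (betaMoment lam)

theorem betaFunctional_monomial (lam : ℝ) (i : ℕ) (c : ℝ) :
    betaFunctional lam (Polynomial.monomial i c) = c * betaMoment lam i := by
  have h1 : Polynomial.monomial i c = c • Polynomial.monomial i (1 : ℝ) := by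
    rw [Polynomial.smul_monomial, smul_eq_mul, mul_one]
  rw [h1, map_smul, smul_eq_mul, betaFunctional]
  congr 1
  have := (Polynomial.basisMonomials ℝ).constr_basis ℝ (betaMoment lam) i
  simpa using this

theorem betaFunctional_C_mul_X_pow (lam : ℝ) (i : ℕ) (c : ℝ) :
    betaFunctional lam (Polynomial.C c * Polynomial.X ^ i) = c * betaMoment lam i := by
  rw [Polynomial.C_mul_X_pow_eq_monomial, betaFunctional_monomial]

open Polynomial in
/-- Integration by parts for the beta weight: the integral of
`((1 - t²)^{λ + 1/2} p)' = (1 - t²)^{λ - 1/2} ((1 - t²) p' - (2 λ + 1) t p)` vanishes. -/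
theorem betaFunctional_by_parts {lam : ℝ} (hl : 0 < lam) (p : ℝ[X]) :
    betaFunctional lam ((1 - X ^ 2) * derivative p - C (2 * lam + 1) * (X * p)) = 0 := by
  induction p using Polynomial.induction_on' with
  | add p q hp hq =>
    rw [derivative_add]
    rw [show (1 - X ^ 2) * (derivative p + derivative q) - C (2 * lam + 1) * (X * (p + q)) =
      ((1 - X ^ 2) * derivative p - C (2 * lam + 1) * (X * p)) +
      ((1 - X ^ 2) * derivative q - C (2 * lam + 1) * (X * q)) by ring, map_add, hp, hq, add_zero]
  | monomial k a =>
    rw [derivative_monomial, ← C_mul_X_pow_eq_monomial, ← C_mul_X_pow_eq_monomial]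
    rcases k with _ | k
    · rw [show (1 - X ^ 2) * (C (a * ((0 : ℕ) : ℝ)) * X ^ (0 - 1)) -
        C (2 * lam + 1) * (X * (C a * X ^ 0)) = C (-(2 * lam + 1) * a) * X ^ 1 by
        simp; ring]
      rw [betaFunctional_C_mul_X_pow]
      simp [betaMoment]
    · rw [show (1 - X ^ 2) * (C (a * ((k + 1 : ℕ) : ℝ)) * X ^ (k + 1 - 1)) -
        C (2 * lam + 1) * (X * (C a * X ^ (k + 1))) = C (a * (k + 1)) * X ^ k -
          C (a * (k + 1 + 2 * lam + 1)) * X ^ (k + 2) by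
        simp; ring]
      rw [map_sub, betaFunctional_C_mul_X_pow, betaFunctional_C_mul_X_pow, betaMoment]
      have : (k : ℝ) + 2 + 2 * lam ≠ 0 := by positivity
      field_simp
      ring

open Polynomial in
/-- The factor `1 - t²` raises the exponent of the weight, hence `λ`, by one; the constant is the
ratio of the total masses. -/
theorem betaFunctional_one_sub_sq_mul {lam : ℝ} (hl : 0 < lam) (p : ℝ[X]) :
    betaFunctional lam ((1 - X ^ 2) * p) =
      (lam + 1 / 2) / (lam + 1) * betaFunctional (lam + 1) p := by
  induction p using Polynomial.induction_on' with
  | add p q hp hq => rw [mul_add, map_add, hp, hq, map_add]; ring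
  | monomial k a =>
    have key : ∀ k, betaMoment lam k - betaMoment lam (k + 2) =
        (lam + 1 / 2) / (lam + 1) * betaMoment (lam + 1) k := by
      intro k
      induction k using Nat.twoStepInduction with
      | zero =>
        simp only [betaMoment]
        field_simp
        norm_num
        ring
      | one => simp [betaMoment]
      | more k ih _ =>
        have h1 : betaMoment lam (k + 2) = (k + 1) / (k + 2 + 2 * lam) * betaMoment lam k := rfl
        have h1' : betaMoment lam (k + 2 + 2) =
          ((k + 2 : ℕ) + 1) / ((k + 2 : ℕ) + 2 + 2 * lam) * betaMoment lam (k + 2) := rfl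
        have h5 : betaMoment (lam + 1) (k + 2) =
          (k + 1) / (k + 2 + 2 * (lam + 1)) * betaMoment (lam + 1) k := rfl
        rw [h5, h1', h1]
        rw [h1] at ih
        have h0 : (k : ℝ) + 2 + 2 * lam ≠ 0 := by positivity
        have h2 : ((k + 2 : ℕ) : ℝ) + 2 + 2 * lam ≠ 0 := by positivity
        have h3 : (k : ℝ) + 2 + 2 * (lam + 1) ≠ 0 := by positivity
        have h4 : lam + 1 ≠ 0 := by positivity
        rw [mul_left_comm ((lam + 1 / 2) / (lam + 1)), ← ih]
        push_cast at h2 ⊢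
        field_simp
        ring
    rw [← C_mul_X_pow_eq_monomial, show (1 - X ^ 2) * (C a * X ^ k) =
      C a * X ^ k - C a * X ^ (k + 2) by ring, map_sub, betaFunctional_C_mul_X_pow,
      betaFunctional_C_mul_X_pow, betaFunctional_C_mul_X_pow, ← mul_sub, key]
    ring

/-- The coefficient of `t^{m-2i}` in the Gegenbauer polynomial `C_m^λ`. -/
def gegenbauerCoeff (m : ℕ) (lam : ℝ) (i : ℕ) : ℝ :=
  (-1) ^ i * Real.Gamma ((m - i : ℕ) + lam) /
      (Real.Gamma lam * (i.factorial : ℝ) * ((m - 2 * i).factorial : ℝ)) * 2 ^ (m - 2 * i)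

open Polynomial in
/-- The Gegenbauer polynomial `C_m^λ` as a formal polynomial. -/
def gegenbauerPoly (m : ℕ) (lam : ℝ) : ℝ[X] :=
  ∑ i ∈ Finset.range (m / 2 + 1), C (gegenbauerCoeff m lam i) * X ^ (m - 2 * i)

theorem eval_gegenbauerPoly (m : ℕ) (lam t : ℝ) :
    (gegenbauerPoly m lam).eval t = gegenbauer m lam t := by
  rw [gegenbauerPoly, gegenbauer, Polynomial.eval_finsetSum]
  refine Finset.sum_congr rfl fun i _ => ?_
  simp [gegenbauerCoeff, mul_pow]
  ring

theorem gegenbauerPoly_zero {lam : ℝ} (hl : 0 < lam) : gegenbauerPoly 0 lam = 1 := by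
  have := (Real.Gamma_pos_of_pos hl).ne'
  simp [gegenbauerPoly, gegenbauerCoeff, this]

theorem gegenbauerCoeff_zero_pos (m : ℕ) {lam : ℝ} (hl : 0 < lam) :
    0 < gegenbauerCoeff m lam 0 := by
  have h1 := Real.Gamma_pos_of_pos hl
  have h2 : 0 < Real.Gamma ((m - 0 : ℕ) + lam) := Real.Gamma_pos_of_pos (by positivity)
  rw [gegenbauerCoeff]
  positivity

/-- The recursion of the coefficients which expresses the Gegenbauer differential equation. -/
theorem gegenbauerCoeff_succ {m i : ℕ} (hi : 2 * (i + 1) ≤ m) {lam : ℝ} (hl : 0 < lam) :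
    gegenbauerCoeff m lam i * ((m - 2 * i : ℕ) * ((m - 2 * i : ℕ) - 1)) =
      -(4 * ((i + 1 : ℕ) : ℝ) * ((m : ℝ) - (i + 1 : ℕ) + lam) * gegenbauerCoeff m lam (i + 1)) := by
  obtain ⟨t, rfl⟩ := Nat.exists_eq_add_of_le hi
  have h1 : 2 * (i + 1) + t - i = (i + t + 1) + 1 := by omega
  have h2 : 2 * (i + 1) + t - 2 * i = t + 1 + 1 := by omega
  have h3 : 2 * (i + 1) + t - (i + 1) = i + t + 1 := by omega
  have h4 : 2 * (i + 1) + t - 2 * (i + 1) = t := by omega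
  rw [gegenbauerCoeff, gegenbauerCoeff, h1, h2, h3, h4]
  have hg := (Real.Gamma_pos_of_pos hl).ne'
  rw [show ((i + t + 1 + 1 : ℕ) : ℝ) + lam = ((i + t + 1 : ℕ) : ℝ) + lam + 1 by push_cast; ring,
    Real.Gamma_add_one (by positivity), Nat.factorial_succ, Nat.factorial_succ, Nat.factorial_succ]
  push_cast
  field_simp
  ring

open Polynomial in
theorem derivative_gegenbauerPoly (m : ℕ) {lam : ℝ} (hl : 0 < lam) :
    derivative (gegenbauerPoly (m + 1) lam) = C (2 * lam) * gegenbauerPoly m (lam + 1) := by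
  have hg := (Real.Gamma_pos_of_pos hl).ne'
  have key : ∀ i, 2 * i ≤ m →
      derivative (C (gegenbauerCoeff (m + 1) lam i) * X ^ (m + 1 - 2 * i)) =
        C (2 * lam) * (C (gegenbauerCoeff m (lam + 1) i) * X ^ (m - 2 * i)) := by
    intro i hi
    rw [derivative_C_mul_X_pow, ← mul_assoc, ← C_mul]
    obtain ⟨t, rfl⟩ := Nat.exists_eq_add_of_le hi
    have h1 : 2 * i + t + 1 - 2 * i = t + 1 := by omega
    have h2 : 2 * i + t - 2 * i = t := by omega
    have h3 : 2 * i + t + 1 - i = i + t + 1 := by omega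
    have h4 : 2 * i + t - i = i + t := by omega
    congr 2
    · rw [gegenbauerCoeff, gegenbauerCoeff, h1, h2, h3, h4, Real.Gamma_add_one hl.ne',
        Nat.factorial_succ]
      rw [show ((i + t + 1 : ℕ) : ℝ) + lam = ((i + t : ℕ) : ℝ) + (lam + 1) by push_cast; ring]
      push_cast
      field_simp
      ring
    · rw [h1, h2]; rfl
  rw [gegenbauerPoly, gegenbauerPoly, derivative_sum, Finset.mul_sum]
  rcases Nat.even_or_odd' m with ⟨t, rfl | rfl⟩
  · rw [show (2 * t + 1) / 2 = 2 * t / 2 by omega]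
    exact Finset.sum_congr rfl fun i hi => key i (by rw [Finset.mem_range] at hi; omega)
  · rw [show (2 * t + 1 + 1) / 2 = (2 * t + 1) / 2 + 1 by omega, Finset.sum_range_succ]
    rw [show 2 * t + 1 + 1 - 2 * ((2 * t + 1) / 2 + 1) = 0 by omega]
    rw [pow_zero, mul_one, derivative_C, add_zero]
    exact Finset.sum_congr rfl fun i hi => key i (by rw [Finset.mem_range] at hi; omega)

open Polynomial in
/-- The Gegenbauer differential equation. -/
theorem gegenbauerPoly_ode (m : ℕ) {lam : ℝ} (hl : 0 < lam) :
    (1 - X ^ 2) * derivative (derivative (gegenbauerPoly m lam)) -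
      C (2 * lam + 1) * (X * derivative (gegenbauerPoly m lam)) =
      - (C (m * (m + 2 * lam)) * gegenbauerPoly m lam) := by
  -- Applied to the `i`-th term, the operator gives `u i - v i` with `v (i + 1) = u i`.
  set u : ℕ → ℝ[X] := fun i => C (gegenbauerCoeff m lam i *
    ((m - 2 * i : ℕ) * ((m - 2 * i : ℕ) - 1))) * X ^ (m - 2 * (i + 1)) with hu
  set v : ℕ → ℝ[X] := fun i => C (-(4 * (i : ℝ) * ((m : ℝ) - i + lam) * gegenbauerCoeff m lam i)) *
    X ^ (m - 2 * i) with hv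
  have hvu : ∀ i, 2 * (i + 1) ≤ m → v (i + 1) = u i := by
    intro i hi
    simp only [hu, hv]
    rw [gegenbauerCoeff_succ hi hl]
  have hterm : ∀ i, 2 * i ≤ m →
      (1 - X ^ 2) * derivative (derivative (C (gegenbauerCoeff m lam i) * X ^ (m - 2 * i))) -
      C (2 * lam + 1) * (X * derivative (C (gegenbauerCoeff m lam i) * X ^ (m - 2 * i))) +
      C (m * (m + 2 * lam)) * (C (gegenbauerCoeff m lam i) * X ^ (m - 2 * i)) = u i - v i := by
    intro i hi
    obtain ⟨t, rfl⟩ := Nat.exists_eq_add_of_le hi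
    have h2 : 2 * i + t - 2 * i = t := by omega
    have h3 : 2 * i + t - 2 * (i + 1) = t - 2 := by omega
    simp only [hu, hv, h2, h3]
    generalize gegenbauerCoeff (2 * i + t) lam i = c
    refine Polynomial.funext fun x => ?_
    rcases t with _ | _ | t
    · simp
      left
      ring
    · simp
      ring
    · simp
      ring
  have hsum : ∀ n, 2 * n ≤ m → ∑ i ∈ Finset.range (n + 1), (u i - v i) = u n := by
    intro n
    induction n with
    | zero => intro _; simp [hv]
    | succ n ih =>
      intro hn
      rw [Finset.sum_range_succ, ih (by omega), hvu n hn]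
      ring
  have hlast : u (m / 2) = 0 := by
    simp only [hu]
    rcases Nat.even_or_odd' m with ⟨t, ht | ht⟩
    · rw [show m - 2 * (m / 2) = 0 by omega]; simp
    · rw [show m - 2 * (m / 2) = 1 by omega]; simp
  rw [eq_neg_iff_add_eq_zero, ← hlast, ← hsum (m / 2) (by omega), gegenbauerPoly]
  simp only [derivative_sum, Finset.mul_sum]
  rw [← Finset.sum_sub_distrib, ← Finset.sum_add_distrib]
  exact Finset.sum_congr rfl fun i hi => hterm i (by rw [Finset.mem_range] at hi; omega)

open Polynomial in
/-- The Gegenbauer operator is symmetric: its eigenvalue equation for `C_m^λ`, integrated by parts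
against a polynomial `q`. -/
theorem betaFunctional_gegenbauerPoly_mul (m : ℕ) {lam : ℝ} (hl : 0 < lam) (q : ℝ[X]) :
    m * (m + 2 * lam) * betaFunctional lam (gegenbauerPoly m lam * q) =
      betaFunctional lam ((1 - X ^ 2) * (derivative (gegenbauerPoly m lam) * derivative q)) := by
  have h1 := betaFunctional_by_parts hl (derivative (gegenbauerPoly m lam) * q)
  have h2 := gegenbauerPoly_ode m hl
  rw [derivative_mul, show (1 - X ^ 2) * (derivative (derivative (gegenbauerPoly m lam)) * q +
      derivative (gegenbauerPoly m lam) * derivative q) -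
      C (2 * lam + 1) * (X * (derivative (gegenbauerPoly m lam) * q)) =
      ((1 - X ^ 2) * derivative (derivative (gegenbauerPoly m lam)) -
      C (2 * lam + 1) * (X * derivative (gegenbauerPoly m lam))) * q +
      (1 - X ^ 2) * (derivative (gegenbauerPoly m lam) * derivative q) by ring, h2, map_add,
    show -(C (m * (m + 2 * lam)) * gegenbauerPoly m lam) * q =
      -((m * (m + 2 * lam)) • (gegenbauerPoly m lam * q)) by
        rw [smul_eq_C_mul]; ring, map_neg, map_smul, smul_eq_mul] at h1
  linarith

theorem betaFunctional_gegenbauerPoly_of_ne {m n : ℕ} (hmn : m ≠ n) {lam : ℝ} (hl : 0 < lam) :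
    betaFunctional lam (gegenbauerPoly m lam * gegenbauerPoly n lam) = 0 := by
  have h1 := betaFunctional_gegenbauerPoly_mul m hl (gegenbauerPoly n lam)
  have h2 := betaFunctional_gegenbauerPoly_mul n hl (gegenbauerPoly m lam)
  rw [mul_comm (gegenbauerPoly n lam), mul_comm (Polynomial.derivative (gegenbauerPoly n lam)),
    ← h1] at h2
  have h3 : ((n : ℝ) - m) * (n + m + 2 * lam) *
      betaFunctional lam (gegenbauerPoly m lam * gegenbauerPoly n lam) = 0 := by
    linear_combination h2
  rcases mul_eq_zero.mp h3 with h | h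
  · rcases mul_eq_zero.mp h with h | h
    · exact absurd (by exact_mod_cast (sub_eq_zero.mp h).symm) hmn
    · exact absurd h (by positivity)
  · exact h

open Polynomial in
/-- The norm of the Gegenbauer polynomials, by induction over the degree with the parameter
raised by one: the derivative of `C_{m+1}^λ` is `2 λ C_m^{λ+1}`. -/
theorem betaFunctional_gegenbauerPoly_self (m : ℕ) {lam : ℝ} (hl : 0 < lam) :
    betaFunctional lam (gegenbauerPoly m lam * gegenbauerPoly m lam) =
      lam / (m + lam) * (Real.Gamma (2 * lam + m) / (Real.Gamma (2 * lam) * m.factorial)) := by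
  induction m generalizing lam with
  | zero =>
    have := (Real.Gamma_pos_of_pos (show 0 < 2 * lam by positivity)).ne'
    rw [gegenbauerPoly_zero hl, show (1 : ℝ[X]) * 1 = C 1 * X ^ 0 by simp,
      betaFunctional_C_mul_X_pow]
    simp [betaMoment, this, hl.ne']
  | succ m ih =>
    have h1 := betaFunctional_gegenbauerPoly_mul (m + 1) hl (gegenbauerPoly (m + 1) lam)
    rw [betaFunctional_one_sub_sq_mul hl, derivative_gegenbauerPoly m hl,
      show C (2 * lam) * gegenbauerPoly m (lam + 1) * (C (2 * lam) * gegenbauerPoly m (lam + 1)) =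
        (2 * lam * (2 * lam)) • (gegenbauerPoly m (lam + 1) * gegenbauerPoly m (lam + 1)) by
        rw [smul_eq_C_mul, C_mul (a := 2 * lam) (b := 2 * lam)]; ring, map_smul, smul_eq_mul,
      ih (by positivity : 0 < lam + 1)] at h1
    have hg := (Real.Gamma_pos_of_pos (show 0 < 2 * lam by positivity)).ne'
    rw [show 2 * (lam + 1) + (m : ℝ) = (2 * lam + (m + 1 : ℕ)) + 1 by push_cast; ring,
      Real.Gamma_add_one (by positivity), show 2 * (lam + 1) = 2 * lam + 1 + 1 by ring,
      Real.Gamma_add_one (s := 2 * lam + 1) (by positivity),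
      Real.Gamma_add_one (s := 2 * lam) (by positivity)] at h1
    have hne : ((m + 1 : ℕ) : ℝ) * ((m + 1 : ℕ) + 2 * lam) ≠ 0 := by positivity
    rw [← mul_right_inj' hne, h1, Nat.factorial_succ]
    push_cast
    field_simp
    ring

/-! ### The Gaussian functional on polynomials -/

/-- The moments of the standard normal distribution. -/
def gaussMoment : ℕ → ℝ
  | 0 => 1
  | 1 => 0
  | i + 2 => (i + 1) * gaussMoment i

open MvPolynomial

/-- The expectation of a polynomial in independent standard normal variables `X_0, X_1, …`. -/
def gaussFunctional : MvPolynomial ℕ ℂ →ₗ[ℂ] ℂ :=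
  (basisMonomials ℕ ℂ).constr ℂ fun α => ((α.prod fun _ a => gaussMoment a : ℝ) : ℂ)

theorem gaussFunctional_monomial (α : ℕ →₀ ℕ) (c : ℂ) :
    gaussFunctional (monomial α c) = c * ((α.prod fun _ a => gaussMoment a : ℝ) : ℂ) := by
  have h1 : monomial α c = c • monomial α (1 : ℂ) := by
    rw [smul_monomial, smul_eq_mul, mul_one]
  rw [h1, map_smul, smul_eq_mul, gaussFunctional]
  congr 1
  have := (basisMonomials ℕ ℂ).constr_basis ℂ
    (fun α => ((α.prod fun _ a => gaussMoment a : ℝ) : ℂ)) α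
  simpa using this

theorem gaussFunctional_C_mul (c : ℂ) (P : MvPolynomial ℕ ℂ) :
    gaussFunctional (C c * P) = c * gaussFunctional P := by
  rw [C_mul', map_smul, smul_eq_mul]

/-- Gaussian integration by parts. -/
theorem gaussFunctional_X_mul (l : ℕ) (P : MvPolynomial ℕ ℂ) :
    gaussFunctional (X l * P) = gaussFunctional (pderiv l P) := by
  induction P using MvPolynomial.induction_on' with
  | add p q hp hq => rw [mul_add, map_add, hp, hq, map_add, map_add]
  | monomial α c =>
    rw [pderiv_monomial, X, monomial_mul, one_mul, gaussFunctional_monomial,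
      gaussFunctional_monomial]
    have hsplit : ∀ β : ℕ →₀ ℕ, (β.prod fun _ a => gaussMoment a) =
        gaussMoment (β l) * ((β.erase l).prod fun _ a => gaussMoment a) := fun β =>
      (Finsupp.mul_prod_erase' β l (fun _ a => gaussMoment a) fun _ => rfl).symm
    rw [hsplit (Finsupp.single l 1 + α), hsplit (α - Finsupp.single l 1)]
    have he1 : (Finsupp.single l 1 + α).erase l = α.erase l := by
      ext i
      by_cases hi : i = l
      · simp [hi]
      · simp [Finsupp.erase_ne hi]
    have he2 : (α - Finsupp.single l 1).erase l = α.erase l := by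
      ext i
      by_cases hi : i = l
      · simp [hi]
      · simp [Finsupp.erase_ne hi, hi]
    rw [he1, he2, mul_assoc]
    congr 1
    rw [Finsupp.add_apply, Finsupp.tsub_apply, Finsupp.single_eq_same]
    rcases h : α l with _ | a
    · simp [gaussMoment]
    · rw [show 1 + (a + 1) = a + 2 by ring, gaussMoment]
      push_cast
      ring_nf

theorem pderiv_eq_zero_of_mem_supported {m l : ℕ} (hl : m ≤ l) {P : MvPolynomial ℕ ℂ}
    (hP : P ∈ supported ℂ (Iio m)) : pderiv l P = 0 := by
  refine pderiv_eq_zero_of_notMem_vars fun h => ?_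
  have := mem_supported.mp hP h
  rw [mem_Iio] at this
  omega

/-- Independence of the variable `X_m` from the preceding ones. -/
theorem gaussFunctional_X_pow_mul {m : ℕ} {P : MvPolynomial ℕ ℂ}
    (hP : P ∈ supported ℂ (Iio m)) (a : ℕ) :
    gaussFunctional (X m ^ a * P) = gaussMoment a * gaussFunctional P := by
  have h0 := pderiv_eq_zero_of_mem_supported le_rfl hP
  induction a using Nat.twoStepInduction with
  | zero => simp [gaussMoment]
  | one => rw [pow_one, gaussFunctional_X_mul, h0]; simp [gaussMoment]
  | more a ih _ =>
    rw [show X m ^ (a + 2) * P = X m * (X m ^ (a + 1) * P) by ring, gaussFunctional_X_mul,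
      pderiv_mul, h0, mul_zero, add_zero, pderiv_pow, pderiv_X_self, mul_one,
      show ((a + 1 : ℕ) : MvPolynomial ℕ ℂ) * X m ^ (a + 1 - 1) * P =
        C ((a + 1 : ℕ) : ℂ) * (X m ^ a * P) by simp; ring, gaussFunctional_C_mul, ih, gaussMoment]
    push_cast
    ring

/-- The polynomial `X_0² + … + X_{m-1}²`. -/
def rhoPoly (m : ℕ) : MvPolynomial ℕ ℂ := ∑ l ∈ Finset.range m, X l ^ 2

theorem rhoPoly_succ (m : ℕ) : rhoPoly (m + 1) = rhoPoly m + X m ^ 2 :=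
  Finset.sum_range_succ _ _

theorem rhoPoly_mem_supported (m : ℕ) : rhoPoly m ∈ supported ℂ (Iio m) :=
  Subalgebra.sum_mem _ fun l hl =>
    Subalgebra.pow_mem _ (X_mem_supported.mpr (by simpa using hl)) _

theorem isHomogeneous_rhoPoly (m : ℕ) : (rhoPoly m).IsHomogeneous 2 :=
  IsHomogeneous.sum _ _ _ fun l _ => isHomogeneous_X_pow l 2

/-- Euler's identity for homogeneous polynomials in the first `m` variables. -/
theorem sum_range_X_mul_pderiv {m D : ℕ} {P : MvPolynomial ℕ ℂ}
    (hP : P ∈ supported ℂ (Iio m)) (hD : P.IsHomogeneous D) :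
    ∑ l ∈ Finset.range m, X l * pderiv l P = D • P := by
  conv_lhs => rw [P.as_sum]
  conv_rhs => rw [P.as_sum]
  simp_rw [map_sum, Finset.mul_sum, X_mul_pderiv_monomial]
  rw [Finset.sum_comm, Finset.smul_sum]
  refine Finset.sum_congr rfl fun α hα => ?_
  rw [← Finset.sum_smul]
  congr 1
  rw [hD.degree_eq_sum_deg_support hα]
  refine (Finset.sum_subset ?_ ?_).symm
  · intro l hl
    have h1 : l ∈ P.vars := (mem_vars_iff_mem_support l).mpr ⟨α, hα, hl⟩
    simpa using mem_supported.mp hP h1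
  · intro l _ hl
    simpa using hl

/-- The radial moments: integration by parts in every variable, followed by Euler's identity for
homogeneous polynomials. -/
theorem gaussFunctional_rhoPoly_mul {m D : ℕ} {P : MvPolynomial ℕ ℂ}
    (hP : P ∈ supported ℂ (Iio m)) (hD : P.IsHomogeneous D) :
    gaussFunctional (rhoPoly m * P) = (D + m) * gaussFunctional P := by
  have h1 : ∀ l, gaussFunctional (X l ^ 2 * P) =
      gaussFunctional P + gaussFunctional (X l * pderiv l P) := by
    intro l
    rw [pow_two, mul_assoc, gaussFunctional_X_mul, pderiv_mul, pderiv_X_self, one_mul, map_add]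
  rw [rhoPoly, Finset.sum_mul, map_sum, Finset.sum_congr rfl fun l _ => h1 l,
    Finset.sum_add_distrib, ← map_sum gaussFunctional (fun l => X l * pderiv l P), sum_range_X_mul_pderiv hP hD, map_nsmul]
  simp
  ring

/-- The ratio between Gaussian and spherical moments of degree `e` in dimension `2 λ + 2`
(relevant for even `e` only). -/
def gaussConst (lam : ℝ) : ℕ → ℝ
  | 0 => 1
  | 1 => 1
  | e + 2 => (2 * lam + 2 + e) * gaussConst lam e

theorem gaussConst_pos {lam : ℝ} (hl : -1 < lam) (e : ℕ) : 0 < gaussConst lam e := by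
  induction e using Nat.twoStepInduction with
  | zero => exact one_pos
  | one => exact one_pos
  | more e ih _ =>
    have : 0 < 2 * lam + 2 + e := by
      have : (0 : ℝ) ≤ e := by positivity
      linarith
    exact mul_pos this ih

theorem gaussConst_two_mul {lam : ℝ} (hl : -1 < lam) (a : ℕ) :
    gaussConst lam (2 * a) = 2 ^ a * Real.Gamma (lam + 1 + a) / Real.Gamma (lam + 1) := by
  induction a with
  | zero =>
    have := (Real.Gamma_pos_of_pos (show 0 < lam + 1 by linarith)).ne'
    simp [gaussConst, this]
  | succ a ih =>
    have h0 : lam + 1 + a ≠ 0 := by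
      have : (0 : ℝ) ≤ a := by positivity
      linarith
    rw [show 2 * (a + 1) = 2 * a + 2 by ring, gaussConst, ih]
    push_cast
    rw [show lam + 1 + ((a : ℝ) + 1) = lam + 1 + a + 1 by ring, Real.Gamma_add_one h0]
    ring

/-- One variable in dimension `2 λ + 2`: the Gaussian moment is the product of a radial moment and
a moment of the beta weight. -/
theorem gaussMoment_eq {lam : ℝ} (hl : 0 ≤ lam) (i : ℕ) :
    gaussMoment i = gaussConst lam i * betaMoment lam i := by
  induction i using Nat.twoStepInduction with
  | zero => simp [gaussMoment, gaussConst, betaMoment]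
  | one => simp [gaussMoment, betaMoment]
  | more i ih _ =>
    have : (i : ℝ) + 2 + 2 * lam ≠ 0 := by positivity
    rw [gaussMoment, gaussConst, betaMoment, ih]
    field_simp
    ring

/-- Gaussian integrals of `q(X_m, |(X_0, …, X_m)|²) A(X_0, …, X_{m-1})` reduce to the integral
of `A` and a beta integral in one variable. -/
theorem gaussFunctional_X_pow_mul_rhoPoly_pow_mul {m D : ℕ} {A : MvPolynomial ℕ ℂ}
    (hA : A ∈ supported ℂ (Iio m)) (hD : A.IsHomogeneous D) {lam : ℝ} (hl : 0 ≤ lam)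
    (hlam : 2 * lam + 1 = m + D) (i s : ℕ) :
    gaussFunctional (X m ^ i * rhoPoly (m + 1) ^ s * A) =
      gaussConst lam (i + 2 * s) * betaMoment lam i * gaussFunctional A := by
  have hlam' : (2 : ℂ) * lam + 1 = m + D := by exact_mod_cast hlam
  have hA' : A ∈ supported ℂ (Iio (m + 1)) :=
    supported_mono (Iio_subset_Iio (Nat.le_succ m)) hA
  induction s with
  | zero =>
    rw [pow_zero, mul_one, gaussFunctional_X_pow_mul hA, gaussMoment_eq hl]
    push_cast
    rfl
  | succ s ih =>
    have h1 : X m ^ i * rhoPoly (m + 1) ^ s * A ∈ supported ℂ (Iio (m + 1)) :=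
      Subalgebra.mul_mem _ (Subalgebra.mul_mem _
        (Subalgebra.pow_mem _ (X_mem_supported.mpr (by simp)) _)
        (Subalgebra.pow_mem _ (rhoPoly_mem_supported _) _)) hA'
    have h2 : (X m ^ i * rhoPoly (m + 1) ^ s * A).IsHomogeneous (i + 2 * s + D) :=
      ((isHomogeneous_X_pow m i).mul ((isHomogeneous_rhoPoly _).pow s)).mul hD
    rw [show X m ^ i * rhoPoly (m + 1) ^ (s + 1) * A =
      rhoPoly (m + 1) * (X m ^ i * rhoPoly (m + 1) ^ s * A) by ring,
      gaussFunctional_rhoPoly_mul h1 h2, ih, show i + 2 * (s + 1) = i + 2 * s + 2 by ring,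
      gaussConst]
    push_cast
    linear_combination (-(gaussConst lam (i + 2 * s) : ℂ) * betaMoment lam i *
      gaussFunctional A) * hlam'

/-! ### Solid harmonics -/

/-- The homogeneous polynomial `(X_1 + i X_0)^k` for `k ≥ 0` and `(X_1 - i X_0)^{-k}` for `k < 0`,
which is `r^{|k|} e^{i k θ}` for `(X_0, X_1) = r (sin θ, cos θ)`. -/
def planarPoly (k : ℤ) : MvPolynomial ℕ ℂ :=
  if 0 ≤ k then (X 1 + C Complex.I * X 0) ^ k.natAbs else (X 1 - C Complex.I * X 0) ^ k.natAbs

/-- The homogeneous polynomial `|x|^a C_a^λ(x_m / |x|)` in `x = (X_0, …, X_m)`. -/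
def gegenbauerSolid (a : ℕ) (lam : ℝ) (m : ℕ) : MvPolynomial ℕ ℂ :=
  ∑ i ∈ Finset.range (a / 2 + 1),
    C (gegenbauerCoeff a lam i : ℂ) * (X m ^ (a - 2 * i) * rhoPoly (m + 1) ^ i)

/-- The solid harmonics in the variables `X_0, …, X_{p+1}`, built up one variable at a time;
`c p` is the degree and `c (p-1), …, c 0` are the lower indices. -/
def solid (c : ℕ → ℤ) : ℕ → MvPolynomial ℕ ℂ
  | 0 => planarPoly (c 0)
  | p + 1 => gegenbauerSolid ((c (p + 1)).natAbs - (c p).natAbs)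
      (((p : ℝ) + 1) / 2 + (c p).natAbs) (p + 2) * solid c p

/-- The index chain `|c i| ≤ c (i + 1)` for `i < p`. -/
def IsChainIndex (c : ℕ → ℤ) (p : ℕ) : Prop := ∀ i < p, |c i| ≤ c (i + 1)

theorem IsChainIndex.mono {c : ℕ → ℤ} {p q : ℕ} (h : IsChainIndex c p) (hq : q ≤ p) :
    IsChainIndex c q := fun i hi => h i (by omega)

theorem IsChainIndex.natAbs_le {c : ℕ → ℤ} {p : ℕ} (h : IsChainIndex c (p + 1)) :
    (c p).natAbs ≤ (c (p + 1)).natAbs := by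
  have h1 := h p (by omega)
  rw [Int.abs_eq_natAbs] at h1
  omega

theorem isHomogeneous_planarPoly (k : ℤ) : (planarPoly k).IsHomogeneous k.natAbs := by
  have h1 := (isHomogeneous_X ℂ (1 : ℕ)).add (isHomogeneous_C_mul_X Complex.I 0)
  have h2 := (isHomogeneous_X ℂ (1 : ℕ)).sub (isHomogeneous_C_mul_X Complex.I 0)
  rw [planarPoly]
  split_ifs
  · simpa using h1.pow k.natAbs
  · simpa using h2.pow k.natAbs

theorem planarPoly_mem_supported (k : ℤ) : planarPoly k ∈ supported ℂ (Iio 2) := by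
  have h0 : (X 0 : MvPolynomial ℕ ℂ) ∈ supported ℂ (Iio 2) := X_mem_supported.mpr (by simp)
  have h1 : (X 1 : MvPolynomial ℕ ℂ) ∈ supported ℂ (Iio 2) := X_mem_supported.mpr (by simp)
  have h2 : C Complex.I * X 0 ∈ supported ℂ (Iio (2 : ℕ)) := by
    rw [C_mul']
    exact Subalgebra.smul_mem _ h0 _
  rw [planarPoly]
  split_ifs
  · exact Subalgebra.pow_mem _ (Subalgebra.add_mem _ h1 h2) _
  · exact Subalgebra.pow_mem _ (Subalgebra.sub_mem _ h1 h2) _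

theorem isHomogeneous_gegenbauerSolid (a : ℕ) (lam : ℝ) (m : ℕ) :
    (gegenbauerSolid a lam m).IsHomogeneous a := by
  refine IsHomogeneous.sum _ _ _ fun i hi => IsHomogeneous.C_mul ?_ _
  have h := (isHomogeneous_X_pow (R := ℂ) m (a - 2 * i)).mul
    ((isHomogeneous_rhoPoly (m + 1)).pow i)
  rwa [show a - 2 * i + 2 * i = a by rw [Finset.mem_range] at hi; omega] at h

theorem gegenbauerSolid_mem_supported (a : ℕ) (lam : ℝ) (m : ℕ) :
    gegenbauerSolid a lam m ∈ supported ℂ (Iio (m + 1)) := by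
  refine Subalgebra.sum_mem _ fun i _ => ?_
  rw [C_mul']
  exact Subalgebra.smul_mem _ (Subalgebra.mul_mem _
    (Subalgebra.pow_mem _ (X_mem_supported.mpr (by simp)) _)
    (Subalgebra.pow_mem _ (rhoPoly_mem_supported _) _)) _

theorem solid_mem_supported (c : ℕ → ℤ) (p : ℕ) : solid c p ∈ supported ℂ (Iio (p + 2)) := by
  induction p with
  | zero => exact planarPoly_mem_supported _
  | succ p ih =>
    exact Subalgebra.mul_mem _ (gegenbauerSolid_mem_supported _ _ _)
      (supported_mono (Iio_subset_Iio (by omega)) ih)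

theorem isHomogeneous_solid {c : ℕ → ℤ} {p : ℕ} (hc : IsChainIndex c p) :
    (solid c p).IsHomogeneous (c p).natAbs := by
  induction p with
  | zero => exact isHomogeneous_planarPoly _
  | succ p ih =>
    have h := (isHomogeneous_gegenbauerSolid ((c (p + 1)).natAbs - (c p).natAbs)
      (((p : ℝ) + 1) / 2 + (c p).natAbs) (p + 2)).mul (ih (hc.mono (Nat.le_succ p)))
    rwa [Nat.sub_add_cancel hc.natAbs_le] at h

/-- Complex conjugation of the coefficients. -/
def conjPoly : MvPolynomial ℕ ℂ →+* MvPolynomial ℕ ℂ := MvPolynomial.map (starRingEnd ℂ)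

theorem conjPoly_mem_supported {m : ℕ} {P : MvPolynomial ℕ ℂ} (hP : P ∈ supported ℂ (Iio m)) :
    conjPoly P ∈ supported ℂ (Iio m) := by
  rw [mem_supported] at hP ⊢
  exact (Finset.coe_subset.mpr (vars_map _ _)).trans hP

theorem conjPoly_rhoPoly (m : ℕ) : conjPoly (rhoPoly m) = rhoPoly m := by
  simp [conjPoly, rhoPoly]

theorem conjPoly_gegenbauerSolid (a : ℕ) (lam : ℝ) (m : ℕ) :
    conjPoly (gegenbauerSolid a lam m) = gegenbauerSolid a lam m := by
  have h := conjPoly_rhoPoly (m + 1)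
  simp only [gegenbauerSolid, map_sum, map_mul, map_pow, h]
  simp [conjPoly]

theorem rhoPoly_two : rhoPoly 2 = (X 1 + C Complex.I * X 0) * (X 1 - C Complex.I * X 0) := by
  have : (C Complex.I : MvPolynomial ℕ ℂ) * C Complex.I = -1 := by
    rw [← C_mul, Complex.I_mul_I]; simp
  simp only [rhoPoly, Finset.sum_range_succ, Finset.sum_range_zero]
  linear_combination ((X 0 : MvPolynomial ℕ ℂ) ^ 2) * this

/-- Integration by parts in `X_0` and `X_1` yields terms that cancel as `1 + z² = 0`. -/
theorem gaussFunctional_isotropic_pow {z : ℂ} (hz : z * z = -1) {j : ℕ} (hj : j ≠ 0) :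
    gaussFunctional ((X 1 + C z * X 0) ^ j) = 0 := by
  obtain ⟨j, rfl⟩ := Nat.exists_eq_succ_of_ne_zero hj
  have h1 : (X 1 + C z * X 0 : MvPolynomial ℕ ℂ) ^ (j + 1) =
    X 1 * (X 1 + C z * X 0) ^ j + C z * (X 0 * (X 1 + C z * X 0) ^ j) := by ring
  have hd1 : pderiv 1 ((X 1 + C z * X 0 : MvPolynomial ℕ ℂ) ^ j) =
      (j : MvPolynomial ℕ ℂ) * (X 1 + C z * X 0) ^ (j - 1) := by
    rw [pderiv_pow, map_add, pderiv_X_self, pderiv_C_mul, pderiv_X_of_ne (by norm_num)]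
    simp
  have hd0 : pderiv 0 ((X 1 + C z * X 0 : MvPolynomial ℕ ℂ) ^ j) =
      C z * ((j : MvPolynomial ℕ ℂ) * (X 1 + C z * X 0) ^ (j - 1)) := by
    rw [pderiv_pow, map_add, pderiv_C_mul, pderiv_X_self, pderiv_X_of_ne (by norm_num)]
    ring
  rw [Nat.succ_eq_add_one, h1, map_add, gaussFunctional_C_mul, gaussFunctional_X_mul,
    gaussFunctional_X_mul, hd1, hd0, gaussFunctional_C_mul, ← mul_assoc, hz]
  ring

theorem gaussFunctional_isotropic_pow_mul_rhoPoly_pow {z : ℂ} (hz : z * z = -1) {j : ℕ}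
    (hj : j ≠ 0) (s : ℕ) : gaussFunctional (rhoPoly 2 ^ s * (X 1 + C z * X 0) ^ j) = 0 := by
  have h0 : (X 0 : MvPolynomial ℕ ℂ) ∈ supported ℂ (Iio 2) := X_mem_supported.mpr (by simp)
  have h1 : (X 1 : MvPolynomial ℕ ℂ) ∈ supported ℂ (Iio 2) := X_mem_supported.mpr (by simp)
  have h2 : C z * X 0 ∈ supported ℂ (Iio (2 : ℕ)) := by
    rw [C_mul']
    exact Subalgebra.smul_mem _ h0 _
  have h3 : (X 1 + C z * X 0 : MvPolynomial ℕ ℂ).IsHomogeneous 1 :=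
    (isHomogeneous_X ℂ (1 : ℕ)).add (isHomogeneous_C_mul_X z 0)
  induction s with
  | zero => rw [pow_zero, one_mul, gaussFunctional_isotropic_pow hz hj]
  | succ s ih =>
    rw [pow_succ', mul_assoc, gaussFunctional_rhoPoly_mul (m := 2) (D := 2 * s + 1 * j)
      (Subalgebra.mul_mem _ (Subalgebra.pow_mem _ (rhoPoly_mem_supported 2) _)
        (Subalgebra.pow_mem _ (Subalgebra.add_mem _ h1 h2) _))
      (((isHomogeneous_rhoPoly 2).pow s).mul (h3.pow j)), ih, mul_zero]

theorem gaussFunctional_rhoPoly_two_pow (s : ℕ) :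
    gaussFunctional (rhoPoly 2 ^ s) = gaussConst 0 (2 * s) := by
  induction s with
  | zero =>
    have h := gaussFunctional_monomial 0 1
    simp at h
    simp [gaussConst, h]
  | succ s ih =>
    rw [pow_succ', gaussFunctional_rhoPoly_mul (m := 2) (D := 2 * s)
      (Subalgebra.pow_mem _ (rhoPoly_mem_supported 2) _) ((isHomogeneous_rhoPoly 2).pow s), ih,
      show 2 * (s + 1) = 2 * s + 2 by ring, gaussConst]
    push_cast
    ring

theorem conjPoly_planarPoly (k : ℤ) :
    conjPoly (planarPoly k) = if 0 ≤ k then (X 1 - C Complex.I * X 0) ^ k.natAbs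
      else (X 1 + C Complex.I * X 0) ^ k.natAbs := by
  rw [planarPoly, apply_ite conjPoly]
  simp [conjPoly, sub_eq_add_neg]

/-- Orthogonality of the characters in the plane of the first two variables. -/
theorem gaussFunctional_planarPoly_mul_conj (k l : ℤ) :
    gaussFunctional (planarPoly k * conjPoly (planarPoly l)) =
      if k = l then (gaussConst 0 (2 * k.natAbs) : ℂ) else 0 := by
  set u : MvPolynomial ℕ ℂ := X 1 + C Complex.I * X 0 with hu
  set v : MvPolynomial ℕ ℂ := X 1 - C Complex.I * X 0 with hv
  have hv' : v = X 1 + C (-Complex.I) * X 0 := by rw [hv]; simp [sub_eq_add_neg]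
  have huv : rhoPoly 2 = u * v := rhoPoly_two
  have hu0 : ∀ s j, j ≠ 0 → gaussFunctional (rhoPoly 2 ^ s * u ^ j) = 0 := fun s j hj =>
    gaussFunctional_isotropic_pow_mul_rhoPoly_pow Complex.I_mul_I hj s
  have hv0 : ∀ s j, j ≠ 0 → gaussFunctional (rhoPoly 2 ^ s * v ^ j) = 0 := fun s j hj => by
    rw [hv']
    exact gaussFunctional_isotropic_pow_mul_rhoPoly_pow (by simp) hj s
  have hmix : ∀ a b : ℕ, gaussFunctional (u ^ a * v ^ b) =
      if a = b then (gaussConst 0 (2 * a) : ℂ) else 0 := by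
    clear_value u v
    intro a b
    rcases lt_trichotomy a b with h | h | h
    · obtain ⟨t, rfl⟩ := Nat.exists_eq_add_of_lt h
      rw [if_neg h.ne, show u ^ a * v ^ (a + t + 1) = rhoPoly 2 ^ a * v ^ (t + 1) by
        rw [huv]; ring, hv0 _ _ (by omega)]
    · subst h
      rw [if_pos rfl, ← mul_pow, ← huv, gaussFunctional_rhoPoly_two_pow]
    · obtain ⟨t, rfl⟩ := Nat.exists_eq_add_of_lt h
      rw [if_neg h.ne', show u ^ (b + t + 1) * v ^ b = rhoPoly 2 ^ b * u ^ (t + 1) by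
        rw [huv]; ring, hu0 _ _ (by omega)]
  rw [conjPoly_planarPoly, planarPoly]
  by_cases hk : 0 ≤ k <;> by_cases hl : 0 ≤ l
  · rw [if_pos hk, if_pos hl, hmix]
    refine if_congr ⟨fun h => ?_, fun h => by rw [h]⟩ rfl rfl
    omega
  · rw [if_pos hk, if_neg hl, ← pow_add, if_neg (by omega)]
    simpa using hu0 0 (k.natAbs + l.natAbs) (by omega)
  · rw [if_neg hk, if_pos hl, ← pow_add, if_neg (by omega)]
    simpa using hv0 0 (k.natAbs + l.natAbs) (by omega)
  · rw [if_neg hk, if_neg hl, mul_comm, hmix]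
    by_cases h : k = l
    · rw [if_pos (by rw [h]), if_pos h, h]
    · rw [if_neg (by omega), if_neg h]

/-- The factor by which the squared Gaussian norm of a solid harmonic grows in the step from
`solid c p` to `solid c (p + 1)`. -/
def solidFactor (c : ℕ → ℤ) (p : ℕ) : ℝ :=
  gaussConst (((p : ℝ) + 1) / 2 + (c p).natAbs) (2 * ((c (p + 1)).natAbs - (c p).natAbs)) *
    betaFunctional (((p : ℝ) + 1) / 2 + (c p).natAbs)
      (gegenbauerPoly ((c (p + 1)).natAbs - (c p).natAbs) (((p : ℝ) + 1) / 2 + (c p).natAbs) *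
        gegenbauerPoly ((c (p + 1)).natAbs - (c p).natAbs) (((p : ℝ) + 1) / 2 + (c p).natAbs))

/-- Splitting off the variable `X_m`: the Gegenbauer factors contribute the beta integral of their
product, with the parameter `λ` determined by the number of variables and the degree of `A`. -/
theorem gaussFunctional_gegenbauerSolid_mul {m D : ℕ} {A : MvPolynomial ℕ ℂ}
    (hA : A ∈ supported ℂ (Iio m)) (hD : A.IsHomogeneous D) {lam lam' : ℝ} (hl : 0 ≤ lam)
    (hlam : 2 * lam + 1 = m + D) (a b : ℕ) :
    gaussFunctional (gegenbauerSolid a lam' m * gegenbauerSolid b lam' m * A) =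
      gaussConst lam (a + b) * betaFunctional lam (gegenbauerPoly a lam' * gegenbauerPoly b lam') *
        gaussFunctional A := by
  have h1 : gegenbauerSolid a lam' m * gegenbauerSolid b lam' m * A =
      ∑ i ∈ Finset.range (a / 2 + 1), ∑ j ∈ Finset.range (b / 2 + 1),
        C ((gegenbauerCoeff a lam' i : ℂ) * gegenbauerCoeff b lam' j) *
          (X m ^ (a - 2 * i + (b - 2 * j)) * rhoPoly (m + 1) ^ (i + j) * A) := by
    rw [gegenbauerSolid, gegenbauerSolid, Finset.sum_mul_sum, Finset.sum_mul]
    refine Finset.sum_congr rfl fun i _ => ?_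
    rw [Finset.sum_mul]
    refine Finset.sum_congr rfl fun j _ => ?_
    rw [C_mul]
    ring
  have h2 : gegenbauerPoly a lam' * gegenbauerPoly b lam' =
      ∑ i ∈ Finset.range (a / 2 + 1), ∑ j ∈ Finset.range (b / 2 + 1),
        Polynomial.C (gegenbauerCoeff a lam' i * gegenbauerCoeff b lam' j) *
          Polynomial.X ^ (a - 2 * i + (b - 2 * j)) := by
    rw [gegenbauerPoly, gegenbauerPoly, Finset.sum_mul_sum]
    refine Finset.sum_congr rfl fun i _ => Finset.sum_congr rfl fun j _ => ?_
    rw [Polynomial.C_mul]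
    ring
  rw [h1, h2]
  simp only [map_sum, gaussFunctional_C_mul, betaFunctional_C_mul_X_pow,
    gaussFunctional_X_pow_mul_rhoPoly_pow_mul hA hD hl hlam]
  push_cast
  rw [Finset.mul_sum, Finset.sum_mul]
  refine Finset.sum_congr rfl fun i hi => ?_
  rw [Finset.mul_sum, Finset.sum_mul]
  refine Finset.sum_congr rfl fun j hj => ?_
  rw [Finset.mem_range] at hi hj
  rw [show a - 2 * i + (b - 2 * j) + 2 * (i + j) = a + b by omega]
  ring

/-- Solid harmonics with different indices are orthogonal for the Gaussian functional. -/
theorem gaussFunctional_solid_mul_conj {c c' : ℕ → ℤ} {p : ℕ} (hc : IsChainIndex c p)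
    (hc' : IsChainIndex c' p) :
    gaussFunctional (solid c p * conjPoly (solid c' p)) =
      if ∀ i ≤ p, c i = c' i then
        ((gaussConst 0 (2 * (c 0).natAbs) * ∏ i ∈ Finset.range p, solidFactor c i : ℝ) : ℂ)
      else 0 := by
  induction p with
  | zero =>
    rw [solid, solid, gaussFunctional_planarPoly_mul_conj]
    simp
  | succ p ih =>
    have hcp := hc.mono (Nat.le_succ p)
    have hcp' := hc'.mono (Nat.le_succ p)
    specialize ih hcp hcp'
    set A := solid c p * conjPoly (solid c' p) with hAdef
    have hA : A ∈ supported ℂ (Iio (p + 2)) := Subalgebra.mul_mem _ (solid_mem_supported c p)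
      (conjPoly_mem_supported (solid_mem_supported c' p))
    have hD : A.IsHomogeneous ((c p).natAbs + (c' p).natAbs) :=
      (isHomogeneous_solid hcp).mul ((isHomogeneous_solid hcp').map _)
    by_cases hlow : ∀ i ≤ p, c i = c' i
    · rw [if_pos hlow] at ih
      have hp := hlow p le_rfl
      rw [← hp] at hD
      have hl : 0 < ((p : ℝ) + 1) / 2 + (c p).natAbs := by positivity
      have hprod : solid c (p + 1) * conjPoly (solid c' (p + 1)) =
          gegenbauerSolid ((c (p + 1)).natAbs - (c p).natAbs)
            (((p : ℝ) + 1) / 2 + (c p).natAbs) (p + 2) *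
          gegenbauerSolid ((c' (p + 1)).natAbs - (c p).natAbs)
            (((p : ℝ) + 1) / 2 + (c p).natAbs) (p + 2) * A := by
        rw [solid, solid, map_mul, conjPoly_gegenbauerSolid, hp, hAdef]
        ring
      rw [hprod, gaussFunctional_gegenbauerSolid_mul hA hD hl.le (by push_cast; ring), ih]
      have h1 := hc p (by omega)
      have h2 := hc' p (by omega)
      rw [Int.abs_eq_natAbs] at h1 h2
      by_cases hlast : c (p + 1) = c' (p + 1)
      · rw [if_pos, Finset.prod_range_succ, solidFactor, ← hlast, ← two_mul]
        · push_cast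
          ring
        · intro i hi
          rcases Nat.le_succ_iff.mp hi with h | rfl
          · exact hlow i h
          · exact hlast
      · rw [if_neg fun h => hlast (h _ le_rfl), betaFunctional_gegenbauerPoly_of_ne _ hl]
        · simp
        · rw [← hp] at h2
          omega
    · rw [if_neg hlow] at ih
      rw [if_neg fun h => hlow fun i hi => h i (by omega)]
      -- The lower parts are orthogonal already, so that the beta integral does not matter.
      have hzero : ∀ i s, gaussFunctional (X (p + 2) ^ i * rhoPoly (p + 3) ^ s * A) = 0 := by
        intro i s
        rw [gaussFunctional_X_pow_mul_rhoPoly_pow_mul hA hD (lam := ((p : ℝ) + 1 +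
          ((c p).natAbs + (c' p).natAbs)) / 2) (by positivity) (by push_cast; ring), ih, mul_zero]
      have hprod : solid c (p + 1) * conjPoly (solid c' (p + 1)) =
          gegenbauerSolid ((c (p + 1)).natAbs - (c p).natAbs)
            (((p : ℝ) + 1) / 2 + (c p).natAbs) (p + 2) *
          gegenbauerSolid ((c' (p + 1)).natAbs - (c' p).natAbs)
            (((p : ℝ) + 1) / 2 + (c' p).natAbs) (p + 2) * A := by
        rw [solid, solid, map_mul, conjPoly_gegenbauerSolid, hAdef]
        ring
      rw [hprod, gegenbauerSolid, gegenbauerSolid, Finset.sum_mul_sum, Finset.sum_mul, map_sum]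
      refine Finset.sum_eq_zero fun i _ => ?_
      rw [Finset.sum_mul, map_sum]
      refine Finset.sum_eq_zero fun j _ => ?_
      rw [mul_mul_mul_comm (C _), ← C_mul, mul_mul_mul_comm (X _ ^ _), ← pow_add, ← pow_add, mul_assoc,
        gaussFunctional_C_mul, hzero, mul_zero]

/-! ### Integrals of polynomials over the sphere -/

open Module in
/-- Integration in polar coordinates of the product of a homogeneous and a radial function. -/
theorem integral_homogeneous_mul_radial {E : Type*} [NormedAddCommGroup E] [NormedSpace ℝ E]
    [MeasurableSpace E] [BorelSpace E] [FiniteDimensional ℝ E] [Nontrivial E] (μ : Measure E)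
    [μ.IsAddHaarMeasure] {D : ℕ} (F : E → ℝ) (hF : ∀ (r : ℝ) (x : E), F (r • x) = r ^ D * F x)
    (w : ℝ → ℝ) :
    ∫ x, F x * w ‖x‖ ∂μ = (∫ x : Metric.sphere (0 : E) 1, F x ∂μ.toSphere) *
      ∫ r in Ioi (0 : ℝ), r ^ (D + (finrank ℝ E - 1)) * w r := by
  have h1 : ∫ x, F x * w ‖x‖ ∂μ =
      ∫ x : ({(0)}ᶜ : Set E), F x.1 * w ‖x.1‖ ∂(μ.comap (↑)) := by
    rw [integral_subtype_comap (measurableSet_singleton _).compl fun x => F x * w ‖x‖,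
      restrict_compl_singleton]
  have h2 : ∫ x : ({(0)}ᶜ : Set E), F x.1 * w ‖x.1‖ ∂(μ.comap (↑)) =
      ∫ z : Metric.sphere (0 : E) 1 × Ioi (0 : ℝ), F z.1 * (z.2.1 ^ D * w z.2.1)
        ∂μ.toSphere.prod (.volumeIoiPow (finrank ℝ E - 1)) := by
    rw [← μ.measurePreserving_homeomorphUnitSphereProd.integral_comp
      (Homeomorph.measurableEmbedding _)]
    refine integral_congr_ae (ae_of_all _ fun x => ?_)
    have hx : x.1 ≠ 0 := x.2
    simp only [homeomorphUnitSphereProd_apply_snd_coe, homeomorphUnitSphereProd_apply_fst_coe]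
    have h3 := hF ‖x.1‖ (‖x.1‖⁻¹ • x.1)
    rw [smul_smul, mul_inv_cancel₀ (norm_ne_zero_iff.mpr hx), one_smul] at h3
    rw [h3]
    ring
  rw [h1, h2, integral_prod_mul (fun x : Metric.sphere (0 : E) 1 => F x)
    fun r : Ioi (0 : ℝ) => r.1 ^ D * w r.1]
  congr 1
  simp only [Measure.volumeIoiPow, ENNReal.ofReal]
  rw [integral_withDensity_eq_integral_smul,
    integral_subtype_comap measurableSet_Ioi
      fun a => Real.toNNReal (a ^ (finrank ℝ E - 1)) • (a ^ D * w a),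
    setIntegral_congr_fun measurableSet_Ioi fun x hx => ?_]
  · rw [NNReal.smul_def, Real.coe_toNNReal _ (pow_nonneg (le_of_lt hx) _), smul_eq_mul, pow_add]
    ring
  · exact (measurable_subtype_coe.pow_const _).real_toNNReal

/-- The half-line Gaussian moments. -/
theorem integral_Ioi_pow_mul_exp (N : ℕ) :
    ∫ r in Ioi (0 : ℝ), r ^ N * Real.exp (-(r ^ 2 / 2)) =
      (1 / 2 : ℝ) ^ (-((N : ℝ) + 1) / 2) * (1 / 2) * Real.Gamma (((N : ℝ) + 1) / 2) := by
  have h := integral_rpow_mul_exp_neg_mul_rpow (p := 2) (q := N) (b := 1 / 2) (by norm_num)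
    (by have : (0 : ℝ) ≤ N := by positivity
        linarith) (by norm_num)
  rw [← h]
  refine setIntegral_congr_fun measurableSet_Ioi fun x _ => ?_
  simp only [Real.rpow_natCast, Real.rpow_ofNat]
  ring_nf

theorem integral_Ioi_pow_mul_exp_pos (N : ℕ) :
    0 < ∫ r in Ioi (0 : ℝ), r ^ N * Real.exp (-(r ^ 2 / 2)) := by
  rw [integral_Ioi_pow_mul_exp]
  have := Real.Gamma_pos_of_pos (show 0 < ((N : ℝ) + 1) / 2 by positivity)
  positivity

theorem integral_Ioi_pow_add_two_mul_exp (N : ℕ) :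
    ∫ r in Ioi (0 : ℝ), r ^ (N + 2) * Real.exp (-(r ^ 2 / 2)) =
      (N + 1) * ∫ r in Ioi (0 : ℝ), r ^ N * Real.exp (-(r ^ 2 / 2)) := by
  rw [integral_Ioi_pow_mul_exp, integral_Ioi_pow_mul_exp]
  push_cast
  rw [show ((N : ℝ) + 2 + 1) / 2 = ((N : ℝ) + 1) / 2 + 1 by ring,
    Real.Gamma_add_one (by positivity),
    show -((N : ℝ) + 2 + 1) / 2 = -((N : ℝ) + 1) / 2 - 1 by ring,
    Real.rpow_sub_one (by norm_num)]
  ring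

theorem integral_pow_mul_exp (a : ℕ) :
    ∫ x : ℝ, x ^ a * Real.exp (-(x ^ 2 / 2)) =
      gaussMoment a * (2 * ∫ r in Ioi (0 : ℝ), r ^ 0 * Real.exp (-(r ^ 2 / 2))) := by
  rcases Nat.even_or_odd a with ha | ha
  · have h1 : ∫ x : ℝ, x ^ a * Real.exp (-(x ^ 2 / 2)) =
        2 * ∫ r in Ioi (0 : ℝ), r ^ a * Real.exp (-(r ^ 2 / 2)) := by
      rw [← integral_comp_abs]
      simp only [sq_abs, ha.pow_abs]
    rw [h1]
    obtain ⟨t, rfl⟩ := ha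
    clear h1
    induction t with
    | zero => simp [gaussMoment]
    | succ t ih =>
      rw [show t + 1 + (t + 1) = t + t + 2 by ring, integral_Ioi_pow_add_two_mul_exp, gaussMoment,
        mul_left_comm, ih]
      push_cast
      ring
  · have h0 : gaussMoment a = 0 := by
      obtain ⟨t, rfl⟩ := ha
      induction t with
      | zero => rfl
      | succ t ih =>
        rw [show 2 * (t + 1) + 1 = 2 * t + 1 + 2 by ring, gaussMoment, ih, mul_zero]
    have h1 := integral_neg_eq_self (fun x : ℝ => x ^ a * Real.exp (-(x ^ 2 / 2))) volume
    simp only [ha.neg_pow, neg_sq, neg_mul] at h1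
    rw [integral_neg] at h1
    rw [h0, zero_mul]
    linarith

/-- `gaussConst` as a quotient of two radial moments. -/
theorem integral_Ioi_pow_add_mul_exp {d : ℕ} (hd : 1 ≤ d) (t : ℕ) :
    ∫ r in Ioi (0 : ℝ), r ^ (2 * t + (d - 1)) * Real.exp (-(r ^ 2 / 2)) =
      gaussConst (((d : ℝ) - 2) / 2) (2 * t) *
        ∫ r in Ioi (0 : ℝ), r ^ (d - 1) * Real.exp (-(r ^ 2 / 2)) := by
  induction t with
  | zero => simp [gaussConst]
  | succ t ih =>
    rw [show 2 * (t + 1) + (d - 1) = 2 * t + (d - 1) + 2 by ring, integral_Ioi_pow_add_two_mul_exp,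
      ih, show 2 * (t + 1) = 2 * t + 2 by ring, gaussConst]
    push_cast [Nat.cast_sub hd]
    ring

instance isProbabilityMeasure_surfaceMeasure (d : ℕ) [NeZero d] :
    IsProbabilityMeasure (surfaceMeasure d) := by
  constructor
  rw [surfaceMeasure, Measure.smul_apply, smul_eq_mul]
  refine ENNReal.inv_mul_cancel ?_ (measure_ne_top _ _)
  have : Nontrivial (EuclideanSpace ℝ (Fin d)) := by
    refine Module.nontrivial_of_finrank_pos (R := ℝ) ?_
    rw [finrank_euclideanSpace_fin]
    exact Nat.pos_of_ne_zero (NeZero.ne d)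
  rw [Ne, Measure.measure_univ_eq_zero]
  exact Measure.toSphere_ne_zero _

theorem integral_surfaceMeasure (d : ℕ) {F : Type*} [NormedAddCommGroup F] [NormedSpace ℝ F]
    (f : Sphere d → F) : ∫ x, f x ∂(surfaceMeasure d) =
      ((volume : Measure (EuclideanSpace ℝ (Fin d))).toSphere.real univ)⁻¹ •
        ∫ x, f x ∂(volume : Measure (EuclideanSpace ℝ (Fin d))).toSphere := by
  rw [surfaceMeasure, integral_smul_measure, ENNReal.toReal_inv]
  rfl

/-- The integral of a monomial over the sphere, by comparison of the Gaussian integral in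
Cartesian and in polar coordinates. -/
theorem gaussConst_mul_integral_monomial {d : ℕ} [NeZero d] (α : Fin d → ℕ) :
    gaussConst (((d : ℝ) - 2) / 2) (∑ i, α i) *
      ∫ x : Sphere d, ∏ i, (x : EuclideanSpace ℝ (Fin d)) i ^ α i ∂(surfaceMeasure d) =
      ∏ i, gaussMoment (α i) := by
  have hd : 1 ≤ d := Nat.pos_of_ne_zero (NeZero.ne d)
  have hnt : Nontrivial (EuclideanSpace ℝ (Fin d)) := by
    refine Module.nontrivial_of_finrank_pos (R := ℝ) ?_
    rw [finrank_euclideanSpace_fin]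
    exact hd
  set ν := (volume : Measure (EuclideanSpace ℝ (Fin d))).toSphere with hν
  set J : ℝ := 2 * ∫ r in Ioi (0 : ℝ), r ^ 0 * Real.exp (-(r ^ 2 / 2)) with hJ
  have hJpos : 0 < J := mul_pos two_pos (integral_Ioi_pow_mul_exp_pos 0)
  have hcart : ∀ α : Fin d → ℕ, ∫ x : EuclideanSpace ℝ (Fin d),
      (∏ i, x i ^ α i) * Real.exp (-(‖x‖ ^ 2 / 2)) = (∏ i, gaussMoment (α i)) * J ^ d := by
    intro α
    have h1 : ∀ x : EuclideanSpace ℝ (Fin d),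
        (∏ i, x i ^ α i) * Real.exp (-(‖x‖ ^ 2 / 2)) =
        ∏ i, (x i ^ α i * Real.exp (-(x i ^ 2 / 2))) := by
      intro x
      rw [Finset.prod_mul_distrib, ← Real.exp_sum, EuclideanSpace.norm_sq_eq, Finset.sum_div,
        Finset.sum_neg_distrib]
      simp
    simp_rw [h1]
    refine ((EuclideanSpace.volume_preserving_symm_measurableEquiv_toLp (Fin d)).integral_comp'
      (f := (MeasurableEquiv.toLp 2 (Fin d → ℝ)).symm)
      (fun y : Fin d → ℝ => ∏ i, (y i ^ α i * Real.exp (-(y i ^ 2 / 2))))).trans ?_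
    rw [integral_fintype_prod_volume_eq_prod
      (fun (i : Fin d) (y : ℝ) => y ^ α i * Real.exp (-(y ^ 2 / 2)))]
    simp_rw [integral_pow_mul_exp]
    rw [Finset.prod_mul_distrib, Finset.prod_const, Finset.card_univ, Fintype.card_fin]
  have hpol : ∀ α : Fin d → ℕ, ∫ x : EuclideanSpace ℝ (Fin d),
      (∏ i, x i ^ α i) * Real.exp (-(‖x‖ ^ 2 / 2)) =
      (∫ x : Sphere d, ∏ i, (x : EuclideanSpace ℝ (Fin d)) i ^ α i ∂ν) *
        ∫ r in Ioi (0 : ℝ), r ^ ((∑ i, α i) + (d - 1)) * Real.exp (-(r ^ 2 / 2)) := by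
    intro α
    have h := integral_homogeneous_mul_radial (volume : Measure (EuclideanSpace ℝ (Fin d)))
      (D := ∑ i, α i) (fun x => ∏ i, x i ^ α i) (fun r x => by
        simp [mul_pow, Finset.prod_mul_distrib, Finset.prod_pow_eq_pow_sum])
      (fun r => Real.exp (-(r ^ 2 / 2)))
    rw [finrank_euclideanSpace_fin] at h
    exact h
  have htot : ν.real univ * ∫ r in Ioi (0 : ℝ), r ^ (d - 1) * Real.exp (-(r ^ 2 / 2)) = J ^ d := by
    have h1 := hcart fun _ => 0
    rw [hpol] at h1
    simpa [gaussMoment] using h1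
  have hR := integral_Ioi_pow_mul_exp_pos (d - 1)
  have hν0 : ν.real univ ≠ 0 := by
    intro h
    rw [h, zero_mul] at htot
    exact (pow_pos hJpos d).ne htot
  rw [integral_surfaceMeasure, smul_eq_mul, ← hν]
  have hmain := (hpol α).symm.trans (hcart α)
  rw [← htot] at hmain
  rcases Nat.even_or_odd' (∑ i, α i) with ⟨t, ht | ht⟩
  · rw [ht, integral_Ioi_pow_add_mul_exp hd] at hmain
    rw [ht]
    field_simp
    apply mul_right_cancel₀ hR.ne'
    linear_combination hmain
  · -- In odd degree, some exponent is odd.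
    have hM : ∏ i, gaussMoment (α i) = 0 := by
      by_contra hne
      have hev : ∀ i, Even (α i) := by
        intro i
        by_contra hi
        have h2 := Finset.prod_ne_zero_iff.mp hne i (Finset.mem_univ _)
        have h3 := integral_pow_mul_exp (α i)
        have h4 := integral_neg_eq_self (fun x : ℝ => x ^ α i * Real.exp (-(x ^ 2 / 2))) volume
        rw [Nat.not_even_iff_odd] at hi
        simp only [hi.neg_pow, neg_sq, neg_mul] at h4
        rw [integral_neg] at h4
        rw [show ∫ x : ℝ, x ^ α i * Real.exp (-(x ^ 2 / 2)) = 0 by linarith] at h3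
        exact (mul_ne_zero h2 hJpos.ne') h3.symm
      have : Even (∑ i, α i) := Finset.even_sum _ fun i _ => hev i
      rw [ht] at this
      exact absurd this (by simp)
    rw [hM] at hmain ⊢
    rw [zero_mul, mul_eq_zero] at hmain
    rcases hmain with h | h
    · rw [h]; simp
    · exact absurd h (integral_Ioi_pow_mul_exp_pos _).ne'

/-- The value of a polynomial in the coordinates `x_0, x_1, …` of a point of the sphere. -/
def evalSphere {d : ℕ} (x : Sphere d) : MvPolynomial ℕ ℂ →+* ℂ :=
  eval fun i => (coord (x : EuclideanSpace ℝ (Fin d)) i : ℂ)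

theorem evalSphere_X {d : ℕ} (x : Sphere d) (i : ℕ) :
    evalSphere x (X i) = coord (x : EuclideanSpace ℝ (Fin d)) i := eval_X i

theorem evalSphere_C {d : ℕ} (x : Sphere d) (a : ℂ) : evalSphere x (C a) = a := eval_C a

theorem evalSphere_conjPoly {d : ℕ} (x : Sphere d) (P : MvPolynomial ℕ ℂ) :
    evalSphere x (conjPoly P) = (starRingEnd ℂ) (evalSphere x P) := by
  induction P using MvPolynomial.induction_on with
  | C a => simp [conjPoly, evalSphere_C]
  | add p q hp hq => rw [map_add, map_add, map_add, map_add, hp, hq]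
  | mul_X p i hp =>
    rw [map_mul, map_mul, map_mul, map_mul, hp]
    simp [conjPoly, evalSphere_X]

theorem continuous_coord {d : ℕ} (i : ℕ) :
    Continuous fun x : Sphere d => coord (x : EuclideanSpace ℝ (Fin d)) i := by
  by_cases h : i < d
  · simp only [coord, h, dif_pos]
    fun_prop
  · simp only [coord, h, dif_neg, not_false_eq_true]
    exact continuous_const

theorem continuous_evalSphere {d : ℕ} (P : MvPolynomial ℕ ℂ) :
    Continuous fun x : Sphere d => evalSphere x P := by
  induction P using MvPolynomial.induction_on with
  | C a => simpa only [evalSphere_C] using continuous_const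
  | add p q hp hq =>
    simp only [map_add]
    exact hp.add hq
  | mul_X p i hp =>
    simp only [map_mul, evalSphere_X]
    exact hp.mul (Complex.continuous_ofReal.comp (continuous_coord i))

theorem integrable_of_continuous_sphere {d : ℕ} [NeZero d] {f : Sphere d → ℂ}
    (hf : Continuous f) : Integrable f (surfaceMeasure d) :=
  hf.integrable_of_hasCompactSupport (HasCompactSupport.of_compactSpace f)

/-- On homogeneous polynomials the normalised surface integral and the Gaussian expectation agree up
to a constant that depends only on the degree and the dimension. -/
theorem gaussConst_mul_integral_evalSphere {d : ℕ} [NeZero d] {D : ℕ} {P : MvPolynomial ℕ ℂ}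
    (hP : P ∈ supported ℂ (Iio d)) (hD : P.IsHomogeneous D) :
    (gaussConst (((d : ℝ) - 2) / 2) D : ℂ) * ∫ x : Sphere d, evalSphere x P ∂(surfaceMeasure d) =
      gaussFunctional P := by
  rw [P.as_sum]
  simp only [map_sum]
  rw [integral_finsetSum _ fun α _ => integrable_of_continuous_sphere (continuous_evalSphere _),
    Finset.mul_sum]
  refine Finset.sum_congr rfl fun α hα => ?_
  have hsupp : α.support ⊆ Finset.range d := by
    intro l hl
    have h1 : l ∈ P.vars := (mem_vars_iff_mem_support l).mpr ⟨α, hα, hl⟩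
    simpa using mem_supported.mp hP h1
  have hdeg : ∑ i : Fin d, α i = D := by
    rw [hD.degree_eq_sum_deg_support hα, ← Finset.sum_range fun i => α i]
    refine (Finset.sum_subset hsupp ?_).symm
    intro l _ hl
    simpa using hl
  have h := gaussConst_mul_integral_monomial fun i : Fin d => α i
  rw [hdeg] at h
  rw [gaussFunctional_monomial, Finsupp.prod_of_support_subset _ hsupp _ fun _ _ => rfl,
    Finset.prod_range, ← h]
  have hev : ∀ x : Sphere d, evalSphere x (monomial α (coeff α P)) =
      coeff α P * ((∏ i : Fin d, (x : EuclideanSpace ℝ (Fin d)) i ^ α i : ℝ) : ℂ) := by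
    intro x
    rw [evalSphere, eval_monomial, Finsupp.prod_of_support_subset _ hsupp _ fun _ _ => pow_zero _,
      Finset.prod_range]
    simp [coord]
  simp_rw [hev]
  rw [integral_const_mul, integral_complex_ofReal]
  push_cast
  ring

/-! ### The spherical harmonics as polynomials -/

theorem partialNorm_nonneg {d : ℕ} (x : EuclideanSpace ℝ (Fin d)) (i : ℕ) : 0 ≤ partialNorm x i :=
  Real.sqrt_nonneg _

theorem partialNorm_sq {d : ℕ} (x : EuclideanSpace ℝ (Fin d)) (i : ℕ) :
    partialNorm x i ^ 2 = ∑ l ∈ Finset.range i, coord x l ^ 2 :=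
  Real.sq_sqrt (Finset.sum_nonneg fun _ _ => sq_nonneg _)

theorem partialNorm_succ_sq {d : ℕ} (x : EuclideanSpace ℝ (Fin d)) (i : ℕ) :
    partialNorm x (i + 1) ^ 2 = partialNorm x i ^ 2 + coord x i ^ 2 := by
  rw [partialNorm_sq, partialNorm_sq, Finset.sum_range_succ]

theorem sum_coord_sq {d : ℕ} (x : Sphere d) :
    ∑ l ∈ Finset.range d, coord (x : EuclideanSpace ℝ (Fin d)) l ^ 2 = 1 := by
  have hx : ‖(x : EuclideanSpace ℝ (Fin d))‖ = 1 := by simp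
  have h := EuclideanSpace.norm_sq_eq (x : EuclideanSpace ℝ (Fin d))
  rw [hx, one_pow] at h
  refine Eq.trans ?_ h.symm
  rw [Finset.sum_range]
  exact Finset.sum_congr rfl fun i _ => by simp [coord]

theorem partialNorm_self {d : ℕ} (x : Sphere d) :
    partialNorm (x : EuclideanSpace ℝ (Fin d)) d = 1 := by
  rw [partialNorm, sum_coord_sq, Real.sqrt_one]

theorem abs_coord_le {d : ℕ} (x : EuclideanSpace ℝ (Fin d)) (i : ℕ) :
    |coord x i| ≤ partialNorm x (i + 1) :=
  abs_le_of_sq_le_sq (by nlinarith [partialNorm_succ_sq x i, sq_nonneg (partialNorm x i)])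
    (partialNorm_nonneg _ _)

theorem abs_coord_div_le {d : ℕ} (x : EuclideanSpace ℝ (Fin d)) (i : ℕ) :
    -1 ≤ coord x i / partialNorm x (i + 1) ∧ coord x i / partialNorm x (i + 1) ≤ 1 := by
  refine abs_le.mp ?_
  rw [abs_div, abs_of_nonneg (partialNorm_nonneg _ _)]
  exact div_le_one_of_le₀ (abs_coord_le x i) (partialNorm_nonneg _ _)

theorem partialNorm_mul_cos_angle {d : ℕ} (x : EuclideanSpace ℝ (Fin d)) (p : ℕ) :
    partialNorm x (p + 3) * Real.cos (angle x (p + 2)) = coord x (p + 2) := by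
  have h := abs_coord_div_le x (p + 2)
  rw [angle, if_neg (by omega), Real.cos_arccos h.1 h.2]
  rcases eq_or_ne (partialNorm x (p + 3)) 0 with h0 | h0
  · have h1 := abs_coord_le x (p + 2)
    rw [h0] at h1
    rw [h0, abs_nonpos_iff.mp h1, zero_mul]
  · rw [mul_div_cancel₀ _ h0]

theorem partialNorm_mul_sin_angle {d : ℕ} (x : EuclideanSpace ℝ (Fin d)) (p : ℕ) :
    partialNorm x (p + 3) * Real.sin (angle x (p + 2)) = partialNorm x (p + 2) := by
  have h0 : 0 ≤ Real.sin (angle x (p + 2)) := by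
    rw [angle, if_neg (by omega), Real.sin_arccos]
    exact Real.sqrt_nonneg _
  refine (sq_eq_sq₀ (mul_nonneg (partialNorm_nonneg _ _) h0) (partialNorm_nonneg _ _)).mp ?_
  have h1 := partialNorm_mul_cos_angle x p
  have h2 := partialNorm_succ_sq x (p + 2)
  have h3 := Real.sin_sq_add_cos_sq (angle x (p + 2))
  rw [← h1] at h2
  rw [mul_pow]
  linear_combination h2 + partialNorm x (p + 3) ^ 2 * h3

theorem norm_coord_one_zero {d : ℕ} (x : EuclideanSpace ℝ (Fin d)) :
    ‖(⟨coord x 1, coord x 0⟩ : ℂ)‖ = partialNorm x 2 := by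
  rw [Complex.norm_def, partialNorm, Complex.normSq_mk]
  simp [Finset.sum_range_succ]
  ring_nf

theorem evalSphere_rhoPoly {d : ℕ} (x : Sphere d) (m : ℕ) :
    evalSphere x (rhoPoly m) = ((partialNorm (x : EuclideanSpace ℝ (Fin d)) m ^ 2 : ℝ) : ℂ) := by
  rw [partialNorm_sq]
  simp [rhoPoly, evalSphere_X]

/-- In polar coordinates of the first two variables: `θ_1` is the argument of `X_1 + i X_0`. -/
theorem evalSphere_planarPoly {d : ℕ} (x : Sphere d) (k : ℤ) :
    evalSphere x (planarPoly k) =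
      (partialNorm (x : EuclideanSpace ℝ (Fin d)) 2 : ℂ) ^ k.natAbs *
        Complex.exp (Complex.I * k * (angle (x : EuclideanSpace ℝ (Fin d)) 1 : ℝ)) := by
  set y := (x : EuclideanSpace ℝ (Fin d))
  set z : ℂ := ⟨coord y 1, coord y 0⟩ with hz
  have h1 : evalSphere x (X 1 + C Complex.I * X 0) = z := by
    rw [map_add, map_mul, evalSphere_X, evalSphere_X, evalSphere_C, mul_comm]
    exact (Complex.mk_eq_add_mul_I _ _).symm
  have h2 : evalSphere x (X 1 - C Complex.I * X 0) = (starRingEnd ℂ) z := by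
    rw [map_sub, map_mul, evalSphere_X, evalSphere_X, evalSphere_C, ← h1, map_add, map_mul,
      evalSphere_X, evalSphere_X, evalSphere_C]
    simp only [map_add, map_mul, Complex.conj_ofReal, Complex.conj_I]
    ring
  have h3 : z = (partialNorm y 2 : ℂ) * Complex.exp ((angle y 1 : ℝ) * Complex.I) := by
    rw [angle, if_pos rfl, ← norm_coord_one_zero, Complex.norm_mul_exp_arg_mul_I]
  have h4 : (starRingEnd ℂ) z =
      (partialNorm y 2 : ℂ) * Complex.exp (-((angle y 1 : ℝ) * Complex.I)) := by
    rw [h3, map_mul, Complex.conj_ofReal, ← Complex.exp_conj, map_mul, Complex.conj_ofReal,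
      Complex.conj_I, mul_neg]
  rw [planarPoly]
  split_ifs with hk
  · rw [map_pow, h1, h3, mul_pow, ← Complex.exp_nat_mul]
    congr 2
    have : (k : ℂ) = (k.natAbs : ℂ) := by
      rw [← Int.cast_natCast, Int.natAbs_of_nonneg hk]
    rw [this]
    ring
  · rw [map_pow, h2, h4, mul_pow, ← Complex.exp_nat_mul]
    congr 2
    have : (k : ℂ) = -(k.natAbs : ℂ) := by
      rw [← Int.cast_natCast, Int.ofNat_natAbs_of_nonpos (by omega)]
      simp
    rw [this]
    ring

theorem evalSphere_gegenbauerSolid {d : ℕ} (x : Sphere d) (a : ℕ) (lam : ℝ) (p : ℕ) :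
    evalSphere x (gegenbauerSolid a lam (p + 2)) =
      ((partialNorm (x : EuclideanSpace ℝ (Fin d)) (p + 3) ^ a *
        gegenbauer a lam (Real.cos (angle (x : EuclideanSpace ℝ (Fin d)) (p + 2))) : ℝ) : ℂ) := by
  rw [gegenbauerSolid, gegenbauer, map_sum, Finset.mul_sum, Complex.ofReal_sum]
  refine Finset.sum_congr rfl fun i hi => ?_
  rw [map_mul, evalSphere_C, map_mul, map_pow, map_pow, evalSphere_X, evalSphere_rhoPoly,
    ← partialNorm_mul_cos_angle]
  rw [gegenbauerCoeff]
  obtain ⟨t, rfl⟩ := Nat.exists_eq_add_of_le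
    (show 2 * i ≤ a by rw [Finset.mem_range] at hi; omega)
  rw [show 2 * i + t - 2 * i = t by omega]
  push_cast
  ring

/-- In spherical coordinates a solid harmonic is a power of the radius times the product of the
Gegenbauer factors and the exponential. -/
theorem evalSphere_solid {d : ℕ} (x : Sphere d) {c : ℕ → ℤ} {p : ℕ} (hc : IsChainIndex c p) :
    evalSphere x (solid c p) =
      (partialNorm (x : EuclideanSpace ℝ (Fin d)) (p + 2) : ℂ) ^ (c p).natAbs *
      ((∏ i ∈ Finset.range p, (gegenbauer ((c (i + 1)).natAbs - (c i).natAbs)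
        (((i : ℝ) + 1) / 2 + (c i).natAbs)
        (Real.cos (angle (x : EuclideanSpace ℝ (Fin d)) (i + 2))) *
        Real.sin (angle (x : EuclideanSpace ℝ (Fin d)) (i + 2)) ^ (c i).natAbs) : ℝ) : ℂ) *
      Complex.exp (Complex.I * (c 0 : ℂ) * (angle (x : EuclideanSpace ℝ (Fin d)) 1 : ℝ)) := by
  induction p with
  | zero => rw [solid, evalSphere_planarPoly]; simp
  | succ p ih =>
    rw [solid, map_mul, ih (hc.mono (Nat.le_succ p)), evalSphere_gegenbauerSolid,
      Finset.prod_range_succ, ← partialNorm_mul_sin_angle _ p]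
    obtain ⟨t, ht⟩ := Nat.exists_eq_add_of_le hc.natAbs_le
    rw [ht, show (c p).natAbs + t - (c p).natAbs = t by omega]
    push_cast
    ring

/-- The index sequence `k_{d-2}, …, k_1, n` in the order in which variables are added. -/
def chainIndex (d n : ℕ) (k : Fin (d - 2) → ℤ) (i : ℕ) : ℤ := extIndex n k (d - 2 - i)

theorem chainIndex_last (d n : ℕ) (k : Fin (d - 2) → ℤ) : chainIndex d n k (d - 2) = n := by
  rw [chainIndex, Nat.sub_self]; rfl

theorem isChainIndex_chainIndex {d n : ℕ} {k : Fin (d - 2) → ℤ} (hk : k ∈ indexSet d n) :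
    IsChainIndex (chainIndex d n k) (d - 2) := by
  intro i hi
  have h := mem_indexSet.mp hk (d - 2 - (i + 1)) (by omega)
  rwa [show d - 2 - (i + 1) + 1 = d - 2 - i by omega] at h

theorem exists_chainIndex {d n : ℕ} {c : ℕ → ℤ} (hc : IsChainIndex c (d - 2))
    (hn : c (d - 2) = n) :
    ∃ k ∈ indexSet d n, ∀ i ≤ d - 2, chainIndex d n k i = c i := by
  have hext : ∀ j ≤ d - 2,
      extIndex n (fun i : Fin (d - 2) => c (d - 2 - (i + 1))) j = c (d - 2 - j) := by
    intro j hj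
    rcases j with _ | j
    · rw [Nat.sub_zero, hn]; rfl
    · rw [extIndex, dif_pos (by omega)]
  refine ⟨fun i => c (d - 2 - (i + 1)), mem_indexSet.mpr fun i hi => ?_, fun i hi => ?_⟩
  · rw [hext _ (by omega), hext _ (by omega)]
    have h := hc (d - 2 - (i + 1)) (by omega)
    rwa [show d - 2 - (i + 1) + 1 = d - 2 - i by omega] at h
  · rw [chainIndex, hext _ (by omega), show d - 2 - (d - 2 - i) = i by omega]

theorem eq_of_chainIndex_eq {d n n' : ℕ} {k k' : Fin (d - 2) → ℤ}
    (h : ∀ i ≤ d - 2, chainIndex d n k i = chainIndex d n' k' i) : n = n' ∧ k = k' := by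
  refine ⟨?_, ?_⟩
  · have := h (d - 2) le_rfl
    rw [chainIndex_last, chainIndex_last] at this
    exact_mod_cast this
  · funext i
    have := h (d - 2 - (i + 1)) (by omega)
    rw [chainIndex, chainIndex, show d - 2 - (d - 2 - ((i : ℕ) + 1)) = i + 1 by omega, extIndex,
      extIndex, dif_pos i.2, dif_pos i.2] at this
    exact this

theorem solid_congr {c c' : ℕ → ℤ} {p : ℕ} (h : ∀ i ≤ p, c i = c' i) : solid c p = solid c' p := by
  induction p with
  | zero => rw [solid, solid, h 0 le_rfl]
  | succ p ih =>
    rw [solid, solid, ih fun i hi => h i (by omega), h p (by omega), h (p + 1) le_rfl]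

/-- On the sphere, the spherical harmonics are the restrictions of the solid harmonics. -/
theorem Y_eq_evalSphere {d n : ℕ} (hd : 3 ≤ d) {k : Fin (d - 2) → ℤ} (hk : k ∈ indexSet d n)
    (x : Sphere d) :
    Y d n k x = (normConst d n k : ℂ) * evalSphere x (solid (chainIndex d n k) (d - 2)) := by
  obtain ⟨N, rfl⟩ : ∃ N, d = N + 2 := ⟨d - 2, by omega⟩
  have hN : N + 2 - 2 = N := by omega
  rw [evalSphere_solid x (isChainIndex_chainIndex hk), hN, partialNorm_self]
  simp only [Y, harmonicAngles, chainIndex, hN]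
  rw [← Finset.prod_range_reflect]
  push_cast
  rw [one_pow, one_mul, Nat.sub_zero, ← mul_assoc]
  congr 2
  refine Finset.prod_congr rfl fun i hi => ?_
  rw [Finset.mem_range] at hi
  rw [show N - 1 - i + 1 = N - i by omega, show N - 1 - i = N - (i + 1) by omega,
    show N + 2 - (N - (i + 1)) - 1 = i + 2 by omega]
  have : ((N : ℝ) + 2 - ((N - (i + 1) : ℕ) : ℝ) - 2) = i + 1 := by
    rw [Nat.cast_sub (by omega)]; push_cast; ring
  rw [this]

/-! ### Orthonormality -/

/-- The `p`-th factor of the normalisation constant, cancelled against the growth of the squared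
norm of the solid harmonics by means of the duplication formula for the Gamma function. -/
theorem normFactor_mul_solidFactor {c : ℕ → ℤ} {p j : ℕ} (hc : (c p).natAbs ≤ (c (p + 1)).natAbs) :
    ((2 : ℝ) ^ (2 * ((c p).natAbs : ℤ) - (j : ℤ)) *
      (((c (p + 1)).natAbs - (c p).natAbs).factorial : ℝ) *
      (2 * ((c (p + 1)).natAbs : ℝ) + (p + 1)) *
      Real.Gamma (((p : ℝ) + 1) / 2 + (c p).natAbs) ^ 2 /
      (√Real.pi * Real.Gamma (((c (p + 1)).natAbs : ℝ) + (c p).natAbs + (p + 1)))) *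
      solidFactor c p = (2 : ℝ) / 2 ^ (p + j) *
      ((2 ^ (c (p + 1)).natAbs * Real.Gamma ((((p + 1 : ℕ) : ℝ) + 2) / 2 + (c (p + 1)).natAbs)) /
        (2 ^ (c p).natAbs * Real.Gamma (((p : ℝ) + 2) / 2 + (c p).natAbs))) := by
  obtain ⟨a, ha⟩ := Nat.exists_eq_add_of_le hc
  rw [solidFactor, ha, Nat.add_sub_cancel_left]
  generalize (c p).natAbs = b
  clear ha hc
  set lam : ℝ := ((p : ℝ) + 1) / 2 + b with hlam
  have hl : 0 < lam := by positivity
  rw [gaussConst_two_mul (by linarith), betaFunctional_gegenbauerPoly_self a hl]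
  have hdup := Real.Gamma_mul_Gamma_add_half lam
  have h2lam : 2 * lam = ((p + 2 * b : ℕ) : ℝ) + 1 := by rw [hlam]; push_cast; ring
  rw [show 1 - 2 * lam = -((p + 2 * b : ℕ) : ℝ) by rw [h2lam]; ring,
    Real.rpow_neg (by norm_num), Real.rpow_natCast] at hdup
  have e1 : ((b + a : ℕ) : ℝ) + b + (p + 1) = 2 * lam + a := by rw [h2lam]; push_cast; ring
  have e2 : 2 * ((b + a : ℕ) : ℝ) + (p + 1) = 2 * (a + lam) := by rw [hlam]; push_cast; ring
  have e3 : (((p + 1 : ℕ) : ℝ) + 2) / 2 + ((b + a : ℕ) : ℝ) = lam + 1 + a := by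
    rw [hlam]; push_cast; ring
  have e4 : ((p : ℝ) + 2) / 2 + b = lam + 1 / 2 := by rw [hlam]; ring
  rw [e1, e2, e3, e4, Real.Gamma_add_one hl.ne', zpow_sub₀ two_ne_zero, zpow_natCast,
    show (2 * (b : ℤ)) = ((2 * b : ℕ) : ℤ) by push_cast; ring, zpow_natCast]
  have g1 := (Real.Gamma_pos_of_pos hl).ne'
  have g2 := (Real.Gamma_pos_of_pos (show 0 < lam + 1 / 2 by positivity)).ne'
  have g3 := (Real.Gamma_pos_of_pos (show 0 < 2 * lam by positivity)).ne'
  have g4 := (Real.Gamma_pos_of_pos (show 0 < 2 * lam + a by positivity)).ne'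
  have g5 : √Real.pi ≠ 0 := (Real.sqrt_pos.mpr Real.pi_pos).ne'
  have g6 : (a : ℝ) + lam ≠ 0 := by positivity
  have g7 : (a.factorial : ℝ) ≠ 0 := by positivity
  generalize Real.Gamma (lam + 1 + a) = G at *
  generalize Real.Gamma (lam + 1 / 2) = G2 at *
  generalize Real.Gamma (2 * lam + a) = G4 at *
  generalize Real.Gamma (2 * lam) = G3 at *
  generalize Real.Gamma lam = G1 at *
  have hdup' : G1 * G2 * 2 ^ (p + 2 * b) = G3 * √Real.pi := by
    rw [hdup]; field_simp
  field_simp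
  rw [pow_add] at hdup'
  linear_combination (2 : ℝ) ^ b * 2 ^ a * 2 ^ j * G * hdup'

/-- The normalisation constant `A_k^n` cancels the Gaussian norm of the solid harmonic: the product
of the identities `normFactor_mul_solidFactor` telescopes. -/
theorem normConst_sq_mul {d n : ℕ} (hd : 3 ≤ d) {k : Fin (d - 2) → ℤ} (hk : k ∈ indexSet d n) :
    normConst d n k ^ 2 * (gaussConst 0 (2 * (chainIndex d n k 0).natAbs) *
      ∏ i ∈ Finset.range (d - 2), solidFactor (chainIndex d n k) i) =
      gaussConst (((d : ℝ) - 2) / 2) (2 * n) := by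
  have hchain := isChainIndex_chainIndex hk
  have hlast := chainIndex_last d n k
  obtain ⟨N, rfl⟩ : ∃ N, d = N + 1 + 2 := ⟨d - 3, by omega⟩
  have hN : N + 1 + 2 - 2 = N + 1 := by omega
  rw [hN] at hchain hlast ⊢
  set c := chainIndex (N + 1 + 2) n k with hc
  set B : ℕ → ℝ := fun p => (2 : ℝ) ^ (2 * ((c p).natAbs : ℤ) - ((N - p : ℕ) : ℤ)) *
        (((c (p + 1)).natAbs - (c p).natAbs).factorial : ℝ) *
        (2 * ((c (p + 1)).natAbs : ℝ) + (p + 1)) *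
        Real.Gamma (((p : ℝ) + 1) / 2 + (c p).natAbs) ^ 2 /
        (√Real.pi * Real.Gamma (((c (p + 1)).natAbs : ℝ) + (c p).natAbs + (p + 1))) with hB
  have hprod : ∏ j ∈ Finset.range (N + 1),
      (2 : ℝ) ^ (2 * ((extIndex n k (j + 1)).natAbs : ℤ) - (j : ℤ)) *
        (((extIndex n k j).natAbs - (extIndex n k (j + 1)).natAbs).factorial : ℝ) *
        (2 * ((extIndex n k j).natAbs : ℝ) + (N + 1 + 2 : ℕ) - j - 2) *
        Real.Gamma ((((N + 1 + 2 : ℕ) : ℝ) - j - 2) / 2 + (extIndex n k (j + 1)).natAbs) ^ 2 /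
        (√Real.pi * Real.Gamma (((extIndex n k j).natAbs : ℝ) + (extIndex n k (j + 1)).natAbs +
          (N + 1 + 2 : ℕ) - j - 2)) =
      ∏ p ∈ Finset.range (N + 1), B p := by
    rw [← Finset.prod_range_reflect]
    refine Finset.prod_congr rfl fun p hp => ?_
    rw [Finset.mem_range] at hp
    simp only [hB, hc, chainIndex, hN]
    rw [show N + 1 - 1 - p = N - p by omega, show N - p + 1 = N + 1 - p by omega,
      show N + 1 - (p + 1) = N - p by omega]
    have hcast : ((N - p : ℕ) : ℝ) = N - p := Nat.cast_sub (by omega)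
    have e1 : 2 * ((extIndex n k (N - p)).natAbs : ℝ) + (N + 1 + 2 : ℕ) - ((N - p : ℕ) : ℝ) - 2 =
        2 * ((extIndex n k (N - p)).natAbs : ℝ) + (p + 1) := by
      rw [hcast]; push_cast; ring
    have e2 : (((N + 1 + 2 : ℕ) : ℝ) - ((N - p : ℕ) : ℝ) - 2) / 2 = ((p : ℝ) + 1) / 2 := by
      rw [hcast]; push_cast; ring
    have e3 : ((extIndex n k (N - p)).natAbs : ℝ) + (extIndex n k (N + 1 - p)).natAbs +
          (N + 1 + 2 : ℕ) - ((N - p : ℕ) : ℝ) - 2 =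
        ((extIndex n k (N - p)).natAbs : ℝ) + (extIndex n k (N + 1 - p)).natAbs + (p + 1) := by
      rw [hcast]; push_cast; ring
    rw [e1, e2, e3]
  have hnonneg : 0 ≤ (2 : ℝ) ^ ((((N + 1 + 2 : ℕ) : ℤ) - 4) * (((N + 1 + 2 : ℕ) : ℤ) - 2)) /
      Real.Gamma (((N + 1 + 2 : ℕ) : ℝ) / 2) := by
    have := Real.Gamma_pos_of_pos (show 0 < ((N + 1 + 2 : ℕ) : ℝ) / 2 by positivity)
    positivity
  rw [normConst]
  dsimp only
  have hfac : (∏ p ∈ Finset.range (N + 1), B p) * ∏ p ∈ Finset.range (N + 1), solidFactor c p =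
      ∏ p ∈ Finset.range (N + 1), ((2 : ℝ) / 2 ^ N *
        ((2 ^ (c (p + 1)).natAbs * Real.Gamma ((((p + 1 : ℕ) : ℝ) + 2) / 2 + (c (p + 1)).natAbs)) /
        (2 ^ (c p).natAbs * Real.Gamma (((p : ℝ) + 2) / 2 + (c p).natAbs)))) := by
    rw [← Finset.prod_mul_distrib]
    refine Finset.prod_congr rfl fun p hp => ?_
    rw [Finset.mem_range] at hp
    rw [hB]
    dsimp only
    rw [normFactor_mul_solidFactor (hchain.mono (show p + 1 ≤ N + 1 by omega)).natAbs_le,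
        show p + (N - p) = N by omega]
  have htel : ∀ M, ∏ p ∈ Finset.range M,
      ((2 ^ (c (p + 1)).natAbs * Real.Gamma ((((p + 1 : ℕ) : ℝ) + 2) / 2 + (c (p + 1)).natAbs)) /
        (2 ^ (c p).natAbs * Real.Gamma (((p : ℝ) + 2) / 2 + (c p).natAbs))) =
      (2 ^ (c M).natAbs * Real.Gamma (((M : ℝ) + 2) / 2 + (c M).natAbs)) /
        (2 ^ (c 0).natAbs * Real.Gamma ((((0 : ℕ) : ℝ) + 2) / 2 + (c 0).natAbs)) := by
    have hpos : ∀ p : ℕ, (2 : ℝ) ^ (c p).natAbs *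
        Real.Gamma (((p : ℝ) + 2) / 2 + (c p).natAbs) ≠ 0 := fun p =>
      mul_ne_zero (by positivity) (Real.Gamma_pos_of_pos (by positivity)).ne'
    intro M
    induction M with
    | zero => rw [Finset.prod_range_zero, div_self (hpos 0)]
    | succ M ih => rw [Finset.prod_range_succ, ih, mul_comm, div_mul_div_cancel₀ (hpos M)]
  rw [congrArg Finset.range hN, hprod, Real.sq_sqrt]
  · rw [mul_mul_mul_comm, mul_comm _ (gaussConst _ _), mul_assoc,
      hfac,
      Finset.prod_mul_distrib, Finset.prod_const, Finset.card_range,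
      htel (N + 1), hlast,
      gaussConst_two_mul (by norm_num), gaussConst_two_mul (by push_cast; linarith [(Nat.cast_nonneg N : (0 : ℝ) ≤ N)]), Int.natAbs_natCast]
    have hpow : (2 : ℝ) ^ ((((N + 1 + 2 : ℕ) : ℤ) - 4) * (((N + 1 + 2 : ℕ) : ℤ) - 2)) *
        (2 / 2 ^ N) ^ (N + 1) = 1 := by
      rw [show (((N + 1 + 2 : ℕ) : ℤ) - 2) = ((N + 1 : ℕ) : ℤ) by push_cast; ring, zpow_mul,
        zpow_natCast, ← mul_pow, show (((N + 1 + 2 : ℕ) : ℤ) - 4) = (N : ℤ) - 1 by push_cast; ring,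
        zpow_sub₀ two_ne_zero, zpow_natCast, zpow_one]
      field_simp
      exact one_pow _
    have e1 : (((N + 1 + 2 : ℕ) : ℝ) - 2) / 2 + 1 = ((N + 1 + 2 : ℕ) : ℝ) / 2 := by ring
    have e2 : (((N + 1 : ℕ) : ℝ) + 2) / 2 = ((N + 1 + 2 : ℕ) : ℝ) / 2 := by push_cast; ring
    have e3 : (((0 : ℕ) : ℝ) + 2) / 2 = 1 := by norm_num
    have e4 : (0 : ℝ) + 1 = 1 := by norm_num
    have g1 := (Real.Gamma_pos_of_pos (show 0 < ((N + 1 + 2 : ℕ) : ℝ) / 2 by positivity)).ne'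
    have g2 := (Real.Gamma_pos_of_pos (show 0 < (1 : ℝ) + (c 0).natAbs by positivity)).ne'
    rw [e1, e2, e3, e4, Real.Gamma_one]
    generalize (2 : ℝ) ^ ((((N + 1 + 2 : ℕ) : ℤ) - 4) * (((N + 1 + 2 : ℕ) : ℤ) - 2)) = Z at hpow ⊢
    generalize ((2 : ℝ) / 2 ^ N) ^ (N + 1) = W at hpow ⊢
    field_simp
    linear_combination hpow
  · refine mul_nonneg hnonneg (Finset.prod_nonneg fun p _ => ?_)
    have := Real.Gamma_pos_of_pos
      (show 0 < ((c (p + 1)).natAbs : ℝ) + (c p).natAbs + (p + 1) by positivity)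
    positivity

/-- The spherical harmonics are orthonormal. -/
theorem innerL2_Y {d n n' : ℕ} (hd : 3 ≤ d) {k k' : Fin (d - 2) → ℤ} (hk : k ∈ indexSet d n)
    (hk' : k' ∈ indexSet d n') :
    innerL2 d (Y d n k) (Y d n' k') = if n = n' ∧ k = k' then 1 else 0 := by
  have : NeZero d := ⟨by omega⟩
  set c := chainIndex d n k with hc
  set c' := chainIndex d n' k' with hc'
  have hcc : IsChainIndex c (d - 2) := isChainIndex_chainIndex hk
  have hcc' : IsChainIndex c' (d - 2) := isChainIndex_chainIndex hk'
  have hlast : c (d - 2) = n := chainIndex_last d n k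
  have hlast' : c' (d - 2) = n' := chainIndex_last d n' k'
  have hlam : -1 < ((d : ℝ) - 2) / 2 := by
    have : (3 : ℝ) ≤ d := by exact_mod_cast hd
    linarith
  have h1 : innerL2 d (Y d n k) (Y d n' k') = (normConst d n k : ℂ) * normConst d n' k' *
      ∫ x : Sphere d, evalSphere x (solid c (d - 2) * conjPoly (solid c' (d - 2)))
        ∂(surfaceMeasure d) := by
    rw [innerL2, ← integral_const_mul]
    refine integral_congr_ae (ae_of_all _ fun x => ?_)
    simp only
    rw [Y_eq_evalSphere hd hk, Y_eq_evalSphere hd hk', map_mul, Complex.conj_ofReal, map_mul,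
      evalSphere_conjPoly]
    ring
  have hsupp : solid c (d - 2) * conjPoly (solid c' (d - 2)) ∈ supported ℂ (Iio d) := by
    have h2 : d - 2 + 2 = d := by omega
    have h3 := solid_mem_supported c (d - 2)
    have h4 := conjPoly_mem_supported (solid_mem_supported c' (d - 2))
    rw [h2] at h3 h4
    exact Subalgebra.mul_mem _ h3 h4
  have h2 := gaussConst_mul_integral_evalSphere hsupp
    ((isHomogeneous_solid hcc).mul ((isHomogeneous_solid hcc').map _))
  rw [gaussFunctional_solid_mul_conj hcc hcc'] at h2
  have hne : ∀ e, (gaussConst (((d : ℝ) - 2) / 2) e : ℂ) ≠ 0 := fun e =>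
    Complex.ofReal_ne_zero.mpr (gaussConst_pos hlam e).ne'
  by_cases heq : n = n' ∧ k = k'
  · rw [if_pos heq]
    obtain ⟨rfl, rfl⟩ := heq
    rw [if_pos fun i _ => rfl, hlast, hlast', Int.natAbs_natCast, ← two_mul] at h2
    have h3 := normConst_sq_mul hd hk
    rw [h1]
    apply mul_left_cancel₀ (hne (2 * n))
    rw [mul_left_comm, h2, ← h3]
    push_cast
    ring
  · rw [if_neg heq]
    rw [if_neg fun h => heq (eq_of_chainIndex_eq h)] at h2
    rw [h1, (mul_eq_zero.mp h2).resolve_left (hne _), mul_zero]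

/-! ### Every polynomial is a combination of solid harmonics -/

/-- The span of the products of powers of `|x|²` and solid harmonics of total degree `D` in the
variables `X_0, …, X_{p+1}`. -/
def solidSpan (p D : ℕ) : Submodule ℂ (MvPolynomial ℕ ℂ) :=
  Submodule.span ℂ {Q | ∃ (s : ℕ) (c : ℕ → ℤ), IsChainIndex c p ∧ 2 * s + (c p).natAbs = D ∧
    Q = rhoPoly (p + 2) ^ s * solid c p}

theorem rhoPoly_pow_mul_solid_mem {p : ℕ} (s : ℕ) {c : ℕ → ℤ} (hc : IsChainIndex c p) :
    rhoPoly (p + 2) ^ s * solid c p ∈ solidSpan p (2 * s + (c p).natAbs) :=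
  Submodule.subset_span ⟨s, c, hc, rfl, rfl⟩

theorem rhoPoly_mul_mem_solidSpan {p D : ℕ} {Q : MvPolynomial ℕ ℂ} (hQ : Q ∈ solidSpan p D) :
    rhoPoly (p + 2) * Q ∈ solidSpan p (D + 2) := by
  induction hQ using Submodule.span_induction with
  | mem Q hQ =>
    obtain ⟨s, c, hc, rfl, rfl⟩ := hQ
    rw [← mul_assoc, ← pow_succ', show 2 * s + (c p).natAbs + 2 = 2 * (s + 1) + (c p).natAbs by ring]
    exact rhoPoly_pow_mul_solid_mem _ hc
  | zero => rw [mul_zero]; exact Submodule.zero_mem _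
  | add P Q _ _ hP hQ => rw [mul_add]; exact Submodule.add_mem _ hP hQ
  | smul a Q _ hQ => rw [mul_smul_comm]; exact Submodule.smul_mem _ _ hQ

theorem rhoPoly_pow_mul_mem_solidSpan {p D : ℕ} {Q : MvPolynomial ℕ ℂ} (hQ : Q ∈ solidSpan p D)
    (s : ℕ) : rhoPoly (p + 2) ^ s * Q ∈ solidSpan p (D + 2 * s) := by
  induction s with
  | zero => simpa using hQ
  | succ s ih =>
    rw [pow_succ', mul_assoc]
    exact rhoPoly_mul_mem_solidSpan ih

/-- Powers of the new variable are combinations of Gegenbauer factors. -/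
theorem X_pow_mul_solid_mem {p : ℕ} {c : ℕ → ℤ} (hc : IsChainIndex c p) (i : ℕ) :
    X (p + 2) ^ i * solid c p ∈ solidSpan (p + 1) (i + (c p).natAbs) := by
  induction i using Nat.strong_induction_on with
  | _ i ih =>
    set lam : ℝ := ((p : ℝ) + 1) / 2 + (c p).natAbs with hlam
    have hlam0 : 0 < lam := by positivity
    -- The leading term of `gegenbauerSolid i lam` is a nonzero multiple of `X ^ i`.
    have hG : gegenbauerSolid i lam (p + 2) * solid c p ∈
        solidSpan (p + 1) (i + (c p).natAbs) := by
      set c' : ℕ → ℤ := Function.update c (p + 1) ((i + (c p).natAbs : ℕ) : ℤ) with hc'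
      have hlow : ∀ j ≤ p, c' j = c j := fun j hj => Function.update_of_ne (by omega) _ _
      have hlast : c' (p + 1) = ((i + (c p).natAbs : ℕ) : ℤ) := Function.update_self _ _ _
      have hchain : IsChainIndex c' (p + 1) := by
        intro j hj
        rcases Nat.lt_succ_iff_lt_or_eq.mp hj with h | rfl
        · rw [hlow j h.le, hlow (j + 1) h]
          exact hc j h
        · rw [hlow j le_rfl, hlast, Int.abs_eq_natAbs]
          push_cast
          omega
      have h := rhoPoly_pow_mul_solid_mem 0 hchain
      rw [pow_zero, one_mul, solid, solid_congr hlow, hlow p le_rfl, hlast, Int.natAbs_natCast,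
        Nat.add_sub_cancel, mul_zero, zero_add] at h
      exact h
    have hlead := gegenbauerCoeff_zero_pos i hlam0
    have hsplit : C (gegenbauerCoeff i lam 0 : ℂ) * (X (p + 2) ^ i * solid c p) =
        gegenbauerSolid i lam (p + 2) * solid c p - ∑ l ∈ Finset.range (i / 2),
          C (gegenbauerCoeff i lam (l + 1) : ℂ) *
            (rhoPoly (p + 3) ^ (l + 1) * (X (p + 2) ^ (i - 2 * (l + 1)) * solid c p)) := by
      rw [gegenbauerSolid, Finset.sum_range_succ', add_mul, Finset.sum_mul, eq_sub_iff_add_eq,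
        add_comm]
      congr 1
      · exact Finset.sum_congr rfl fun l _ => by ring
      · simp; ring
    have hmem : C (gegenbauerCoeff i lam 0 : ℂ) * (X (p + 2) ^ i * solid c p) ∈
        solidSpan (p + 1) (i + (c p).natAbs) := by
      rw [hsplit]
      refine Submodule.sub_mem _ hG (Submodule.sum_mem _ fun l hl => ?_)
      rw [Finset.mem_range] at hl
      rw [C_mul']
      refine Submodule.smul_mem _ _ ?_
      have h := rhoPoly_pow_mul_mem_solidSpan (ih (i - 2 * (l + 1)) (by omega)) (l + 1)
      rwa [show i - 2 * (l + 1) + (c p).natAbs + 2 * (l + 1) = i + (c p).natAbs by omega] at h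
    rw [C_mul'] at hmem
    exact (Submodule.smul_mem_iff _ (Complex.ofReal_ne_zero.mpr hlead.ne')).mp hmem

/-- Powers of `|(X_0, …, X_{p+1})|²` are removed one at a time, as the difference of
`|(X_0, …, X_{p+2})|²` and `X_{p+2}²`. -/
theorem X_pow_mul_rhoPoly_pow_mul_solid_mem {p : ℕ} {c : ℕ → ℤ} (hc : IsChainIndex c p)
    (s i : ℕ) : X (p + 2) ^ i * (rhoPoly (p + 2) ^ s * solid c p) ∈
      solidSpan (p + 1) (i + (2 * s + (c p).natAbs)) := by
  induction s generalizing i with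
  | zero => simpa using X_pow_mul_solid_mem hc i
  | succ s ih =>
    have h1 := rhoPoly_mul_mem_solidSpan (ih i)
    have h2 := ih (i + 2)
    rw [show i + (2 * (s + 1) + (c p).natAbs) = i + (2 * s + (c p).natAbs) + 2 by ring]
    rw [show i + 2 + (2 * s + (c p).natAbs) = i + (2 * s + (c p).natAbs) + 2 by ring] at h2
    have h3 := Submodule.sub_mem _ h1 h2
    convert h3 using 1
    rw [rhoPoly_succ (p + 2)]
    ring

theorem X_pow_mul_mem_solidSpan {p D : ℕ} {Q : MvPolynomial ℕ ℂ} (hQ : Q ∈ solidSpan p D)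
    (i : ℕ) : X (p + 2) ^ i * Q ∈ solidSpan (p + 1) (i + D) := by
  induction hQ using Submodule.span_induction with
  | mem Q hQ =>
    obtain ⟨s, c, hc, rfl, rfl⟩ := hQ
    exact X_pow_mul_rhoPoly_pow_mul_solid_mem hc s i
  | zero => rw [mul_zero]; exact Submodule.zero_mem _
  | add P Q _ _ hP hQ => rw [mul_add]; exact Submodule.add_mem _ hP hQ
  | smul a Q _ hQ => rw [mul_smul_comm]; exact Submodule.smul_mem _ _ hQ

/-- Multiplication by `X_1 ± i X_0` raises or lowers the index of the planar polynomials. -/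
theorem isotropic_mul_mem_solidSpan {D : ℕ} {Q : MvPolynomial ℕ ℂ} (hQ : Q ∈ solidSpan 0 D) :
    (X 1 + C Complex.I * X 0) * Q ∈ solidSpan 0 (D + 1) ∧
      (X 1 - C Complex.I * X 0) * Q ∈ solidSpan 0 (D + 1) := by
  set u : MvPolynomial ℕ ℂ := X 1 + C Complex.I * X 0 with hu
  set v : MvPolynomial ℕ ℂ := X 1 - C Complex.I * X 0 with hv
  have huv : rhoPoly 2 = u * v := rhoPoly_two
  have hplanar : ∀ k, planarPoly k = if 0 ≤ k then u ^ k.natAbs else v ^ k.natAbs := fun k => rfl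
  clear_value u v
  have hmem : ∀ (s : ℕ) (k : ℤ), rhoPoly 2 ^ s * planarPoly k ∈
      solidSpan 0 (2 * s + k.natAbs) := fun s k =>
    rhoPoly_pow_mul_solid_mem (p := 0) s (c := fun _ => k) fun i hi => absurd hi (by omega)
  have hup : ∀ (s : ℕ) (k : ℤ), u * (rhoPoly 2 ^ s * planarPoly k) ∈
      solidSpan 0 (2 * s + k.natAbs + 1) := by
    intro s k
    rcases le_or_gt 0 k with hk | hk
    · have h := hmem s (k + 1)
      rw [hplanar, if_pos (by omega), show (k + 1).natAbs = k.natAbs + 1 by omega] at h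
      rw [show rhoPoly 2 ^ s * u ^ (k.natAbs + 1) = u * (rhoPoly 2 ^ s * u ^ k.natAbs) by ring] at h
      rw [hplanar, if_pos hk]
      exact h
    · have h := hmem (s + 1) (k + 1)
      rw [show 2 * (s + 1) + (k + 1).natAbs = 2 * s + k.natAbs + 1 by omega] at h
      convert h using 1
      rw [hplanar k, if_neg (by omega), show k.natAbs = (k + 1).natAbs + 1 by omega,
        show planarPoly (k + 1) = v ^ (k + 1).natAbs by
          rw [hplanar]
          split_ifs
          · rw [show (k + 1).natAbs = 0 by omega, pow_zero, pow_zero]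
          · rfl, pow_succ, pow_succ]
      nth_rewrite 3 [huv]
      ring
  have hdown : ∀ (s : ℕ) (k : ℤ), v * (rhoPoly 2 ^ s * planarPoly k) ∈
      solidSpan 0 (2 * s + k.natAbs + 1) := by
    intro s k
    rcases le_or_gt k 0 with hk | hk
    · have h := hmem s (k - 1)
      rw [hplanar, if_neg (by omega), show (k - 1).natAbs = k.natAbs + 1 by omega] at h
      rw [show planarPoly k = v ^ k.natAbs by
          rw [hplanar]
          split_ifs
          · rw [show k.natAbs = 0 by omega, pow_zero, pow_zero]
          · rfl]
      rw [show rhoPoly 2 ^ s * v ^ (k.natAbs + 1) = v * (rhoPoly 2 ^ s * v ^ k.natAbs) by ring] at h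
      exact h
    · have h := hmem (s + 1) (k - 1)
      rw [show 2 * (s + 1) + (k - 1).natAbs = 2 * s + k.natAbs + 1 by omega] at h
      convert h using 1
      rw [hplanar k, if_pos (by omega), show k.natAbs = (k - 1).natAbs + 1 by omega,
        hplanar (k - 1), if_pos (by omega), pow_succ, pow_succ]
      nth_rewrite 3 [huv]
      ring
  induction hQ using Submodule.span_induction with
  | mem Q hQ =>
    obtain ⟨s, c, -, rfl, rfl⟩ := hQ
    exact ⟨hup s (c 0), hdown s (c 0)⟩
  | zero => simp
  | add P Q _ _ hP hQ =>
    rw [mul_add, mul_add]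
    exact ⟨Submodule.add_mem _ hP.1 hQ.1, Submodule.add_mem _ hP.2 hQ.2⟩
  | smul a Q _ hQ =>
    rw [mul_smul_comm, mul_smul_comm]
    exact ⟨Submodule.smul_mem _ _ hQ.1, Submodule.smul_mem _ _ hQ.2⟩

theorem X_mul_mem_solidSpan_zero {D : ℕ} {Q : MvPolynomial ℕ ℂ} (hQ : Q ∈ solidSpan 0 D) :
    X 0 * Q ∈ solidSpan 0 (D + 1) ∧ X 1 * Q ∈ solidSpan 0 (D + 1) := by
  obtain ⟨h1, h2⟩ := isotropic_mul_mem_solidSpan hQ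
  have hC : (C Complex.I : MvPolynomial ℕ ℂ) * C Complex.I = -1 := by
    rw [← C_mul, Complex.I_mul_I]; simp
  constructor
  · have h3 := Submodule.smul_mem _ (-(Complex.I / 2)) (Submodule.sub_mem _ h1 h2)
    convert h3 using 1
    have hC2 : (C (-(Complex.I / 2)) : MvPolynomial ℕ ℂ) * (2 * C Complex.I) = 1 := by
      rw [show (2 : MvPolynomial ℕ ℂ) = C 2 from rfl, ← C_mul, ← C_mul,
        show -(Complex.I / 2) * (2 * Complex.I) = -(Complex.I * Complex.I) by ring,
        Complex.I_mul_I]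
      simp
    rw [smul_eq_C_mul]
    linear_combination (-(X 0 * Q)) * hC2
  · have h3 := Submodule.smul_mem _ (1 / 2 : ℂ) (Submodule.add_mem _ h1 h2)
    convert h3 using 1
    have hC2 : (C (1 / 2) : MvPolynomial ℕ ℂ) * 2 = 1 := by
      rw [show (2 : MvPolynomial ℕ ℂ) = C 2 from rfl, ← C_mul]
      norm_num
    rw [smul_eq_C_mul]
    linear_combination (-(X 1 * Q)) * hC2

theorem one_mem_solidSpan_zero : (1 : MvPolynomial ℕ ℂ) ∈ solidSpan 0 0 := by
  have h := rhoPoly_pow_mul_solid_mem (p := 0) 0 (c := fun _ => 0) fun i hi => absurd hi (by omega)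
  simpa [solid, planarPoly] using h

theorem monomial_mem_solidSpan {p : ℕ} {α : ℕ →₀ ℕ} (hα : α.support ⊆ Finset.range (p + 2)) :
    monomial α (1 : ℂ) ∈ solidSpan p α.degree := by
  induction p generalizing α with
  | zero =>
    have h1 : ∀ a b : ℕ, (X 0 ^ a * X 1 ^ b : MvPolynomial ℕ ℂ) ∈ solidSpan 0 (a + b) := by
      intro a b
      induction a with
      | zero =>
        induction b with
        | zero => simpa using one_mem_solidSpan_zero
        | succ b ih =>
          rw [show (X 0 ^ 0 * X 1 ^ (b + 1) : MvPolynomial ℕ ℂ) = X 1 * (X 0 ^ 0 * X 1 ^ b) by ring]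
          exact (X_mul_mem_solidSpan_zero ih).2
      | succ a ih =>
        rw [show (X 0 ^ (a + 1) * X 1 ^ b : MvPolynomial ℕ ℂ) = X 0 * (X 0 ^ a * X 1 ^ b) by ring,
          show a + 1 + b = a + b + 1 by ring]
        exact (X_mul_mem_solidSpan_zero ih).1
    have h2 := h1 (α 0) (α 1)
    have hdeg : α.degree = α 0 + α 1 := by
      rw [Finsupp.degree_apply, Finset.sum_subset hα fun i _ hi => by simpa using hi]
      simp [Finset.sum_range_succ]
    have hmon : monomial α (1 : ℂ) = X 0 ^ α 0 * X 1 ^ α 1 := by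
      rw [monomial_eq, Finsupp.prod_of_support_subset _ hα _ fun _ _ => pow_zero _]
      simp [Finset.prod_range_succ]
    rwa [hdeg, hmon]
  | succ p ih =>
    have hβ : (α.erase (p + 2)).support ⊆ Finset.range (p + 2) := by
      intro i hi
      rw [Finsupp.support_erase, Finset.mem_erase] at hi
      have := hα hi.2
      rw [Finset.mem_range] at this ⊢
      omega
    have h := X_pow_mul_mem_solidSpan (ih hβ) (α (p + 2))
    have hsum : Finsupp.single (p + 2) (α (p + 2)) + α.erase (p + 2) = α :=
      Finsupp.single_add_erase _ _
    have hdeg : α.degree = α (p + 2) + (α.erase (p + 2)).degree := by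
      conv_lhs => rw [← hsum]
      rw [map_add, Finsupp.degree_single]
    have hmon : monomial α (1 : ℂ) = X (p + 2) ^ α (p + 2) * monomial (α.erase (p + 2)) 1 := by
      conv_lhs => rw [← hsum]
      rw [X_pow_eq_monomial, monomial_mul, one_mul]
    rwa [hdeg, hmon]

/-- Every homogeneous polynomial of degree `D` is a combination of products of powers of `|x|²` and
solid harmonics. -/
theorem mem_solidSpan {p D : ℕ} {P : MvPolynomial ℕ ℂ} (hP : P ∈ supported ℂ (Iio (p + 2)))
    (hD : P.IsHomogeneous D) : P ∈ solidSpan p D := by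
  rw [P.as_sum]
  refine Submodule.sum_mem _ fun α hα => ?_
  have hsupp : α.support ⊆ Finset.range (p + 2) := by
    intro l hl
    have h1 : l ∈ P.vars := (mem_vars_iff_mem_support l).mpr ⟨α, hα, hl⟩
    simpa using mem_supported.mp hP h1
  have h1 : monomial α (coeff α P) = coeff α P • monomial α (1 : ℂ) := by
    rw [smul_monomial, smul_eq_mul, mul_one]
  have h2 : α.degree = D := by
    rw [hD.degree_eq_sum_deg_support hα, Finsupp.degree_apply]
  rw [h1, ← h2]
  exact Submodule.smul_mem _ _ (monomial_mem_solidSpan hsupp)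

/-! ### Polynomial functions of a family of real coordinates -/

/-- The functions on `S` that are complex polynomials of degree at most `N` in the real coordinate
functions `v · i`. -/
def polyFun {S ι : Type*} (v : S → ι → ℝ) (N : ℕ) : Submodule ℂ (S → ℂ) where
  carrier := {f | ∃ P : MvPolynomial ι ℂ, P.totalDegree ≤ N ∧
    ∀ x, f x = eval (fun i => (v x i : ℂ)) P}
  add_mem' := by
    rintro f g ⟨P, hP, hf⟩ ⟨Q, hQ, hg⟩
    exact ⟨P + Q, (totalDegree_add _ _).trans (max_le hP hQ), fun x => by
      rw [Pi.add_apply, hf, hg, map_add]⟩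
  zero_mem' := ⟨0, by simp, fun x => by simp⟩
  smul_mem' := by
    rintro a f ⟨P, hP, hf⟩
    exact ⟨a • P, (totalDegree_smul_le _ _).trans hP, fun x => by
      rw [Pi.smul_apply, hf, smul_eval, smul_eq_mul]⟩

section polyFun

variable {S ι : Type*} {v : S → ι → ℝ}

theorem polyFun_mono {M N : ℕ} (h : M ≤ N) : polyFun v M ≤ polyFun v N := by
  rintro f ⟨P, hP, hf⟩
  exact ⟨P, hP.trans h, hf⟩

theorem const_mem_polyFun (a : ℂ) (N : ℕ) : (fun _ => a) ∈ polyFun v N :=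
  ⟨C a, by simp, fun x => by simp⟩

theorem coord_mem_polyFun (i : ι) : (fun x => (v x i : ℂ)) ∈ polyFun v 1 :=
  ⟨X i, by simp, fun x => by simp⟩

theorem mul_mem_polyFun {M N : ℕ} {f g : S → ℂ} (hf : f ∈ polyFun v M) (hg : g ∈ polyFun v N) :
    (fun x => f x * g x) ∈ polyFun v (M + N) := by
  obtain ⟨P, hP, hf⟩ := hf
  obtain ⟨Q, hQ, hg⟩ := hg
  exact ⟨P * Q, (totalDegree_mul _ _).trans (add_le_add hP hQ), fun x => by
    simp only [hf, hg, map_mul]⟩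

theorem pow_mem_polyFun {M : ℕ} {f : S → ℂ} (hf : f ∈ polyFun v M) (a : ℕ) :
    (fun x => f x ^ a) ∈ polyFun v (a * M) := by
  induction a with
  | zero => simpa using const_mem_polyFun 1 _
  | succ a ih =>
    simp only [pow_succ, add_mul, one_mul]
    exact mul_mem_polyFun ih hf

theorem prod_mem_polyFun {κ : Type*} (s : Finset κ) {f : κ → S → ℂ} {a : κ → ℕ}
    (hf : ∀ i ∈ s, f i ∈ polyFun v (a i)) :
    (fun x => ∏ i ∈ s, f i x) ∈ polyFun v (∑ i ∈ s, a i) := by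
  classical
  induction s using Finset.induction_on with
  | empty => simpa using const_mem_polyFun 1 _
  | insert i s hi ih =>
    simp only [Finset.prod_insert hi, Finset.sum_insert hi]
    exact mul_mem_polyFun (hf i (Finset.mem_insert_self _ _))
      (ih fun j hj => hf j (Finset.mem_insert_of_mem hj))

theorem conj_mem_polyFun {N : ℕ} {f : S → ℂ} (hf : f ∈ polyFun v N) :
    (fun x => (starRingEnd ℂ) (f x)) ∈ polyFun v N := by
  obtain ⟨P, hP, hf⟩ := hf
  refine ⟨MvPolynomial.map (starRingEnd ℂ) P, ?_, fun x => ?_⟩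
  · exact (Finset.sup_mono (support_map_subset _ _)).trans hP
  · simp only [hf]
    rw [eval_map]
    simp [eval_eq, eval₂_eq]

/-- Substitution of polynomial functions of degree one. -/
theorem eval_mem_polyFun {κ : Type*} {w : κ → S → ℂ} (P : MvPolynomial κ ℂ)
    (hw : ∀ i ∈ P.vars, w i ∈ polyFun v 1) :
    (fun x => eval (fun i => w i x) P) ∈ polyFun v P.totalDegree := by
  simp only [eval_eq]
  have : (fun x => ∑ α ∈ P.support, coeff α P * ∏ i ∈ α.support, w i x ^ α i) =
      ∑ α ∈ P.support, coeff α P • fun x => ∏ i ∈ α.support, w i x ^ α i := by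
    funext x
    simp
  rw [this]
  refine Submodule.sum_mem _ fun α hα => Submodule.smul_mem _ _ ?_
  refine polyFun_mono (le_totalDegree hα) ?_
  refine prod_mem_polyFun _ fun i hi => ?_
  have h := pow_mem_polyFun (hw i ((mem_vars_iff_mem_support i).mpr ⟨α, hα, hi⟩)) (α i)
  rwa [mul_one] at h

theorem comp_mem_polyFun {S' ι' : Type*} {v' : S' → ι' → ℝ} {N : ℕ} {f : S' → ℂ}
    (hf : f ∈ polyFun v' N) {T : S → S'} (hT : ∀ i, (fun x => (v' (T x) i : ℂ)) ∈ polyFun v 1) :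
    (fun x => f (T x)) ∈ polyFun v N := by
  obtain ⟨P, hP, hf⟩ := hf
  simp only [hf]
  exact polyFun_mono hP (eval_mem_polyFun (w := fun i x => (v' (T x) i : ℂ)) P fun i _ => hT i)

theorem finiteDimensional_polyFun [Finite ι] (N : ℕ) : FiniteDimensional ℂ (polyFun v N) := by
  let L : MvPolynomial ι ℂ →ₗ[ℂ] (S → ℂ) :=
    LinearMap.pi fun x => (aeval fun i => (v x i : ℂ)).toLinearMap
  have h : polyFun v N = (restrictTotalDegree ι ℂ N).map L := by
    ext f
    rw [Submodule.mem_map]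
    constructor
    · rintro ⟨P, hP, hf⟩
      refine ⟨P, (mem_restrictTotalDegree _ _ _).mpr hP, funext fun x => ?_⟩
      rw [hf]
      rfl
    · rintro ⟨P, hP, rfl⟩
      exact ⟨P, (mem_restrictTotalDegree _ _ _).mp hP, fun x => rfl⟩
  rw [h]
  infer_instance

theorem continuous_of_mem_polyFun [TopologicalSpace S] (hv : ∀ i, Continuous fun x => v x i)
    {N : ℕ} {f : S → ℂ} (hf : f ∈ polyFun v N) : Continuous f := by
  obtain ⟨P, hP, hf⟩ := hf
  simp only [funext hf, eval_eq]
  exact continuous_finsetSum _ fun α _ => continuous_const.mul (continuous_finsetProd _ fun i _ =>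
    (Complex.continuous_ofReal.comp (hv i)).pow _)

end polyFun

/-! ### Spherical polynomials as polynomial functions -/

/-- The Cartesian coordinates of a point of the sphere. -/
def sphereCoord {d : ℕ} (x : Sphere d) (i : Fin d) : ℝ := (x : EuclideanSpace ℝ (Fin d)) i

theorem continuous_sphereCoord {d : ℕ} (i : Fin d) :
    Continuous fun x : Sphere d => sphereCoord x i := by
  simp only [sphereCoord]
  fun_prop

theorem coord_eq_sphereCoord {d : ℕ} (x : Sphere d) (i : Fin d) :
    coord (x : EuclideanSpace ℝ (Fin d)) i = sphereCoord x i := by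
  simp [coord, sphereCoord]

theorem normConst_ne_zero {d n : ℕ} (hd : 3 ≤ d) {k : Fin (d - 2) → ℤ} (hk : k ∈ indexSet d n) :
    normConst d n k ≠ 0 := by
  intro h
  have h1 := normConst_sq_mul hd hk
  rw [h] at h1
  have h2 : (3 : ℝ) ≤ d := by exact_mod_cast hd
  have h3 := gaussConst_pos (show -1 < ((d : ℝ) - 2) / 2 by linarith) (2 * n)
  simp at h1
  exact h3.ne h1

theorem Y_mem_polyFun {d n : ℕ} (hd : 3 ≤ d) {k : Fin (d - 2) → ℤ} (hk : k ∈ indexSet d n) :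
    Y d n k ∈ polyFun (sphereCoord (d := d)) n := by
  rw [funext fun x => Y_eq_evalSphere hd hk x]
  refine Submodule.smul_mem _ (normConst d n k : ℂ) ?_
  have h := isHomogeneous_solid (isChainIndex_chainIndex hk)
  rw [chainIndex_last, Int.natAbs_natCast] at h
  refine polyFun_mono h.totalDegree_le ?_
  refine eval_mem_polyFun (w := fun i (x : Sphere d) =>
    (coord (x : EuclideanSpace ℝ (Fin d)) i : ℂ)) _ fun i hi => ?_
  have hi' : i < d := by
    have := mem_supported.mp (solid_mem_supported (chainIndex d n k) (d - 2)) hi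
    rw [mem_Iio] at this
    omega
  have := coord_mem_polyFun (v := sphereCoord (d := d)) ⟨i, hi'⟩
  simpa only [← coord_eq_sphereCoord] using this

/-- The spherical polynomials are the restrictions of the polynomials in the coordinates. -/
theorem sphericalPoly_eq_polyFun {d : ℕ} (hd : 3 ≤ d) (N : ℕ) :
    sphericalPoly d N = polyFun (sphereCoord (d := d)) N := by
  apply le_antisymm
  · refine Submodule.span_le.mpr ?_
    rintro f ⟨n, hn, k, hk, rfl⟩
    exact polyFun_mono hn (Y_mem_polyFun hd hk)
  · rintro f ⟨P, hP, hf⟩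
    have h2 : d - 2 + 2 = d := by omega
    have hev : ∀ Q : MvPolynomial (Fin d) ℂ, ∀ x : Sphere d,
        eval (fun i => (sphereCoord x i : ℂ)) Q = evalSphere x (rename Fin.val Q) := by
      intro Q x
      rw [evalSphere, eval_rename]
      congr 2
      funext i
      simp [coord_eq_sphereCoord]
    have hmem : ∀ D ≤ N, ∀ Q ∈ solidSpan (d - 2) D,
        (fun x : Sphere d => evalSphere x Q) ∈ sphericalPoly d N := by
      intro D hD Q hQ
      induction hQ using Submodule.span_induction with
      | mem Q hQ =>
        obtain ⟨s, c, hc, hdeg, rfl⟩ := hQ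
        have hlast : 0 ≤ c (d - 2) := by
          have := hc (d - 2 - 1) (by omega)
          rw [show d - 2 - 1 + 1 = d - 2 by omega] at this
          exact (abs_nonneg _).trans this
        obtain ⟨n, hn⟩ := Int.eq_ofNat_of_zero_le hlast
        obtain ⟨k, hk, hkc⟩ := exists_chainIndex hc hn
        have hrho : ∀ x : Sphere d, evalSphere x (rhoPoly d) = 1 := by
          intro x
          rw [evalSphere_rhoPoly, partialNorm_self]
          simp
        have heq : (fun x : Sphere d => evalSphere x (rhoPoly (d - 2 + 2) ^ s * solid c (d - 2))) =
            (normConst d n k : ℂ)⁻¹ • Y d n k := by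
          funext x
          rw [map_mul, map_pow, h2, hrho, one_pow, one_mul, Pi.smul_apply,
            Y_eq_evalSphere hd hk, solid_congr hkc, smul_eq_mul,
            inv_mul_cancel_left₀ (Complex.ofReal_ne_zero.mpr (normConst_ne_zero hd hk))]
        rw [heq]
        refine Submodule.smul_mem _ _ (Submodule.subset_span ⟨n, ?_, k, hk, rfl⟩)
        rw [hn] at hdeg
        simp at hdeg
        omega
      | zero =>
        simp only [map_zero]
        exact Submodule.zero_mem (sphericalPoly d N)
      | add P Q _ _ hP hQ =>
        simp only [map_add]
        exact Submodule.add_mem _ hP hQ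
      | smul a Q _ hQ =>
        have : (fun x : Sphere d => evalSphere x (a • Q)) = a • fun x => evalSphere x Q := by
          funext x
          rw [smul_eq_C_mul, map_mul, evalSphere_C]
          rfl
        rw [this]
        exact Submodule.smul_mem _ _ hQ
    have hfsum : f = ∑ D ∈ Finset.range (P.totalDegree + 1),
        fun x : Sphere d => evalSphere x (rename Fin.val (homogeneousComponent D P)) := by
      funext x
      rw [hf, Finset.sum_apply, hev]
      conv_lhs => rw [← sum_homogeneousComponent P]
      rw [map_sum, map_sum]
    rw [hfsum]
    refine Submodule.sum_mem _ fun D hD => ?_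
    rw [Finset.mem_range] at hD
    refine hmem D (by omega) _ (mem_solidSpan ?_
      ((homogeneousComponent_isHomogeneous D P).rename_isHomogeneous))
    rw [mem_supported, h2]
    intro i hi
    classical
    have := vars_rename Fin.val _ hi
    rw [Finset.mem_image] at this
    obtain ⟨j, -, rfl⟩ := this
    exact j.2

/-! ### Rotations -/

section rotations

variable {d : ℕ}

theorem sphereCoord_rotate (g : SO d) (x : Sphere d) (i : Fin d) :
    sphereCoord (rotate g x) i = ∑ j, (g : Matrix (Fin d) (Fin d) ℝ) i j * sphereCoord x j := rfl

theorem sphere_ext {x y : Sphere d} (h : ∀ i, sphereCoord x i = sphereCoord y i) : x = y := by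
  apply Subtype.ext
  ext i
  exact h i

theorem rotate_mul (g h : SO d) (x : Sphere d) : rotate (g * h) x = rotate g (rotate h x) := by
  refine sphere_ext fun i => ?_
  change ((g * h : SO d) : Matrix (Fin d) (Fin d) ℝ).mulVec _ i =
    (g : Matrix (Fin d) (Fin d) ℝ).mulVec ((h : Matrix (Fin d) (Fin d) ℝ).mulVec _) i
  rw [Matrix.mulVec_mulVec]
  rfl

theorem rotate_one (x : Sphere d) : rotate 1 x = x := by
  refine sphere_ext fun i => ?_
  change ((1 : SO d) : Matrix (Fin d) (Fin d) ℝ).mulVec _ i = _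
  rw [show ((1 : SO d) : Matrix (Fin d) (Fin d) ℝ) = 1 from rfl, Matrix.one_mulVec]
  rfl

theorem rotate_inv_rotate (g : SO d) (x : Sphere d) : rotate g⁻¹ (rotate g x) = x := by
  rw [← rotate_mul, inv_mul_cancel, rotate_one]

theorem rotate_rotate_inv (g : SO d) (x : Sphere d) : rotate g (rotate g⁻¹ x) = x := by
  rw [← rotate_mul, mul_inv_cancel, rotate_one]

theorem continuous_rotate_uncurry : Continuous fun p : SO d × Sphere d => rotate p.1 p.2 := by
  refine Continuous.subtype_mk ?_ _
  refine (PiLp.continuous_toLp 2 _).comp ?_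
  exact Continuous.matrix_mulVec (continuous_subtype_val.comp continuous_fst)
    ((PiLp.continuous_ofLp 2 _).comp (continuous_subtype_val.comp continuous_snd))

theorem continuous_rotate (g : SO d) : Continuous (rotate g) :=
  continuous_rotate_uncurry.comp (Continuous.prodMk_right g)

/-- A rotation as a linear isometry of Euclidean space. -/
def rotateLinear (g : SO d) : EuclideanSpace ℝ (Fin d) ≃ₗᵢ[ℝ] EuclideanSpace ℝ (Fin d) where
  toFun v := WithLp.toLp 2 ((g : Matrix (Fin d) (Fin d) ℝ).mulVec v.ofLp)
  invFun v := WithLp.toLp 2 (((g⁻¹ : SO d) : Matrix (Fin d) (Fin d) ℝ).mulVec v.ofLp)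
  map_add' u v := by simp [Matrix.mulVec_add]
  map_smul' a v := by simp [Matrix.mulVec_smul]
  left_inv v := by
    change WithLp.toLp 2 (((g⁻¹ : SO d) : Matrix (Fin d) (Fin d) ℝ).mulVec
      ((g : Matrix (Fin d) (Fin d) ℝ).mulVec v.ofLp)) = v
    rw [Matrix.mulVec_mulVec, SO.coe_inv, SO.transpose_mul_self, Matrix.one_mulVec]
  right_inv v := by
    change WithLp.toLp 2 ((g : Matrix (Fin d) (Fin d) ℝ).mulVec
      (((g⁻¹ : SO d) : Matrix (Fin d) (Fin d) ℝ).mulVec v.ofLp)) = v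
    rw [Matrix.mulVec_mulVec]
    have h : (g : Matrix (Fin d) (Fin d) ℝ) * ((g⁻¹ : SO d) : Matrix (Fin d) (Fin d) ℝ) = 1 := by
      rw [← Submonoid.coe_mul, mul_inv_cancel]; rfl
    rw [h, Matrix.one_mulVec]
  norm_map' v := by
    have key : ∀ v : EuclideanSpace ℝ (Fin d), ‖v‖ ^ 2 = v.ofLp ⬝ᵥ v.ofLp := fun v => by
      rw [EuclideanSpace.norm_sq_eq]
      simp [dotProduct, sq]
    rw [← sq_eq_sq₀ (norm_nonneg _) (norm_nonneg _), key, key]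
    change (g : Matrix (Fin d) (Fin d) ℝ).mulVec _ ⬝ᵥ
      (g : Matrix (Fin d) (Fin d) ℝ).mulVec _ = _
    rw [Matrix.dotProduct_mulVec, ← Matrix.mulVec_transpose, Matrix.mulVec_mulVec,
      SO.transpose_mul_self, Matrix.one_mulVec]

theorem coe_rotate (g : SO d) (x : Sphere d) :
    (rotate g x : EuclideanSpace ℝ (Fin d)) = rotateLinear g x := rfl

open scoped Pointwise in
theorem measurePreserving_rotate (g : SO d) :
    MeasurePreserving (rotate g) (surfaceMeasure d) (surfaceMeasure d) := by
  have hmeas : Measurable (rotate g) := (continuous_rotate g).measurable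
  refine ⟨hmeas, ?_⟩
  rw [surfaceMeasure, Measure.map_smul]
  congr 1
  ext s hs
  rw [Measure.map_apply hmeas hs, Measure.toSphere_apply' _ (hmeas hs), Measure.toSphere_apply' _ hs]
  congr 1
  have hset : Ioo (0 : ℝ) 1 • (Subtype.val '' (rotate g ⁻¹' s) : Set (EuclideanSpace ℝ (Fin d))) =
      rotateLinear g ⁻¹' (Ioo (0 : ℝ) 1 • (Subtype.val '' s : Set (EuclideanSpace ℝ (Fin d)))) := by
    ext v
    simp only [Set.mem_smul, mem_preimage, mem_image]
    constructor
    · rintro ⟨r, hr, _, ⟨x, hx, rfl⟩, rfl⟩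
      exact ⟨r, hr, _, ⟨rotate g x, hx, rfl⟩, by rw [coe_rotate, map_smul]⟩
    · rintro ⟨r, hr, _, ⟨x, hx, rfl⟩, h⟩
      refine ⟨r, hr, _, ⟨rotate g⁻¹ x, ?_, rfl⟩, ?_⟩
      · rwa [rotate_rotate_inv]
      · apply (rotateLinear g).injective
        rw [map_smul, ← coe_rotate, rotate_rotate_inv, h]
  rw [hset]
  exact (rotateLinear g).measurePreserving.measure_preimage_equiv
    (f := (rotateLinear g).toMeasurableEquiv) _

theorem integral_comp_rotate (g : SO d) {E : Type*} [NormedAddCommGroup E] [NormedSpace ℝ E]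
    (f : Sphere d → E) :
    ∫ x, f (rotate g x) ∂(surfaceMeasure d) = ∫ x, f x ∂(surfaceMeasure d) := by
  refine (measurePreserving_rotate g).integral_comp ?_ f
  let e : Sphere d ≃ₜ Sphere d :=
    { toFun := rotate g
      invFun := rotate g⁻¹
      left_inv := rotate_inv_rotate g
      right_inv := rotate_rotate_inv g
      continuous_toFun := continuous_rotate g
      continuous_invFun := continuous_rotate g⁻¹ }
  exact e.measurableEmbedding

/-- The matrix entries of a rotation. -/
def entries (g : SO d) (p : Fin d × Fin d) : ℝ := (g : Matrix (Fin d) (Fin d) ℝ) p.1 p.2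

/-- The north pole `e^d` as a point of the sphere. -/
def pole (d : ℕ) (hd : 3 ≤ d) : Sphere d :=
  ⟨WithLp.toLp 2 (lastBasis d), by
    rw [mem_sphere_zero_iff_norm, EuclideanSpace.norm_eq, Finset.sum_eq_single ⟨d - 1, by omega⟩]
    · simp [lastBasis, show d - 1 + 1 = d by omega]
    · intro i _ hi
      have : (i : ℕ) + 1 ≠ d := fun h => hi (Fin.ext (by simp; omega))
      simp [lastBasis, this]
    · simp⟩

theorem rotate_pole_of_mem (hd : 3 ≤ d) (h : SOsub d) : rotate (h : SO d) (pole d hd) = pole d hd := by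
  apply Subtype.ext
  have := h.2
  change WithLp.toLp 2 (((h : SO d) : Matrix (Fin d) (Fin d) ℝ).mulVec (lastBasis d)) = _
  rw [show ((h : SO d) : Matrix (Fin d) (Fin d) ℝ).mulVec (lastBasis d) = lastBasis d from h.2]
  rfl

theorem mem_SOsub_iff (hd : 3 ≤ d) (g : SO d) :
    g ∈ SOsub d ↔ rotate g (pole d hd) = pole d hd := by
  constructor
  · intro h
    exact rotate_pole_of_mem hd ⟨g, h⟩
  · intro h
    exact congrArg (fun x : Sphere d => (x : EuclideanSpace ℝ (Fin d)).ofLp) h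

end rotations

/-! ### Products of two reflections -/

section reflections

variable {d : ℕ}

/-- The reflection in the hyperplane orthogonal to `w` (the identity for `w = 0`). -/
def reflMatrix (w : Fin d → ℝ) : Matrix (Fin d) (Fin d) ℝ :=
  1 - (2 / (w ⬝ᵥ w)) • Matrix.vecMulVec w w

theorem reflMatrix_mulVec (w v : Fin d → ℝ) :
    (reflMatrix w).mulVec v = v - (2 * (w ⬝ᵥ v) / (w ⬝ᵥ w)) • w := by
  rw [reflMatrix, Matrix.sub_mulVec, Matrix.one_mulVec, Matrix.smul_mulVec,
    Matrix.vecMulVec_mulVec]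
  ext i
  simp
  ring

theorem transpose_reflMatrix (w : Fin d → ℝ) : (reflMatrix w).transpose = reflMatrix w := by
  rw [reflMatrix, Matrix.transpose_sub, Matrix.transpose_one, Matrix.transpose_smul,
    Matrix.transpose_vecMulVec]

theorem reflMatrix_mul_self {w : Fin d → ℝ} (hw : w ⬝ᵥ w ≠ 0) :
    reflMatrix w * reflMatrix w = 1 := by
  apply Matrix.toLin'.injective
  refine LinearMap.ext fun v => ?_
  rw [Matrix.toLin'_mul, Matrix.toLin'_one, LinearMap.comp_apply, Matrix.toLin'_apply,
    Matrix.toLin'_apply, reflMatrix_mulVec, reflMatrix_mulVec]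
  ext i
  simp only [dotProduct_sub, dotProduct_smul, Pi.sub_apply, Pi.smul_apply, smul_eq_mul,
    LinearMap.id_apply]
  field_simp
  ring

theorem det_reflMatrix {w : Fin d → ℝ} (hw : w ⬝ᵥ w ≠ 0) : (reflMatrix w).det = -1 := by
  have h : reflMatrix w = 1 - Matrix.replicateCol Unit ((2 / (w ⬝ᵥ w)) • w) *
      Matrix.replicateRow Unit w := by
    ext i j
    simp [reflMatrix, Matrix.mul_apply, Matrix.vecMulVec_apply]
  rw [h, Matrix.det_one_sub_mul_comm, Matrix.det_unique]
  simp only [Matrix.sub_apply, Matrix.one_apply_eq, Matrix.mul_apply, Matrix.replicateRow_apply,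
    Matrix.replicateCol_apply, Pi.smul_apply, smul_eq_mul]
  have h2 : ∑ i, w i * (2 / (w ⬝ᵥ w) * w i) = 2 / (w ⬝ᵥ w) * (w ⬝ᵥ w) := by
    rw [dotProduct, Finset.mul_sum]
    exact Finset.sum_congr rfl fun i _ => by ring
  rw [h2, div_mul_cancel₀ _ hw]
  norm_num

/-- The product of two reflections is a rotation. -/
def reflProd (u w : Fin d → ℝ) (hu : u ⬝ᵥ u ≠ 0) (hw : w ⬝ᵥ w ≠ 0) : SO d :=
  ⟨reflMatrix u * reflMatrix w, by
    rw [Matrix.mem_specialOrthogonalGroup_iff, Matrix.mem_orthogonalGroup_iff']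
    constructor
    · change (reflMatrix u * reflMatrix w).transpose * _ = 1
      rw [Matrix.transpose_mul, transpose_reflMatrix, transpose_reflMatrix, Matrix.mul_assoc,
        ← Matrix.mul_assoc (reflMatrix u), reflMatrix_mul_self hu, Matrix.one_mul,
        reflMatrix_mul_self hw]
    · rw [Matrix.det_mul, det_reflMatrix hu, det_reflMatrix hw]
      norm_num⟩

theorem coe_reflProd (u w : Fin d → ℝ) (hu : u ⬝ᵥ u ≠ 0) (hw : w ⬝ᵥ w ≠ 0) :
    (reflProd u w hu hw : Matrix (Fin d) (Fin d) ℝ) = reflMatrix u * reflMatrix w := rfl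

theorem dotProduct_sphereCoord_self (x : Sphere d) : sphereCoord x ⬝ᵥ sphereCoord x = 1 := by
  have h := norm_eq_of_mem_sphere x
  have h2 := EuclideanSpace.norm_sq_eq (x : EuclideanSpace ℝ (Fin d))
  rw [h] at h2
  simpa [dotProduct, sphereCoord, sq] using h2.symm

/-- In dimension `d ≥ 3` two vectors do not span. -/
theorem exists_orthogonal_ne_zero (hd : 3 ≤ d) (y e : Fin d → ℝ) :
    ∃ u : Fin d → ℝ, u ⬝ᵥ u ≠ 0 ∧ u ⬝ᵥ y = 0 ∧ u ⬝ᵥ e = 0 := by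
  let L : (Fin d → ℝ) →ₗ[ℝ] (Fin 2 → ℝ) := Matrix.mulVecLin (Matrix.of ![y, e])
  have hL : LinearMap.ker L ≠ ⊥ := by
    apply LinearMap.ker_ne_bot_of_finrank_lt
    simp
    omega
  obtain ⟨u, hu, hu0⟩ := Submodule.exists_mem_ne_zero_of_ne_bot hL
  refine ⟨u, fun h => hu0 (dotProduct_self_eq_zero.mp h), ?_, ?_⟩
  · have := congrFun (LinearMap.mem_ker.mp hu) 0
    rw [dotProduct_comm]
    simpa [L, Matrix.mulVec] using this
  · have := congrFun (LinearMap.mem_ker.mp hu) 1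
    rw [dotProduct_comm]
    simpa [L, Matrix.mulVec] using this

/-- Rotations fixing a vector `e` act transitively on the points of the sphere at the same height
over `e`: reflect `x` to `y`, then correct the orientation by a reflection fixing `y` and `e`. -/
theorem exists_rotate_eq_of_dotProduct_eq (hd : 3 ≤ d) {x y : Sphere d} {e : Fin d → ℝ}
    (h : sphereCoord x ⬝ᵥ e = sphereCoord y ⬝ᵥ e) :
    ∃ g : SO d, rotate g x = y ∧ (g : Matrix (Fin d) (Fin d) ℝ).mulVec e = e := by
  by_cases hxy : x = y
  · exact ⟨1, by rw [rotate_one, hxy], by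
      rw [show ((1 : SO d) : Matrix (Fin d) (Fin d) ℝ) = 1 from rfl, Matrix.one_mulVec]⟩
  set a := sphereCoord x with ha
  set b := sphereCoord y with hb
  have haa : a ⬝ᵥ a = 1 := dotProduct_sphereCoord_self x
  have hbb : b ⬝ᵥ b = 1 := dotProduct_sphereCoord_self y
  have hw : (a - b) ⬝ᵥ (a - b) ≠ 0 := by
    intro h0
    refine hxy (sphere_ext fun i => ?_)
    exact sub_eq_zero.mp (congrFun (dotProduct_self_eq_zero.mp h0) i)
  obtain ⟨u, hu, huy, hue⟩ := exists_orthogonal_ne_zero hd b e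
  refine ⟨reflProd u (a - b) hu hw, sphere_ext fun i => ?_, ?_⟩
  · change ((reflProd u (a - b) hu hw : SO d) : Matrix (Fin d) (Fin d) ℝ).mulVec a i = b i
    have h1 : (reflMatrix (a - b)).mulVec a = b := by
      rw [reflMatrix_mulVec]
      have h2 : 2 * ((a - b) ⬝ᵥ a) = (a - b) ⬝ᵥ (a - b) := by
        simp only [sub_dotProduct, dotProduct_sub, haa, hbb, dotProduct_comm b a]
        ring
      rw [h2, div_self hw, one_smul, sub_sub_cancel]
    rw [coe_reflProd, ← Matrix.mulVec_mulVec, h1, reflMatrix_mulVec, huy]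
    simp
  · rw [coe_reflProd, ← Matrix.mulVec_mulVec, reflMatrix_mulVec (a - b), sub_dotProduct, h, sub_self]
    simp [reflMatrix_mulVec, hue]

theorem exists_rotate_eq (hd : 3 ≤ d) (x y : Sphere d) : ∃ g : SO d, rotate g x = y := by
  obtain ⟨g, hg, -⟩ := exists_rotate_eq_of_dotProduct_eq (e := 0) hd (x := x) (y := y) (by simp)
  exact ⟨g, hg⟩

/-- The last coordinate of a point of the sphere. -/
def height (hd : 3 ≤ d) (x : Sphere d) : ℝ := sphereCoord x ⟨d - 1, by omega⟩

theorem lastBasis_eq_single (hd : 3 ≤ d) :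
    lastBasis d = Pi.single (⟨d - 1, by omega⟩ : Fin d) (1 : ℝ) := by
  funext i
  rw [lastBasis, Pi.single_apply]
  refine if_congr ?_ rfl rfl
  rw [Fin.ext_iff]
  simp only
  omega

theorem sphereCoord_dotProduct_lastBasis (hd : 3 ≤ d) (x : Sphere d) :
    sphereCoord x ⬝ᵥ lastBasis d = height hd x := by
  rw [lastBasis_eq_single hd, dotProduct_single, mul_one]
  rfl

/-- `SO(d-1)` acts transitively on the points of the same height. -/
theorem exists_SOsub_rotate_eq (hd : 3 ≤ d) {x y : Sphere d} (h : height hd x = height hd y) :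
    ∃ g : SOsub d, rotate (g : SO d) x = y := by
  rw [← sphereCoord_dotProduct_lastBasis, ← sphereCoord_dotProduct_lastBasis] at h
  obtain ⟨g, hg, hge⟩ := exists_rotate_eq_of_dotProduct_eq hd h
  exact ⟨⟨g, hge⟩, hg⟩

theorem height_rotate (hd : 3 ≤ d) (h : SOsub d) (x : Sphere d) :
    height hd (rotate (h : SO d) x) = height hd x := by
  rw [← sphereCoord_dotProduct_lastBasis, ← sphereCoord_dotProduct_lastBasis]
  change ((h : SO d) : Matrix (Fin d) (Fin d) ℝ).mulVec (sphereCoord x) ⬝ᵥ lastBasis d = _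
  conv_lhs => rw [← show ((h : SO d) : Matrix (Fin d) (Fin d) ℝ).mulVec (lastBasis d) =
    lastBasis d from h.2]
  rw [Matrix.dotProduct_mulVec, ← Matrix.mulVec_transpose, Matrix.mulVec_mulVec,
    SO.transpose_mul_self, Matrix.one_mulVec]

/-! ### The meridian through the pole -/

/-- The vector `(0, …, 0, sin t, cos t)`. -/
def meridianVec (hd : 3 ≤ d) (t : ℝ) : Fin d → ℝ :=
  Real.sin t • Pi.single ⟨d - 2, by omega⟩ 1 + Real.cos t • Pi.single ⟨d - 1, by omega⟩ 1

theorem meridianVec_dotProduct_self (hd : 3 ≤ d) (t : ℝ) :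
    meridianVec hd t ⬝ᵥ meridianVec hd t = 1 := by
  have h1 : (⟨d - 2, by omega⟩ : Fin d) ≠ ⟨d - 1, by omega⟩ := by
    simp only [ne_eq, Fin.mk.injEq]; omega
  simp only [meridianVec, add_dotProduct, dotProduct_add, smul_dotProduct, dotProduct_smul,
    single_dotProduct, smul_eq_mul, Pi.single_apply, h1, h1.symm, if_true, if_false]
  linear_combination Real.sin_sq_add_cos_sq t

/-- The rotation by the angle `t` in the plane of the last two coordinates, as a product of
reflections in two vectors at the angle `t / 2`. -/
def meridianRotation (hd : 3 ≤ d) (t : ℝ) : SO d :=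
  reflProd (meridianVec hd (t / 2)) (meridianVec hd 0)
    (by rw [meridianVec_dotProduct_self]; exact one_ne_zero)
    (by rw [meridianVec_dotProduct_self]; exact one_ne_zero)

theorem meridianVec_zero (hd : 3 ≤ d) :
    meridianVec hd 0 = Pi.single (⟨d - 1, by omega⟩ : Fin d) 1 := by
  simp [meridianVec]

theorem height_meridianRotation (hd : 3 ≤ d) (t : ℝ) :
    height hd (rotate (meridianRotation hd t) (pole d hd)) = Real.cos t := by
  have h1 : (⟨d - 2, by omega⟩ : Fin d) ≠ ⟨d - 1, by omega⟩ := by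
    simp only [ne_eq, Fin.mk.injEq]; omega
  change ((meridianRotation hd t : SO d) : Matrix (Fin d) (Fin d) ℝ).mulVec (lastBasis d)
    ⟨d - 1, by omega⟩ = _
  rw [meridianRotation, coe_reflProd, ← Matrix.mulVec_mulVec, lastBasis_eq_single hd,
    meridianVec_zero, reflMatrix_mulVec, reflMatrix_mulVec, meridianVec_dotProduct_self]
  simp only [Pi.single_eq_same, dotProduct_sub, dotProduct_smul,
    dotProduct_single, meridianVec, Pi.sub_apply, Pi.add_apply, Pi.smul_apply, smul_eq_mul,
    Pi.single_apply, h1.symm, if_false]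
  have h2 := Real.cos_sq (t / 2)
  rw [mul_div_cancel₀ _ two_ne_zero] at h2
  linear_combination 2 * h2

/-- Cosine and sine as coordinates on the line. -/
def circleCoord (t : ℝ) : Fin 2 → ℝ := ![Real.cos t, Real.sin t]

theorem cos_mem_polyFun : (fun t : ℝ => (Real.cos t : ℂ)) ∈ polyFun circleCoord 1 :=
  coord_mem_polyFun (v := circleCoord) 0

theorem sin_mem_polyFun : (fun t : ℝ => (Real.sin t : ℂ)) ∈ polyFun circleCoord 1 :=
  coord_mem_polyFun (v := circleCoord) 1

/-- The matrix entries of `meridianRotation hd t` are affine functions of `cos t` and `sin t`. -/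
theorem entries_meridianRotation_mem (hd : 3 ≤ d) (p : Fin d × Fin d) :
    (fun t => (entries (meridianRotation hd t) p : ℂ)) ∈ polyFun circleCoord 1 := by
  obtain ⟨i, j⟩ := p
  have h1 : (⟨d - 2, by omega⟩ : Fin d) ≠ ⟨d - 1, by omega⟩ := by
    simp only [ne_eq, Fin.mk.injEq]; omega
  set A : Fin d → ℝ := Pi.single ⟨d - 2, by omega⟩ 1 with hA
  set B : Fin d → ℝ := Pi.single ⟨d - 1, by omega⟩ 1 with hB
  have hBj : (reflMatrix (meridianVec hd 0)).mulVec (Pi.single j 1) = Pi.single j 1 - (2 * B j) • B := by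
    rw [reflMatrix_mulVec, meridianVec_dotProduct_self, meridianVec_zero]
    simp [hB, Pi.single_apply]
  have hAB : A ⬝ᵥ B = 0 := by simp [hA, hB, h1.symm]
  have hBB : B ⬝ᵥ B = 1 := by simp [hB]
  have key : ∀ t, entries (meridianRotation hd t) (i, j) =
      ((Pi.single j 1 : Fin d → ℝ) i - 2 * B j * B i - A j * A i + B j * B i) +
        Real.cos t * (A j * A i + B j * B i) + Real.sin t * (B j * A i - A j * B i) := by
    intro t
    have h2 : entries (meridianRotation hd t) (i, j) =
        ((meridianRotation hd t : SO d) : Matrix (Fin d) (Fin d) ℝ).mulVec (Pi.single j 1) i := by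
      rw [Matrix.mulVec_single_one]
      rfl
    have hcos := Real.cos_sq (t / 2)
    have hsin := Real.sin_sq_add_cos_sq (t / 2)
    have hdbl := Real.sin_two_mul (t / 2)
    rw [mul_div_cancel₀ _ two_ne_zero] at hcos hdbl
    rw [h2, meridianRotation, coe_reflProd, ← Matrix.mulVec_mulVec, hBj, reflMatrix_mulVec,
      meridianVec_dotProduct_self]
    have h3 : meridianVec hd (t / 2) = Real.sin (t / 2) • A + Real.cos (t / 2) • B := rfl
    rw [h3, dotProduct_sub, dotProduct_single, dotProduct_smul, add_dotProduct, smul_dotProduct,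
      smul_dotProduct, hAB, hBB]
    simp only [Pi.sub_apply, Pi.add_apply, Pi.smul_apply, smul_eq_mul]
    linear_combination (2 * (A j * A i + B j * B i)) * hcos - (2 * A j * A i) * hsin -
      (B j * A i - A j * B i) * hdbl
  have h4 := Submodule.add_mem _ (Submodule.add_mem _ (const_mem_polyFun (v := circleCoord)
    (((Pi.single j 1 : Fin d → ℝ) i - 2 * B j * B i - A j * A i + B j * B i : ℝ) : ℂ) 1)
    (Submodule.smul_mem _ ((A j * A i + B j * B i : ℝ) : ℂ) cos_mem_polyFun))
    (Submodule.smul_mem _ ((B j * A i - A j * B i : ℝ) : ℂ) sin_mem_polyFun)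
  convert h4 using 1
  funext t
  rw [key]
  simp only [Pi.add_apply, Pi.smul_apply, smul_eq_mul]
  push_cast
  ring

/-! ### Zonal functions -/

/-- An even trigonometric polynomial of degree `N` is a polynomial of degree `N` in the cosine. -/
theorem exists_eval_cos_of_mem_polyFun {N : ℕ} {f : ℝ → ℂ} (hf : f ∈ polyFun circleCoord N)
    (heven : ∀ t, f (-t) = f t) :
    ∃ p : Polynomial ℂ, p.natDegree ≤ N ∧ ∀ t, f t = p.eval (Real.cos t : ℂ) := by
  obtain ⟨P, hP, hfP⟩ := hf
  let T : (Fin 2 →₀ ℕ) → Polynomial ℂ := fun α =>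
    if Even (α 1) then Polynomial.C (coeff α P) * (Polynomial.X ^ α 0 *
      (1 - Polynomial.X ^ 2) ^ (α 1 / 2)) else 0
  refine ⟨∑ α ∈ P.support, T α, ?_, fun t => ?_⟩
  · refine Polynomial.natDegree_sum_le_of_forall_le _ _ fun α hα => ?_
    have h1 : α 0 + α 1 ≤ N := by
      have h2 := (le_totalDegree hα).trans hP
      rw [Finsupp.sum_fintype _ _ fun _ => rfl] at h2
      simpa [Fin.sum_univ_two] using h2
    simp only [T]
    split_ifs with h
    · refine (Polynomial.natDegree_C_mul_le _ _).trans ?_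
      refine Polynomial.natDegree_mul_le.trans ?_
      have h3 : ((1 - Polynomial.X ^ 2 : Polynomial ℂ) ^ (α 1 / 2)).natDegree ≤ α 1 / 2 * 2 := by
        refine Polynomial.natDegree_pow_le_of_le _ ?_
        compute_degree
      have h4 : (Polynomial.X ^ α 0 : Polynomial ℂ).natDegree ≤ α 0 := Polynomial.natDegree_X_pow_le _
      omega
    · simp
  · have h1 : f t = (f t + f (-t)) / 2 := by rw [heven]; ring
    rw [h1, hfP, hfP, eval_eq, eval_eq, ← Finset.sum_add_distrib, Finset.sum_div,
      Polynomial.eval_finsetSum]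
    refine Finset.sum_congr rfl fun α _ => ?_
    have h2 : ∀ s, ∏ i ∈ α.support, (circleCoord s i : ℂ) ^ α i =
        (Real.cos s : ℂ) ^ α 0 * (Real.sin s : ℂ) ^ α 1 := by
      intro s
      rw [Finset.prod_subset (Finset.subset_univ _) fun i _ hi => by
        rw [Finsupp.notMem_support_iff.mp hi, pow_zero]]
      simp [Fin.prod_univ_two, circleCoord]
    rw [h2, h2, Real.cos_neg, Real.sin_neg]
    simp only [T]
    split_ifs with h
    · obtain ⟨r, hr⟩ := h
      have h3 : α 1 / 2 = r := by omega
      have h4 : (1 - (Real.cos t : ℂ) ^ 2) = (Real.sin t : ℂ) ^ 2 := by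
        have := Real.sin_sq_add_cos_sq t
        have h5 : ((Real.sin t ^ 2 + Real.cos t ^ 2 : ℝ) : ℂ) = 1 := by rw [this]; simp
        push_cast at h5 ⊢
        linear_combination -h5
      simp only [Polynomial.eval_mul, Polynomial.eval_C, Polynomial.eval_pow, Polynomial.eval_X,
        Polynomial.eval_sub, Polynomial.eval_one]
      rw [h3, h4, hr, Complex.ofReal_neg, (Even.neg_pow ⟨r, rfl⟩), ← pow_mul, two_mul]
      ring
    · rw [Nat.not_even_iff_odd] at h
      rw [Complex.ofReal_neg, h.neg_pow]
      simp

/-- A function that depends only on the height, and whose restriction to a meridian is a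
trigonometric polynomial of degree `N`, is a polynomial of degree `N` in the height. -/
theorem exists_eval_height (hd : 3 ≤ d) {N : ℕ} {u : Sphere d → ℂ}
    (hu : ∀ x y, height hd x = height hd y → u x = u y)
    (hmer : (fun t => u (rotate (meridianRotation hd t) (pole d hd))) ∈ polyFun circleCoord N) :
    ∃ p : Polynomial ℂ, p.natDegree ≤ N ∧ ∀ x, u x = p.eval (height hd x : ℂ) := by
  obtain ⟨p, hp, h⟩ := exists_eval_cos_of_mem_polyFun hmer fun t => hu _ _ (by
    rw [height_meridianRotation, height_meridianRotation, Real.cos_neg])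
  refine ⟨p, hp, fun x => ?_⟩
  have hx : |height hd x| ≤ 1 := by
    rw [abs_le_one_iff_mul_self_le_one, ← dotProduct_sphereCoord_self x]
    exact Finset.single_le_sum (f := fun i => sphereCoord x i * sphereCoord x i)
      (fun i _ => mul_self_nonneg _) (Finset.mem_univ _)
  have hcos := Real.cos_arccos (abs_le.mp hx).1 (abs_le.mp hx).2
  have h1 := h (Real.arccos (height hd x))
  rw [hcos] at h1
  rw [← h1]
  exact hu _ _ (by rw [height_meridianRotation, hcos])

theorem eval_height_mem_polyFun (hd : 3 ≤ d) {N : ℕ} {p : Polynomial ℂ} (hp : p.natDegree ≤ N) :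
    (fun x : Sphere d => p.eval (height hd x : ℂ)) ∈ polyFun (sphereCoord (d := d)) N := by
  have : (fun x : Sphere d => p.eval (height hd x : ℂ)) =
      ∑ i ∈ Finset.range (p.natDegree + 1), p.coeff i • fun x => (height hd x : ℂ) ^ i := by
    funext x
    rw [Polynomial.eval_eq_sum_range, Finset.sum_apply]
    rfl
  rw [this]
  refine Submodule.sum_mem _ fun i hi => Submodule.smul_mem _ _ ?_
  have h := pow_mem_polyFun (coord_mem_polyFun (v := sphereCoord (d := d)) ⟨d - 1, by omega⟩) i
  rw [Finset.mem_range] at hi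
  exact polyFun_mono (by omega) h

end reflections

/-! ### Completeness of the spherical harmonics -/

section completeness

variable {d : ℕ}

theorem continuous_of_mem_sphericalPoly (hd : 3 ≤ d) {N : ℕ} {f : Sphere d → ℂ}
    (hf : f ∈ sphericalPoly d N) : Continuous f := by
  rw [sphericalPoly_eq_polyFun hd] at hf
  exact continuous_of_mem_polyFun continuous_sphereCoord hf

theorem Y_mem_sphericalPoly {n N : ℕ} (hn : n ≤ N) {k : Fin (d - 2) → ℤ} (hk : k ∈ indexSet d n) :
    Y d n k ∈ sphericalPoly d N :=
  Submodule.subset_span ⟨n, hn, k, hk, rfl⟩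

theorem continuous_Y (hd : 3 ≤ d) {n : ℕ} {k : Fin (d - 2) → ℤ} (hk : k ∈ indexSet d n) :
    Continuous (Y d n k) :=
  continuous_of_mem_sphericalPoly hd (Y_mem_sphericalPoly le_rfl hk)

/-- The spherical harmonics as continuous functions, indexed by degree and order. -/
def harmonicMap (hd : 3 ≤ d) (i : Σ n : ℕ, {k // k ∈ indexSet d n}) : C(Sphere d, ℂ) :=
  ⟨Y d i.1 i.2, continuous_Y hd i.2.2⟩

/-- The star algebra of all polynomial functions on the sphere. -/
def polynomialAlgebra (d : ℕ) : StarSubalgebra ℂ C(Sphere d, ℂ) where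
  carrier := {f | ∃ N, ⇑f ∈ polyFun (sphereCoord (d := d)) N}
  mul_mem' := by
    rintro f g ⟨M, hf⟩ ⟨N, hg⟩
    exact ⟨M + N, mul_mem_polyFun hf hg⟩
  add_mem' := by
    rintro f g ⟨M, hf⟩ ⟨N, hg⟩
    exact ⟨max M N, Submodule.add_mem _ (polyFun_mono (le_max_left _ _) hf)
      (polyFun_mono (le_max_right _ _) hg)⟩
  algebraMap_mem' a := ⟨0, const_mem_polyFun a 0⟩
  star_mem' := by
    rintro f ⟨N, hf⟩
    exact ⟨N, conj_mem_polyFun hf⟩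

theorem polynomialAlgebra_separatesPoints : (polynomialAlgebra d).SeparatesPoints := by
  intro x y hxy
  have h : ∃ i, sphereCoord x i ≠ sphereCoord y i := by
    by_contra! h
    exact hxy (sphere_ext h)
  obtain ⟨i, hi⟩ := h
  refine ⟨_, ⟨⟨fun x => (sphereCoord x i : ℂ),
    Complex.continuous_ofReal.comp (continuous_sphereCoord i)⟩, ⟨1, coord_mem_polyFun i⟩, rfl⟩, ?_⟩
  simpa using hi

/-- The spherical harmonics span a dense subspace of the continuous functions, by the
Stone–Weierstrass theorem. -/
theorem span_harmonicMap_closure_eq_top (hd : 3 ≤ d) :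
    (Submodule.span ℂ (range (harmonicMap hd))).topologicalClosure = ⊤ := by
  have h1 : Subalgebra.toSubmodule (polynomialAlgebra d).toSubalgebra ≤
      Submodule.span ℂ (range (harmonicMap hd)) := by
    rintro f ⟨N, hf⟩
    rw [← sphericalPoly_eq_polyFun hd] at hf
    have h2 : (ContinuousMap.coeFnLinearMap ℂ f : Sphere d → ℂ) ∈
        (Submodule.span ℂ (range (harmonicMap hd))).map (ContinuousMap.coeFnLinearMap ℂ) := by
      rw [Submodule.map_span]
      refine Submodule.span_mono ?_ hf
      rintro _ ⟨n, -, k, hk, rfl⟩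
      exact ⟨_, ⟨⟨n, k, hk⟩, rfl⟩, rfl⟩
    obtain ⟨g, hg, hgf⟩ := h2
    rwa [← (DFunLike.coe_injective hgf : g = f)]
  have h2 : (Subalgebra.toSubmodule (polynomialAlgebra d).toSubalgebra).topologicalClosure = ⊤ :=
    congr_arg (Subalgebra.toSubmodule <| StarSubalgebra.toSubalgebra ·)
      (ContinuousMap.starSubalgebra_topologicalClosure_eq_top_of_separatesPoints _
        polynomialAlgebra_separatesPoints)
  rw [eq_top_iff, ← h2]
  exact Submodule.topologicalClosure_mono h1

theorem integrable_mul_conj {f g : Sphere d → ℂ} (hf : Integrable f (surfaceMeasure d))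
    (hg : Continuous g) :
    Integrable (fun x => f x * (starRingEnd ℂ) (g x)) (surfaceMeasure d) := by
  obtain ⟨C, hC⟩ := isCompact_univ.exists_bound_of_continuousOn hg.continuousOn
  refine hf.mul_bdd (c := C) (Complex.continuous_conj.comp hg).aestronglyMeasurable
    (ae_of_all _ fun x => ?_)
  rw [RCLike.norm_conj]
  exact hC x (mem_univ x)

variable [NeZero d]

/-- The spherical harmonics as elements of `L²`. -/
def harmonicLp (hd : 3 ≤ d) (i : Σ n : ℕ, {k // k ∈ indexSet d n}) :
    Lp ℂ 2 (surfaceMeasure d) :=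
  ContinuousMap.toLp 2 (surfaceMeasure d) ℂ (harmonicMap hd i)

theorem orthonormal_harmonicLp (hd : 3 ≤ d) : Orthonormal ℂ (harmonicLp hd) := by
  classical
  rw [orthonormal_iff_ite]
  rintro ⟨n, k, hk⟩ ⟨n', k', hk'⟩
  rw [harmonicLp, harmonicLp, ContinuousMap.inner_toLp]
  change innerL2 d (Y d n' k') (Y d n k) = _
  rw [innerL2_Y hd hk' hk]
  refine if_congr ⟨?_, ?_⟩ rfl rfl
  · rintro ⟨rfl, rfl⟩
    rfl
  · intro h
    cases h
    exact ⟨rfl, rfl⟩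

theorem span_harmonicLp_closure_eq_top (hd : 3 ≤ d) :
    (Submodule.span ℂ (range (harmonicLp hd))).topologicalClosure = ⊤ := by
  convert! (ContinuousMap.toLp_denseRange ℂ (surfaceMeasure d) ℂ
    ENNReal.ofNat_ne_top).topologicalClosure_map_submodule (span_harmonicMap_closure_eq_top hd)
  rw [Submodule.map_span]
  unfold harmonicLp
  rw [range_comp']
  simp only [ContinuousLinearMap.coe_coe]

/-- Parseval's identity for the spherical harmonics. -/
theorem hasSum_norm_innerL2_Y (hd : 3 ≤ d) {f : Sphere d → ℂ} (hf : MemLp f 2 (surfaceMeasure d)) :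
    HasSum (fun n : ℕ => ∑ k ∈ indexSet d n, ‖innerL2 d f (Y d n k)‖ ^ 2)
      (∫ x, ‖f x‖ ^ 2 ∂(surfaceMeasure d)) := by
  set b : HilbertBasis (Σ n : ℕ, {k // k ∈ indexSet d n}) ℂ (Lp ℂ 2 (surfaceMeasure d)) :=
    HilbertBasis.mk (orthonormal_harmonicLp hd) (span_harmonicLp_closure_eq_top hd).ge with hb
  have hbi : ∀ i, b i = harmonicLp hd i := fun i => by rw [hb, HilbertBasis.coe_mk]
  set F : Lp ℂ 2 (surfaceMeasure d) := hf.toLp f with hF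
  have hin : ∀ i, inner ℂ (b i) F = innerL2 d f (Y d i.1 i.2) := by
    intro i
    rw [hbi, L2.inner_def, innerL2]
    refine integral_congr_ae ?_
    filter_upwards [hf.coeFn_toLp, ContinuousMap.coeFn_toLp (p := 2) (𝕜 := ℂ) (surfaceMeasure d)
      (harmonicMap hd i)] with x h1 h2
    rw [hF, h1, harmonicLp, h2, RCLike.inner_apply]
    rfl
  have hself : inner ℂ F F = ((∫ x, ‖f x‖ ^ 2 ∂(surfaceMeasure d) : ℝ) : ℂ) := by
    rw [L2.inner_def, ← integral_complex_ofReal]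
    refine integral_congr_ae ?_
    filter_upwards [hf.coeFn_toLp] with x h1
    rw [hF, h1, inner_self_eq_norm_sq_to_K]
    push_cast
    rfl
  have h1 := b.hasSum_inner_mul_inner F F
  have h2 : HasSum (fun i : Σ n : ℕ, {k // k ∈ indexSet d n} =>
      ‖innerL2 d f (Y d i.1 i.2)‖ ^ 2) (∫ x, ‖f x‖ ^ 2 ∂(surfaceMeasure d)) := by
    rw [← Complex.hasSum_ofReal, ← hself]
    have h3 : ∀ i, inner ℂ F (b i) * inner ℂ (b i) F =
        ((‖innerL2 d f (Y d i.1 i.2)‖ ^ 2 : ℝ) : ℂ) := fun i => by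
      rw [← inner_conj_symm F, hin, Complex.conj_mul', Complex.ofReal_pow]
    simp only [h3] at h1
    exact h1
  have h3 := h2.sigma fun n => hasSum_fintype _
  convert h3 using 1
  funext n
  rw [← Finset.sum_coe_sort]

instance isOpenPosMeasure_surfaceMeasure : (surfaceMeasure d).IsOpenPosMeasure :=
  Measure.isOpenPosMeasure_smul _ (ENNReal.inv_ne_zero.mpr (measure_ne_top _ _))

/-- A continuous function orthogonal to all spherical harmonics vanishes, by Parseval's identity. -/
theorem eq_zero_of_innerL2_Y_eq_zero (hd : 3 ≤ d) {f : Sphere d → ℂ} (hf : Continuous f)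
    (h : ∀ n, ∀ k ∈ indexSet d n, innerL2 d f (Y d n k) = 0) : f = 0 := by
  have hf2 : MemLp f 2 (surfaceMeasure d) :=
    hf.memLp_of_hasCompactSupport (HasCompactSupport.of_compactSpace f)
  have h1 := hasSum_norm_innerL2_Y hd hf2
  have h2 : (fun n : ℕ => ∑ k ∈ indexSet d n, ‖innerL2 d f (Y d n k)‖ ^ 2) = fun _ => 0 := by
    funext n
    exact Finset.sum_eq_zero fun k hk => by rw [h n k hk]; simp
  rw [h2] at h1
  have h3 := h1.unique hasSum_zero
  by_contra hne
  have hx : ∃ x, f x ≠ 0 := by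
    by_contra! h4
    exact hne (funext h4)
  obtain ⟨x, hx⟩ := hx
  have h4 := Continuous.integral_pos_of_hasCompactSupport_nonneg_nonzero (μ := surfaceMeasure d)
    (f := fun x => ‖f x‖ ^ 2) (by fun_prop) (HasCompactSupport.of_compactSpace _)
    (fun x => by positivity) (x := x) (by simpa using hx)
  exact h4.ne' h3

theorem innerL2_sum_Y (hd : 3 ≤ d) (M : ℕ) (a : ℕ → (Fin (d - 2) → ℤ) → ℂ) {m : ℕ}
    {l : Fin (d - 2) → ℤ} (hl : l ∈ indexSet d m) :
    innerL2 d (fun x => ∑ n ∈ Finset.range M, ∑ k ∈ indexSet d n, a n k * Y d n k x) (Y d m l) =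
      if m < M then a m l else 0 := by
  have h1 : ∀ n, ∀ k ∈ indexSet d n, Integrable (fun x => a n k * Y d n k x *
      (starRingEnd ℂ) (Y d m l x)) (surfaceMeasure d) := fun n k hk =>
    integrable_mul_conj (integrable_of_continuous_sphere
      (continuous_const.mul (continuous_Y hd hk))) (continuous_Y hd hl)
  rw [innerL2]
  simp only [Finset.sum_mul]
  rw [integral_finsetSum _ fun n _ => integrable_finsetSum _ fun k hk => h1 n k hk]
  have h2 : ∀ n, ∫ x, ∑ k ∈ indexSet d n, a n k * Y d n k x *
      (starRingEnd ℂ) (Y d m l x) ∂(surfaceMeasure d) = if n = m then a m l else 0 := by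
    intro n
    rw [integral_finsetSum _ fun k hk => h1 n k hk]
    have h3 : ∀ k ∈ indexSet d n, ∫ x, a n k * Y d n k x *
        (starRingEnd ℂ) (Y d m l x) ∂(surfaceMeasure d) = if n = m ∧ k = l then a m l else 0 := by
      intro k hk
      simp only [mul_assoc]
      rw [integral_const_mul]
      change _ * innerL2 d (Y d n k) (Y d m l) = _
      rw [innerL2_Y hd hk hl]
      split_ifs with h4
      · rw [mul_one, h4.1, h4.2]
      · rw [mul_zero]
    rw [Finset.sum_congr rfl h3]
    by_cases hnm : n = m
    · subst hnm
      simp [hl]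
    · simp [hnm]
  simp only [h2]
  simp

/-- A continuous function orthogonal to all harmonics of degree above `N` is the sum of its
expansion up to degree `N`. -/
theorem eq_sum_innerL2_smul_Y (hd : 3 ≤ d) {f : Sphere d → ℂ} (hf : Continuous f) {N : ℕ}
    (h : ∀ n, N < n → ∀ k ∈ indexSet d n, innerL2 d f (Y d n k) = 0) (x : Sphere d) :
    f x = ∑ n ∈ Finset.range (N + 1), ∑ k ∈ indexSet d n, innerL2 d f (Y d n k) * Y d n k x := by
  set p : Sphere d → ℂ := fun x => ∑ n ∈ Finset.range (N + 1), ∑ k ∈ indexSet d n,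
    innerL2 d f (Y d n k) * Y d n k x with hp
  have hpc : Continuous p := continuous_finsetSum _ fun n _ => continuous_finsetSum _ fun k hk =>
    continuous_const.mul (continuous_Y hd hk)
  have hD : f - p = 0 := by
    refine eq_zero_of_innerL2_Y_eq_zero hd (hf.sub hpc) fun m l hl => ?_
    have h1 : innerL2 d (f - p) (Y d m l) = innerL2 d f (Y d m l) - innerL2 d p (Y d m l) := by
      rw [innerL2, innerL2, innerL2, ← integral_sub
        (integrable_mul_conj (integrable_of_continuous_sphere hf) (continuous_Y hd hl))
        (integrable_mul_conj (integrable_of_continuous_sphere hpc) (continuous_Y hd hl))]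
      simp only [Pi.sub_apply, sub_mul]
    rw [h1, hp, innerL2_sum_Y hd _ _ hl]
    split_ifs with h2
    · rw [sub_self]
    · rw [h m (by omega) l hl, sub_zero]
  exact congrFun (sub_eq_zero.mp hD) x

theorem innerL2_Y_eq_zero_of_mem (hd : 3 ≤ d) {N n : ℕ} (hn : N < n) {f : Sphere d → ℂ}
    (hf : f ∈ sphericalPoly d N) {k : Fin (d - 2) → ℤ} (hk : k ∈ indexSet d n) :
    innerL2 d f (Y d n k) = 0 := by
  have : Continuous f ∧ innerL2 d f (Y d n k) = 0 := by
    induction hf using Submodule.span_induction with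
    | mem f hf =>
      obtain ⟨m, hm, l, hl, rfl⟩ := hf
      exact ⟨continuous_Y hd hl, by rw [innerL2_Y hd hl hk, if_neg (by omega)]⟩
    | zero => exact ⟨continuous_zero, by simp [innerL2]⟩
    | add f g _ _ hf hg =>
      refine ⟨hf.1.add hg.1, ?_⟩
      have h1 := integral_add
        (integrable_mul_conj (integrable_of_continuous_sphere hf.1) (continuous_Y hd hk))
        (integrable_mul_conj (integrable_of_continuous_sphere hg.1) (continuous_Y hd hk))
      change _ = innerL2 d f (Y d n k) + innerL2 d g (Y d n k) at h1
      rw [hf.2, hg.2, add_zero] at h1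
      rw [← h1, innerL2]
      simp only [Pi.add_apply, add_mul]
    | smul a f _ hf =>
      refine ⟨hf.1.const_smul a, ?_⟩
      rw [innerL2]
      simp only [Pi.smul_apply, smul_eq_mul, mul_assoc]
      rw [integral_const_mul]
      exact mul_eq_zero_of_right _ hf.2
  exact this.2

theorem eq_sum_of_mem_sphericalPoly (hd : 3 ≤ d) {N : ℕ} {f : Sphere d → ℂ}
    (hf : f ∈ sphericalPoly d N) (x : Sphere d) :
    f x = ∑ n ∈ Finset.range (N + 1), ∑ k ∈ indexSet d n, innerL2 d f (Y d n k) * Y d n k x :=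
  eq_sum_innerL2_smul_Y hd (continuous_of_mem_sphericalPoly hd hf)
    (fun _ hn _ hk => innerL2_Y_eq_zero_of_mem hd hn hf hk) x

end completeness

section kernels

variable {d : ℕ}

/-! ### Rotations of polynomial functions -/

/-- If the entries of `g` are polynomials of degree `M` and the coordinates of `T` are polynomials of
degree `N`, then the coordinates of `g T` are polynomials of degree `M + N`. -/
theorem rotate_coord_mem {S ι : Type*} {v : S → ι → ℝ} {T : S → Sphere d} {g : S → SO d} {M N : ℕ}
    (hg : ∀ p, (fun s => (entries (g s) p : ℂ)) ∈ polyFun v M)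
    (hT : ∀ i, (fun s => (sphereCoord (T s) i : ℂ)) ∈ polyFun v N) (i : Fin d) :
    (fun s => (sphereCoord (rotate (g s) (T s)) i : ℂ)) ∈ polyFun v (M + N) := by
  have h : (fun s => (sphereCoord (rotate (g s) (T s)) i : ℂ)) =
      ∑ j, fun s => (entries (g s) (i, j) : ℂ) * (sphereCoord (T s) j : ℂ) := by
    funext s
    rw [sphereCoord_rotate, Finset.sum_apply]
    push_cast
    rfl
  rw [h]
  exact Submodule.sum_mem _ fun j _ => mul_mem_polyFun (hg (i, j)) (hT j)

theorem rotate_mem_sphericalPoly (hd : 3 ≤ d) {N : ℕ} {f : Sphere d → ℂ}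
    (hf : f ∈ sphericalPoly d N) (g : SO d) : (fun x => f (rotate g x)) ∈ sphericalPoly d N := by
  rw [sphericalPoly_eq_polyFun hd] at hf ⊢
  refine comp_mem_polyFun hf fun i => ?_
  have h := rotate_coord_mem (v := sphereCoord (d := d)) (T := id) (g := fun _ => g)
    (fun p => const_mem_polyFun _ 0) coord_mem_polyFun i
  rwa [zero_add] at h

/-! ### The reproducing kernels -/

/-- The reproducing kernel `∑_k Y_k(x) conj (Y_k(y))` of the harmonics of degree `n`. -/
def harmonicKernel (d n : ℕ) (x y : Sphere d) : ℂ :=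
  ∑ k ∈ indexSet d n, Y d n k x * (starRingEnd ℂ) (Y d n k y)

theorem conj_innerL2 (f g : Sphere d → ℂ) : (starRingEnd ℂ) (innerL2 d f g) = innerL2 d g f := by
  rw [innerL2, innerL2, ← integral_conj]
  simp only [map_mul, Complex.conj_conj, mul_comm]

theorem innerL2_comp_rotate (g : SO d) (f₁ f₂ : Sphere d → ℂ) :
    innerL2 d (fun x => f₁ (rotate g x)) (fun x => f₂ (rotate g x)) = innerL2 d f₁ f₂ :=
  integral_comp_rotate g fun x => f₁ x * (starRingEnd ℂ) (f₂ x)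

theorem integral_mul_sum_kernel {ι : Type*} {s : Finset ι} {a : ι → Sphere d → ℂ}
    (ha : ∀ i ∈ s, Continuous (a i)) {f : Sphere d → ℂ} (hf : Integrable f (surfaceMeasure d))
    (b : ι → ℂ) :
    ∫ y, f y * ∑ i ∈ s, b i * (starRingEnd ℂ) (a i y) ∂(surfaceMeasure d) =
      ∑ i ∈ s, b i * innerL2 d f (a i) := by
  have h1 : ∀ y, f y * ∑ i ∈ s, b i * (starRingEnd ℂ) (a i y) =
      ∑ i ∈ s, b i * (f y * (starRingEnd ℂ) (a i y)) := fun y => by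
    rw [Finset.mul_sum]
    exact Finset.sum_congr rfl fun i _ => by ring
  simp only [h1]
  rw [integral_finsetSum _ fun i hi => (integrable_mul_conj hf (ha i hi)).const_mul _]
  exact Finset.sum_congr rfl fun i _ => integral_const_mul _ _

/-- The sum `∑_i |⟨f, a_i⟩|²` depends only on the kernel `∑_i a_i(x) conj (a_i(y))`. -/
theorem sum_norm_sq_innerL2 {ι : Type*} {s : Finset ι} {a : ι → Sphere d → ℂ}
    (ha : ∀ i ∈ s, Continuous (a i)) {f : Sphere d → ℂ} (hf : Integrable f (surfaceMeasure d)) :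
    ((∑ i ∈ s, ‖innerL2 d f (a i)‖ ^ 2 : ℝ) : ℂ) =
      ∫ x, f x * (starRingEnd ℂ) (∫ y, f y * ∑ i ∈ s, a i x * (starRingEnd ℂ) (a i y)
        ∂(surfaceMeasure d)) ∂(surfaceMeasure d) := by
  have h1 : ∀ x, f x * (starRingEnd ℂ) (∫ y, f y * ∑ i ∈ s, a i x * (starRingEnd ℂ) (a i y)
        ∂(surfaceMeasure d)) =
      f x * ∑ i ∈ s, (starRingEnd ℂ) (innerL2 d f (a i)) * (starRingEnd ℂ) (a i x) := fun x => by
    rw [integral_mul_sum_kernel ha hf, map_sum]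
    congr 1
    exact Finset.sum_congr rfl fun i _ => by rw [map_mul, mul_comm]
  simp only [h1]
  rw [integral_mul_sum_kernel ha hf]
  push_cast
  exact Finset.sum_congr rfl fun i _ => (Complex.conj_mul' _).symm

theorem harmonicKernel_mem (n N : ℕ) (hn : n ≤ N) (y : Sphere d) :
    (fun x => harmonicKernel d n x y) ∈ sphericalPoly d N := by
  have h : (fun x => harmonicKernel d n x y) =
      ∑ k ∈ indexSet d n, (starRingEnd ℂ) (Y d n k y) • Y d n k := by
    funext x
    simp only [harmonicKernel, Finset.sum_apply, Pi.smul_apply, smul_eq_mul, mul_comm]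
  rw [h]
  exact Submodule.sum_mem _ fun k hk => Submodule.smul_mem _ _ (Y_mem_sphericalPoly hn hk)

/-- The kernel `∑_{n ≤ N} harmonicKernel d n` reproduces the spherical polynomials. -/
theorem innerL2_sum_harmonicKernel (hd : 3 ≤ d) {N : ℕ} {p : Sphere d → ℂ}
    (hp : p ∈ sphericalPoly d N) (y : Sphere d) :
    innerL2 d p (fun x => ∑ n ∈ Finset.range (N + 1), harmonicKernel d n x y) = p y := by
  have : NeZero d := ⟨by omega⟩
  have hpc := integrable_of_continuous_sphere (continuous_of_mem_sphericalPoly hd hp)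
  rw [eq_sum_of_mem_sphericalPoly hd hp y, innerL2]
  simp only [map_sum, Finset.mul_sum]
  rw [integral_finsetSum _ fun n hn => integrable_mul_conj hpc
    (continuous_of_mem_sphericalPoly hd (harmonicKernel_mem n n le_rfl y))]
  refine Finset.sum_congr rfl fun n _ => ?_
  have h1 : ∀ x, p x * (starRingEnd ℂ) (harmonicKernel d n x y) =
      p x * ∑ k ∈ indexSet d n, Y d n k y * (starRingEnd ℂ) (Y d n k x) := fun x => by
    rw [harmonicKernel, map_sum]
    congr 1
    exact Finset.sum_congr rfl fun k _ => by rw [map_mul, Complex.conj_conj, mul_comm]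
  simp only [h1]
  rw [integral_mul_sum_kernel (fun k hk => continuous_Y hd hk) hpc]
  exact Finset.sum_congr rfl fun k _ => mul_comm _ _

/-- The reproducing kernel of a rotation invariant space is rotation invariant: both sides reproduce
the same polynomials. -/
theorem sum_harmonicKernel_rotate (hd : 3 ≤ d) (N : ℕ) (g : SO d) (x y : Sphere d) :
    ∑ n ∈ Finset.range (N + 1), harmonicKernel d n (rotate g x) (rotate g y) =
      ∑ n ∈ Finset.range (N + 1), harmonicKernel d n x y := by
  have : NeZero d := ⟨by omega⟩
  have hmem : ∀ z, (fun x => ∑ n ∈ Finset.range (N + 1), harmonicKernel d n x z) ∈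
      sphericalPoly d N := fun z => by
    have := Submodule.sum_mem (sphericalPoly d N) fun n (hn : n ∈ Finset.range (N + 1)) =>
      harmonicKernel_mem n N (by rw [Finset.mem_range] at hn; omega) z
    convert this using 1
    funext x
    rw [Finset.sum_apply]
  have h1 := rotate_mem_sphericalPoly hd (hmem (rotate g y)) g
  have hD := Submodule.sub_mem _ h1 (hmem y)
  have hzero : ∀ m ≤ N, ∀ l ∈ indexSet d m, innerL2 d
      ((fun x => ∑ n ∈ Finset.range (N + 1), harmonicKernel d n (rotate g x) (rotate g y)) -
        fun x => ∑ n ∈ Finset.range (N + 1), harmonicKernel d n x y) (Y d m l) = 0 := by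
    intro m hm l hl
    have hY := Y_mem_sphericalPoly hm hl
    have hYc := integrable_of_continuous_sphere (continuous_of_mem_sphericalPoly hd hY)
    rw [← conj_innerL2, map_eq_zero]
    have h2 : innerL2 d (Y d m l) (fun x => ∑ n ∈ Finset.range (N + 1),
        harmonicKernel d n (rotate g x) (rotate g y)) = Y d m l y := by
      have h3 := innerL2_sum_harmonicKernel hd (rotate_mem_sphericalPoly hd hY g⁻¹) (rotate g y)
      rw [rotate_inv_rotate, ← innerL2_comp_rotate g] at h3
      simpa only [rotate_inv_rotate] using h3
    have h3 := innerL2_sum_harmonicKernel hd hY y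
    rw [innerL2] at h2 h3 ⊢
    simp only [Pi.sub_apply, map_sub, mul_sub]
    rw [integral_sub (integrable_mul_conj hYc (continuous_of_mem_sphericalPoly hd h1))
      (integrable_mul_conj hYc (continuous_of_mem_sphericalPoly hd (hmem y))), h2, h3, sub_self]
  have h2 := eq_sum_of_mem_sphericalPoly hd hD x
  rw [Finset.sum_eq_zero] at h2
  · exact sub_eq_zero.mp h2
  · intro m hm
    rw [Finset.mem_range] at hm
    exact Finset.sum_eq_zero fun l hl => by rw [hzero m (by omega) l hl, zero_mul]

/-- Since `∑_{n ≤ N} harmonicKernel d n` is rotation invariant for every `N`, so are the differences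
of consecutive such sums. -/
theorem harmonicKernel_rotate (hd : 3 ≤ d) (n : ℕ) (g : SO d) (x y : Sphere d) :
    harmonicKernel d n (rotate g x) (rotate g y) = harmonicKernel d n x y := by
  have h := sum_harmonicKernel_rotate hd n g x y
  rcases n with _ | n
  · simpa using h
  · rw [Finset.sum_range_succ, Finset.sum_range_succ _ (n + 1),
      sum_harmonicKernel_rotate hd n g x y] at h
    exact add_left_cancel h

/-- The norm of the projection to the harmonics of degree `n` is rotation invariant. -/
theorem sum_norm_sq_innerL2_Y_rotateFun (hd : 3 ≤ d) (n : ℕ) (g : SO d) {f : Sphere d → ℂ}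
    (hf : Continuous f) :
    ∑ k ∈ indexSet d n, ‖innerL2 d (rotateFun g f) (Y d n k)‖ ^ 2 =
      ∑ k ∈ indexSet d n, ‖innerL2 d f (Y d n k)‖ ^ 2 := by
  have : NeZero d := ⟨by omega⟩
  have hgf : Continuous (rotateFun g f) := hf.comp (continuous_rotate g⁻¹)
  have hker : ∀ x, ∫ y, rotateFun g f y * ∑ k ∈ indexSet d n, Y d n k (rotate g x) *
      (starRingEnd ℂ) (Y d n k y) ∂(surfaceMeasure d) =
      ∫ y, f y * ∑ k ∈ indexSet d n, Y d n k x * (starRingEnd ℂ) (Y d n k y)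
        ∂(surfaceMeasure d) := by
    intro x
    rw [← integral_comp_rotate g]
    refine integral_congr_ae (ae_of_all _ fun y => ?_)
    change f (rotate g⁻¹ (rotate g y)) * harmonicKernel d n (rotate g x) (rotate g y) =
      f y * harmonicKernel d n x y
    rw [rotate_inv_rotate, harmonicKernel_rotate hd]
  apply Complex.ofReal_injective
  rw [sum_norm_sq_innerL2 (fun k hk => continuous_Y hd hk)
    (integrable_of_continuous_sphere hgf), sum_norm_sq_innerL2 (fun k hk => continuous_Y hd hk)
    (integrable_of_continuous_sphere hf), ← integral_comp_rotate g]
  refine integral_congr_ae (ae_of_all _ fun x => ?_)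
  simp only
  rw [hker, rotateFun, rotate_inv_rotate]

/-! ### Zonal harmonics -/

theorem zero_mem_indexSet (d n : ℕ) : (0 : Fin (d - 2) → ℤ) ∈ indexSet d n := by
  rw [mem_indexSet]
  rintro (_ | i) _
  · simp [extIndex]
  · simp [extIndex]

theorem cos_angle_last {N : ℕ} (x : Sphere (N + 3)) :
    Real.cos (angle (x : EuclideanSpace ℝ (Fin (N + 3))) (N + 2)) = height (by omega) x := by
  have h := partialNorm_mul_cos_angle (x : EuclideanSpace ℝ (Fin (N + 3))) N
  rw [partialNorm_self, one_mul] at h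
  rw [h]
  exact coord_eq_sphereCoord x ⟨N + 2, by omega⟩

/-- The zonal harmonic is a Gegenbauer polynomial in the height: the factors of index `j ≥ 1` are
`C_0^λ = 1`. -/
theorem Y_zero_eq (hd : 3 ≤ d) (n : ℕ) (x : Sphere d) :
    Y d n 0 x = ((normConst d n 0 * (gegenbauerPoly n (((d : ℝ) - 2) / 2)).eval (height hd x) : ℝ) : ℂ) := by
  obtain ⟨N, rfl⟩ : ∃ N, d = N + 3 := ⟨d - 3, by omega⟩
  have hext : ∀ i, extIndex n (0 : Fin (N + 3 - 2) → ℤ) (i + 1) = 0 := fun i => by simp [extIndex]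
  have hext0 : extIndex n (0 : Fin (N + 3 - 2) → ℤ) 0 = n := rfl
  rw [Y, harmonicAngles, eval_gegenbauerPoly]
  simp only [show N + 3 - 2 = N + 1 from rfl, hext]
  rw [Finset.prod_range_succ']
  have hone : ∀ j ∈ Finset.range N, gegenbauer ((extIndex n (0 : Fin (N + 3 - 2) → ℤ) (j + 1)).natAbs -
      (0 : ℤ).natAbs) ((((N + 3 : ℕ) : ℝ) - ((j + 1 : ℕ) : ℝ) - 2) / 2 + ((0 : ℤ).natAbs : ℝ))
      (Real.cos (angle (x : EuclideanSpace ℝ (Fin (N + 3))) (N + 3 - (j + 1) - 1))) *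
      Real.sin (angle (x : EuclideanSpace ℝ (Fin (N + 3))) (N + 3 - (j + 1) - 1)) ^
        (0 : ℤ).natAbs = 1 := by
    intro j hj
    rw [Finset.mem_range] at hj
    have hj' : (j : ℝ) + 1 ≤ N := by exact_mod_cast hj
    rw [hext, ← eval_gegenbauerPoly, Int.natAbs_zero, Nat.sub_zero, gegenbauerPoly_zero]
    · simp
    · push_cast
      linarith
  rw [Finset.prod_congr rfl hone]
  simp [hext0, cos_angle_last]

theorem extIndex_one_ne_zero {n : ℕ} {k : Fin (d - 2) → ℤ} (hk : k ∈ indexSet d n)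
    (hk0 : k ≠ 0) : extIndex n k 1 ≠ 0 := by
  intro h
  rw [mem_indexSet] at hk
  have h1 : ∀ i, i < d - 2 → extIndex n k (i + 1) = 0 := by
    intro i
    induction i with
    | zero => exact fun _ => h
    | succ i ih =>
      intro hi
      have h2 := hk (i + 1) hi
      rw [ih (by omega)] at h2
      exact abs_nonpos_iff.mp h2
  refine hk0 (funext fun i => ?_)
  have := h1 i i.2
  simpa [extIndex] using this

theorem height_pole (hd : 3 ≤ d) : height hd (pole d hd) = 1 := by
  change lastBasis d _ = 1
  rw [lastBasis_eq_single hd, Pi.single_eq_same]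

/-- Only the zonal harmonics do not vanish at the pole. -/
theorem Y_pole_eq_zero (hd : 3 ≤ d) {n : ℕ} {k : Fin (d - 2) → ℤ} (hk : k ∈ indexSet d n)
    (hk0 : k ≠ 0) : Y d n k (pole d hd) = 0 := by
  have h1 := extIndex_one_ne_zero hk hk0
  obtain ⟨N, rfl⟩ : ∃ N, d = N + 3 := ⟨d - 3, by omega⟩
  have hsin : Real.sin (angle ((pole (N + 3) hd : Sphere (N + 3)) : EuclideanSpace ℝ (Fin (N + 3))) (N + 2)) = 0 := by
    have h := partialNorm_mul_sin_angle
      ((pole (N + 3) hd : Sphere (N + 3)) : EuclideanSpace ℝ (Fin (N + 3))) N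
    have h2 := partialNorm_succ_sq
      ((pole (N + 3) hd : Sphere (N + 3)) : EuclideanSpace ℝ (Fin (N + 3))) (N + 2)
    have h3 : coord ((pole (N + 3) hd : Sphere (N + 3)) : EuclideanSpace ℝ (Fin (N + 3))) (N + 2) = 1 :=
      (coord_eq_sphereCoord (pole (N + 3) hd) ⟨N + 2, by omega⟩).trans (height_pole hd)
    rw [partialNorm_self, h3] at h2
    rw [partialNorm_self, one_mul] at h
    rw [h]
    nlinarith
  rw [Y, harmonicAngles]
  simp only [show N + 3 - 2 = N + 1 from rfl]
  rw [Finset.prod_range_succ', show N + 3 - 0 - 1 = N + 2 from rfl, hsin,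
    zero_pow (Int.natAbs_ne_zero.mpr h1)]
  simp

theorem harmonicKernel_pole (hd : 3 ≤ d) (n : ℕ) (x : Sphere d) :
    harmonicKernel d n x (pole d hd) =
      (starRingEnd ℂ) (Y d n 0 (pole d hd)) * Y d n 0 x := by
  rw [harmonicKernel, Finset.sum_eq_single_of_mem 0 (zero_mem_indexSet d n), mul_comm]
  intro k hk hk0
  rw [Y_pole_eq_zero hd hk hk0, map_zero, mul_zero]

/-- The diagonal of the reproducing kernel is constant by invariance and equals `|Y_0(e^d)|²`; if it
vanished, so would all harmonics of degree `n`. -/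
theorem Y_zero_pole_ne_zero (hd : 3 ≤ d) (n : ℕ) : Y d n 0 (pole d hd) ≠ 0 := by
  intro h
  have h1 : ∀ x : Sphere d, Y d n 0 x = 0 := by
    intro x
    obtain ⟨g, hg⟩ := exists_rotate_eq hd (pole d hd) x
    have h2 : harmonicKernel d n x x = 0 := by
      rw [← hg, harmonicKernel_rotate hd, harmonicKernel_pole, h, mul_zero]
    have h3 : ∑ k ∈ indexSet d n, ‖Y d n k x‖ ^ 2 = 0 := by
      rw [← Complex.ofReal_eq_zero, ← h2, harmonicKernel]
      push_cast
      exact Finset.sum_congr rfl fun k _ => (Complex.mul_conj' _).symm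
    have h4 := (Finset.sum_eq_zero_iff_of_nonneg fun k _ => sq_nonneg _).mp h3 0
      (zero_mem_indexSet d n)
    simpa using h4
  have h2 := innerL2_Y hd (zero_mem_indexSet d n) (zero_mem_indexSet d n)
  rw [if_pos ⟨rfl, rfl⟩, innerL2] at h2
  simp [h1] at h2

theorem coeff_gegenbauerPoly_self (n : ℕ) (lam : ℝ) :
    (gegenbauerPoly n lam).coeff n = gegenbauerCoeff n lam 0 := by
  rw [gegenbauerPoly, Polynomial.finsetSum_coeff, Finset.sum_eq_single_of_mem 0 (by simp)]
  · simp
  · intro i hi hi0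
    rw [Finset.mem_range] at hi
    rw [Polynomial.coeff_C_mul, Polynomial.coeff_X_pow, if_neg (by omega), mul_zero]

theorem coeff_gegenbauerPoly_of_lt {n m : ℕ} (h : n < m) (lam : ℝ) :
    (gegenbauerPoly n lam).coeff m = 0 := by
  rw [gegenbauerPoly, Polynomial.finsetSum_coeff]
  refine Finset.sum_eq_zero fun i _ => ?_
  rw [Polynomial.coeff_C_mul, Polynomial.coeff_X_pow, if_neg (by omega), mul_zero]

/-- The polynomials in the height are combinations of zonal harmonics. -/
theorem exists_eq_sum_Y_zero (hd : 3 ≤ d) (N : ℕ) {p : Polynomial ℂ} (hp : p.degree < N) :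
    ∃ a : ℕ → ℂ, ∀ x : Sphere d,
      p.eval (height hd x : ℂ) = ∑ n ∈ Finset.range N, a n * Y d n 0 x := by
  induction N generalizing p with
  | zero =>
    have : p = 0 := by
      rw [← Polynomial.degree_eq_bot]
      simpa using hp
    exact ⟨0, fun x => by simp [this]⟩
  | succ N ih =>
    set lam : ℝ := ((d : ℝ) - 2) / 2 with hlam
    have hlam0 : 0 < lam := by
      have : (3 : ℝ) ≤ d := by exact_mod_cast hd
      rw [hlam]
      linarith
    set G : Polynomial ℂ := (gegenbauerPoly N lam).map (algebraMap ℝ ℂ) with hG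
    have hlead : G.coeff N ≠ 0 := by
      rw [hG, Polynomial.coeff_map, coeff_gegenbauerPoly_self]
      exact Complex.ofReal_ne_zero.mpr (gegenbauerCoeff_zero_pos N hlam0).ne'
    have hc := normConst_ne_zero hd (zero_mem_indexSet d N)
    set b : ℂ := p.coeff N / G.coeff N with hb
    obtain ⟨a, ha⟩ := ih (p := p - Polynomial.C b * G) (by
      rw [Polynomial.degree_lt_iff_coeff_zero] at hp ⊢
      intro m hm
      rw [Polynomial.coeff_sub, Polynomial.coeff_C_mul]
      rcases hm.eq_or_lt with rfl | hm
      · rw [hb, div_mul_cancel₀ _ hlead, sub_self]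
      · rw [hp m hm, hG, Polynomial.coeff_map, coeff_gegenbauerPoly_of_lt hm]
        simp)
    refine ⟨Function.update a N (b / normConst d N 0), fun x => ?_⟩
    have h1 := ha x
    have hGx : G.eval (height hd x : ℂ) = ((gegenbauerPoly N lam).eval (height hd x) : ℝ) := by
      rw [hG, Polynomial.eval_map_algebraMap]
      exact Polynomial.aeval_algebraMap_apply_eq_algebraMap_eval _ _
    rw [Finset.sum_range_succ, Function.update_self, Finset.sum_congr rfl fun n hn => by
      rw [Function.update_of_ne (Finset.mem_range.mp hn).ne], ← h1, Y_zero_eq hd]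
    rw [Polynomial.eval_sub, Polynomial.eval_mul, Polynomial.eval_C, hGx]
    rw [Complex.ofReal_mul, ← mul_assoc, div_mul_cancel₀ _ (Complex.ofReal_ne_zero.mpr hc),
      sub_add_cancel]

theorem comp_meridian_mem (hd : 3 ≤ d) {N : ℕ} {f : Sphere d → ℂ} (hf : f ∈ sphericalPoly d N) :
    (fun t => f (rotate (meridianRotation hd t) (pole d hd))) ∈ polyFun circleCoord N := by
  rw [sphericalPoly_eq_polyFun hd] at hf
  exact comp_mem_polyFun hf fun i => rotate_coord_mem (N := 0)
    (entries_meridianRotation_mem hd) (fun _ => const_mem_polyFun _ 0) i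

/-- A rotation invariant kernel that is polynomial of degree `N` in the first variable is a
combination of the reproducing kernels of degree at most `N`. -/
theorem exists_eq_sum_harmonicKernel (hd : 3 ≤ d) {N : ℕ} {E : Sphere d → Sphere d → ℂ}
    (hE : ∀ (g : SO d) x y, E (rotate g x) (rotate g y) = E x y)
    (hpoly : (fun x => E x (pole d hd)) ∈ sphericalPoly d N) :
    ∃ c : ℕ → ℂ, ∀ x y, E x y = ∑ n ∈ Finset.range (N + 1), c n * harmonicKernel d n x y := by
  have hzonal : ∀ x y, height hd x = height hd y → E x (pole d hd) = E y (pole d hd) := by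
    intro x y hxy
    obtain ⟨g, hg⟩ := exists_SOsub_rotate_eq hd hxy
    rw [← hg, ← hE g x, rotate_pole_of_mem]
  obtain ⟨p, hp, hpE⟩ := exists_eval_height hd hzonal (comp_meridian_mem hd hpoly)
  obtain ⟨a, ha⟩ := exists_eq_sum_Y_zero hd (N + 1)
    (p := p) (lt_of_le_of_lt Polynomial.degree_le_natDegree
      (by exact_mod_cast Nat.lt_succ_of_le hp))
  refine ⟨fun n => a n / (starRingEnd ℂ) (Y d n 0 (pole d hd)), fun x y => ?_⟩
  obtain ⟨g, rfl⟩ := exists_rotate_eq hd (pole d hd) y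
  have hx : x = rotate g (rotate g⁻¹ x) := (rotate_rotate_inv g x).symm
  rw [hx, hE, hpE, ha]
  refine Finset.sum_congr rfl fun n _ => ?_
  have h0 : (starRingEnd ℂ) (Y d n 0 (pole d hd)) ≠ 0 :=
    (map_ne_zero _).mpr (Y_zero_pole_ne_zero hd n)
  rw [harmonicKernel_rotate hd, harmonicKernel_pole]
  field_simp

end kernels

/-! ### Averages over the rotations fixing the pole -/

section averages

variable {d : ℕ}

instance isHaarMeasure_haarSOsub (d : ℕ) : (haarSOsub d).IsHaarMeasure :=
  Measure.isHaarMeasure_haarMeasure _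

instance isProbabilityMeasure_haarSOsub (d : ℕ) : IsProbabilityMeasure (haarSOsub d) :=
  ⟨Measure.haarMeasure_self⟩

theorem integrable_of_continuous_SOsub {f : SOsub d → ℂ} (hf : Continuous f) :
    Integrable f (haarSOsub d) :=
  hf.integrable_of_hasCompactSupport (HasCompactSupport.of_compactSpace f)

/-- The pointwise integral of functions from a finite dimensional space stays in that space,
because the coordinates with respect to a basis are combinations of point evaluations. -/
theorem integral_mem_of_forall_mem {H S : Type*} [MeasurableSpace H] {ν : Measure H}
    {W : Submodule ℂ (S → ℂ)} [FiniteDimensional ℂ W] {F : H → S → ℂ} (hF : ∀ h, F h ∈ W)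
    (hint : ∀ s, Integrable (fun h => F h s) ν) : (fun s => ∫ h, F h s ∂ν) ∈ W := by
  let ev : S → Module.Dual ℂ W := fun s => (LinearMap.proj s).comp W.subtype
  have hspan : Submodule.span ℂ (range ev) = ⊤ := by
    have h1 : (Submodule.span ℂ (range ev)).dualCoannihilator = ⊥ := by
      rw [eq_bot_iff]
      intro w hw
      rw [Submodule.mem_dualCoannihilator] at hw
      refine (Submodule.mem_bot ℂ).mpr (Subtype.ext (funext fun s => ?_))
      exact hw (ev s) (Submodule.subset_span ⟨s, rfl⟩)
    rw [← Subspace.dualCoannihilator_dualAnnihilator_eq (W := Submodule.span ℂ (range ev)), h1,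
      Submodule.dualAnnihilator_bot]
  have hdual : ∀ l : Module.Dual ℂ W, Integrable (fun h => l ⟨F h, hF h⟩) ν := by
    intro l
    have hl : l ∈ Submodule.span ℂ (range ev) := hspan ▸ Submodule.mem_top
    induction hl using Submodule.span_induction with
    | mem l hl =>
      obtain ⟨s, rfl⟩ := hl
      exact hint s
    | zero => simp
    | add l l' _ _ hl hl' => exact hl.add hl'
    | smul a l _ hl => exact hl.smul a
  let b := Module.finBasis ℂ W
  have heq : (fun s => ∫ h, F h s ∂ν) =
      ∑ i, (∫ h, b.coord i ⟨F h, hF h⟩ ∂ν) • (b i : S → ℂ) := by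
    funext s
    have h1 : ∀ h, F h s = ∑ i, b.coord i ⟨F h, hF h⟩ * (b i : S → ℂ) s := by
      intro h
      have h2 := congrArg (fun w : W => (w : S → ℂ) s) (b.sum_repr ⟨F h, hF h⟩)
      simp only [Submodule.coe_sum, Submodule.coe_smul, Finset.sum_apply, Pi.smul_apply,
        smul_eq_mul] at h2
      exact h2.symm
    simp only [h1]
    rw [integral_finsetSum _ fun i _ => (hdual (b.coord i)).mul_const _, Finset.sum_apply]
    exact Finset.sum_congr rfl fun i _ => integral_mul_const _ _
  rw [heq]
  exact Submodule.sum_mem _ fun i _ => Submodule.smul_mem _ _ (b i).2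

theorem entries_mul_mem {S ι : Type*} {v : S → ι → ℝ} {g g' : S → SO d} {M N : ℕ}
    (hg : ∀ p, (fun s => (entries (g s) p : ℂ)) ∈ polyFun v M)
    (hg' : ∀ p, (fun s => (entries (g' s) p : ℂ)) ∈ polyFun v N) (p : Fin d × Fin d) :
    (fun s => (entries (g s * g' s) p : ℂ)) ∈ polyFun v (M + N) := by
  have h : (fun s => (entries (g s * g' s) p : ℂ)) =
      ∑ j, fun s => (entries (g s) (p.1, j) : ℂ) * (entries (g' s) (j, p.2) : ℂ) := by
    funext s
    rw [Finset.sum_apply]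
    have : entries (g s * g' s) p = ∑ j, entries (g s) (p.1, j) * entries (g' s) (j, p.2) := rfl
    rw [this]
    push_cast
    rfl
  rw [h]
  exact Submodule.sum_mem _ fun j _ => mul_mem_polyFun (hg _) (hg' _)

theorem continuous_entries (p : Fin d × Fin d) : Continuous fun g : SO d => entries g p :=
  (continuous_apply_apply p.1 p.2).comp continuous_subtype_val

/-- The orbit map `g ↦ g e^d` is a quotient map, being a continuous surjection from a compact space
to a Hausdorff space. -/
theorem continuous_of_comp_rotate_pole (hd : 3 ≤ d) {F : Sphere d → ℂ}
    (hF : Continuous fun g : SO d => F (rotate g (pole d hd))) : Continuous F := by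
  have hc : Continuous fun g : SO d => rotate g (pole d hd) :=
    continuous_rotate_uncurry.comp (Continuous.prodMk_left _)
  have hq : Topology.IsQuotientMap fun g : SO d => rotate g (pole d hd) :=
    hc.isClosedMap.isQuotientMap hc fun y => exists_rotate_eq hd _ y
  exact hq.continuous_iff.mpr hF

/-- If `F` pulls back to a polynomial of degree `N` on the rotation group, then rotated copies of
`F` are orthogonal to the zonal harmonics of degree above `N`: the zonal average of `F` is a
polynomial of degree `N` in the height. -/
theorem innerL2_comp_rotate_Y_zero_eq_zero (hd : 3 ≤ d) {N n : ℕ} (hn : N < n) {F : Sphere d → ℂ}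
    (hF : (fun g : SO d => F (rotate g (pole d hd))) ∈ polyFun entries N) (a : SO d) :
    innerL2 d (fun x => F (rotate a x)) (Y d n 0) = 0 := by
  have : NeZero d := ⟨by omega⟩
  have hFc : Continuous F :=
    continuous_of_comp_rotate_pole hd (continuous_of_mem_polyFun continuous_entries hF)
  have hYh : ∀ (h : SOsub d) x, Y d n 0 (rotate (h : SO d) x) = Y d n 0 x := fun h x => by
    rw [Y_zero_eq hd, Y_zero_eq hd, height_rotate]
  have hYc := continuous_Y hd (zero_mem_indexSet d n)
  have hcont : Continuous fun p : SOsub d × Sphere d =>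
      F (rotate (a * ((p.1⁻¹ : SOsub d) : SO d)) p.2) := by
    refine hFc.comp (continuous_rotate_uncurry.comp (Continuous.prodMk ?_ continuous_snd))
    exact continuous_const.mul (continuous_subtype_val.comp continuous_fst.inv)
  -- The zonal average of `F ∘ a`; replacing `F ∘ a` by it does not change the inner product, as
  -- `Y d n 0` is zonal.
  set Z : Sphere d → ℂ := fun x => ∫ h : SOsub d,
    F (rotate (a * ((h⁻¹ : SOsub d) : SO d)) x) ∂(haarSOsub d) with hZ
  have hint : ∀ x, Integrable (fun h : SOsub d => F (rotate (a * ((h⁻¹ : SOsub d) : SO d)) x))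
      (haarSOsub d) := fun x => by
    have h1 : Continuous fun h : SOsub d => (h, x) := Continuous.prodMk continuous_id continuous_const
    have h2 := hcont.comp h1
    exact integrable_of_continuous_SOsub h2
  have hZinv : ∀ x y, height hd x = height hd y → Z x = Z y := by
    intro x y hxy
    obtain ⟨g, hg⟩ := exists_SOsub_rotate_eq hd hxy
    rw [← hg]
    simp only [hZ]
    rw [← integral_mul_left_eq_self _ g⁻¹]
    refine integral_congr_ae (ae_of_all _ fun h => ?_)
    simp only
    rw [← rotate_mul]
    congr 2
    simp [mul_assoc]
  have hZmer : (fun t => Z (rotate (meridianRotation hd t) (pole d hd))) ∈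
      polyFun circleCoord N := by
    have := finiteDimensional_polyFun (v := circleCoord) N
    refine integral_mem_of_forall_mem (F := fun (h : SOsub d) t => F (rotate
      (a * ((h⁻¹ : SOsub d) : SO d)) (rotate (meridianRotation hd t) (pole d hd)))) (fun h => ?_)
      fun t => hint _
    simp only [← rotate_mul]
    refine comp_mem_polyFun (T := fun t => a * ((h⁻¹ : SOsub d) : SO d) * meridianRotation hd t)
      hF fun p => ?_
    have h1 := entries_mul_mem (v := circleCoord) (g := fun _ => a * ((h⁻¹ : SOsub d) : SO d))
      (fun p => const_mem_polyFun _ 0) (entries_meridianRotation_mem hd) p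
    rwa [zero_add] at h1
  have hZmem : Z ∈ sphericalPoly d N := by
    obtain ⟨p, hp, hpZ⟩ := exists_eval_height hd hZinv hZmer
    rw [sphericalPoly_eq_polyFun hd, funext hpZ]
    exact eval_height_mem_polyFun hd hp
  have hZ0 := innerL2_Y_eq_zero_of_mem hd hn hZmem (zero_mem_indexSet d n)
  have h1 : ∀ h : SOsub d, innerL2 d (fun x => F (rotate a x)) (Y d n 0) =
      ∫ x, F (rotate (a * ((h⁻¹ : SOsub d) : SO d)) x) * (starRingEnd ℂ) (Y d n 0 x)
        ∂(surfaceMeasure d) := by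
    intro h
    rw [← innerL2_comp_rotate ((h⁻¹ : SOsub d) : SO d), innerL2]
    simp only [hYh, rotate_mul]
  have hcont2 : Continuous (Function.uncurry fun (h : SOsub d) (x : Sphere d) =>
      F (rotate (a * ((h⁻¹ : SOsub d) : SO d)) x) * (starRingEnd ℂ) (Y d n 0 x)) :=
    hcont.mul (Complex.continuous_conj.comp (hYc.comp continuous_snd))
  calc innerL2 d (fun x => F (rotate a x)) (Y d n 0)
      = ∫ _ : SOsub d, innerL2 d (fun x => F (rotate a x)) (Y d n 0) ∂(haarSOsub d) := by simp
    _ = ∫ h : SOsub d, ∫ x, F (rotate (a * ((h⁻¹ : SOsub d) : SO d)) x) *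
        (starRingEnd ℂ) (Y d n 0 x) ∂(surfaceMeasure d) ∂(haarSOsub d) :=
      integral_congr_ae (ae_of_all _ h1)
    _ = ∫ x, ∫ h : SOsub d, F (rotate (a * ((h⁻¹ : SOsub d) : SO d)) x) *
        (starRingEnd ℂ) (Y d n 0 x) ∂(haarSOsub d) ∂(surfaceMeasure d) :=
      integral_integral_swap_of_hasCompactSupport hcont2 (HasCompactSupport.of_compactSpace _)
    _ = innerL2 d Z (Y d n 0) := by
      rw [innerL2]
      refine integral_congr_ae (ae_of_all _ fun x => ?_)
      simp only [hZ]
      rw [← integral_mul_const]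
    _ = 0 := hZ0

/-- A function on the sphere that pulls back to a polynomial of degree `N` on the rotation group is
a spherical polynomial of degree `N`. -/
theorem mem_sphericalPoly_of_comp_rotate_pole (hd : 3 ≤ d) {N : ℕ} {F : Sphere d → ℂ}
    (hF : (fun g : SO d => F (rotate g (pole d hd))) ∈ polyFun entries N) :
    F ∈ sphericalPoly d N := by
  have : NeZero d := ⟨by omega⟩
  have hFc : Continuous F :=
    continuous_of_comp_rotate_pole hd (continuous_of_mem_polyFun continuous_entries hF)
  have hFi := integrable_of_continuous_sphere hFc
  have hort : ∀ n, N < n → ∀ k ∈ indexSet d n, innerL2 d F (Y d n k) = 0 := by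
    intro n hn l hl
    -- The projection of `F` to degree `n`, at `y = a e^d`, is a multiple of the inner product of
    -- `F ∘ a` with the zonal harmonic, by invariance of the reproducing kernel.
    have h1 : ∀ y, ∑ k ∈ indexSet d n, Y d n k y * innerL2 d F (Y d n k) = 0 := by
      intro y
      obtain ⟨a, rfl⟩ := exists_rotate_eq hd (pole d hd) y
      rw [← integral_mul_sum_kernel (fun k hk => continuous_Y hd hk) hFi, ← integral_comp_rotate a]
      have h2 : ∀ x, F (rotate a x) * ∑ k ∈ indexSet d n, Y d n k (rotate a (pole d hd)) *
          (starRingEnd ℂ) (Y d n k (rotate a x)) =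
          Y d n 0 (pole d hd) * (F (rotate a x) * (starRingEnd ℂ) (Y d n 0 x)) := by
        intro x
        have h3 : ∑ k ∈ indexSet d n, Y d n k (rotate a (pole d hd)) *
            (starRingEnd ℂ) (Y d n k (rotate a x)) =
            (starRingEnd ℂ) (harmonicKernel d n (rotate a x) (rotate a (pole d hd))) := by
          rw [harmonicKernel, map_sum]
          exact Finset.sum_congr rfl fun k _ => by rw [map_mul, Complex.conj_conj, mul_comm]
        rw [h3, harmonicKernel_rotate hd, harmonicKernel_pole, map_mul, Complex.conj_conj]
        ring
      simp only [h2]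
      rw [integral_const_mul]
      exact mul_eq_zero_of_right _ (innerL2_comp_rotate_Y_zero_eq_zero hd hn hF a)
    have h2 := innerL2_sum_Y hd (n + 1)
      (fun m k => if m = n then innerL2 d F (Y d n k) else 0) hl
    rw [if_pos n.lt_succ_self, if_pos rfl] at h2
    have h3 : ∀ x, ∑ m ∈ Finset.range (n + 1), ∑ k ∈ indexSet d m,
        (if m = n then innerL2 d F (Y d n k) else 0) * Y d m k x = 0 := fun x => by
      rw [Finset.sum_eq_single_of_mem n (Finset.self_mem_range_succ n)]
      · simpa only [if_true, mul_comm] using h1 x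
      · intro m _ hm
        simp [hm]
    simp only [h3] at h2
    rw [← h2, innerL2]
    simp
  have h1 : F = ∑ n ∈ Finset.range (N + 1), ∑ k ∈ indexSet d n,
      innerL2 d F (Y d n k) • Y d n k := by
    funext x
    rw [eq_sum_innerL2_smul_Y hd hFc hort x]
    simp [Finset.sum_apply]
  rw [h1]
  exact Submodule.sum_mem _ fun n hn => Submodule.sum_mem _ fun k hk =>
    Submodule.smul_mem _ _ (Y_mem_sphericalPoly (by rw [Finset.mem_range] at hn; omega) hk)

end averages

/-! ### Degrees of the wavelets -/

section wavelets

variable {d : ℕ}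

/-- As a function of `h ∈ SO(d-1)`, the rotated harmonic `Y_k(h⁻¹ u)` has degree `|k_1|` only:
`Y_k` is a polynomial in the height times a harmonic of degree `|k_1|` in the other variables. -/
theorem Y_rotate_inv_mem (hd : 3 ≤ d) {n : ℕ} {k : Fin (d - 2) → ℤ} (hk : k ∈ indexSet d n)
    (u : Sphere d) : (fun h : SOsub d => Y d n k (rotate (h : SO d)⁻¹ u)) ∈
      polyFun (fun h : SOsub d => entries (h : SO d)) (extIndex n k 1).natAbs := by
  simp only [Y_eq_evalSphere hd hk]
  obtain ⟨N, rfl⟩ : ∃ N, d = N + 3 := ⟨d - 3, by omega⟩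
  set c := chainIndex (N + 3) n k with hc
  have hcN : c N = extIndex n k 1 := by
    rw [hc, chainIndex]
    congr 1
    omega
  have hchain : IsChainIndex c N := (isChainIndex_chainIndex hk).mono (by omega)
  have hheight : ∀ h : SOsub (N + 3), height hd (rotate (h : SO (N + 3))⁻¹ u) = height hd u :=
    fun h => height_rotate hd h⁻¹ u
  simp only [show N + 3 - 2 = N + 1 from rfl, solid, map_mul, evalSphere_gegenbauerSolid,
    partialNorm_self, cos_angle_last, hheight]
  refine Submodule.smul_mem _ _ (Submodule.smul_mem _ _ ?_)
  rw [← hcN]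
  refine polyFun_mono (isHomogeneous_solid hchain).totalDegree_le ?_
  refine eval_mem_polyFun (w := fun i (h : SOsub (N + 3)) =>
    (coord (rotate (h : SO (N + 3))⁻¹ u : EuclideanSpace ℝ (Fin (N + 3))) i : ℂ)) _ fun i hi => ?_
  have hi' : i < N + 3 := by
    have := mem_supported.mp (solid_mem_supported c N) hi
    rw [mem_Iio] at this
    omega
  have h1 := rotate_coord_mem (v := fun h : SOsub (N + 3) => entries (h : SO (N + 3)))
    (g := fun h : SOsub (N + 3) => (h : SO (N + 3))⁻¹) (T := fun _ => u)
    (fun p => coord_mem_polyFun (p.2, p.1)) (fun _ => const_mem_polyFun _ 0) ⟨i, hi'⟩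
  simpa only [← coord_eq_sphereCoord] using h1

theorem rotate_inv_mem_polyFun (hd : 3 ≤ d) {N : ℕ} {f : Sphere d → ℂ} (hf : f ∈ sphericalPoly d N)
    (h : SO d) (x : Sphere d) : (fun g : SO d => f (rotate (g * h)⁻¹ x)) ∈ polyFun entries N := by
  rw [sphericalPoly_eq_polyFun hd] at hf
  simp only [mul_inv_rev, rotate_mul]
  refine comp_mem_polyFun (T := fun g : SO d => rotate h⁻¹ (rotate g⁻¹ x)) hf fun i => ?_
  have h1 := rotate_coord_mem (v := entries (d := d)) (g := fun _ => h⁻¹)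
    (fun p => const_mem_polyFun _ 0) (rotate_coord_mem (v := entries (d := d))
      (g := fun g : SO d => g⁻¹) (T := fun _ => x) (fun p => coord_mem_polyFun (p.2, p.1))
      (fun _ => const_mem_polyFun _ 0)) i
  rwa [zero_add] at h1

end wavelets

/-! ### Discretisation of an invariant kernel -/

section frame

variable {d : ℕ}

/-- The average over `h ∈ SO(d-1)` of the kernels `Ψ(h⁻¹ u) conj (Ψ(h⁻¹ v))`. -/
def averagedKernel (Ψ : Sphere d → ℂ) (u v : Sphere d) : ℂ :=
  ∫ h : SOsub d, Ψ (rotate (h : SO d)⁻¹ u) * (starRingEnd ℂ) (Ψ (rotate (h : SO d)⁻¹ v))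
    ∂(haarSOsub d)

/-- Invariance of the Haar measure under translations. -/
theorem averagedKernel_rotate_inv (Ψ : Sphere d → ℂ) (a : SOsub d) (u v : Sphere d) :
    averagedKernel Ψ (rotate (a : SO d)⁻¹ u) (rotate (a : SO d)⁻¹ v) = averagedKernel Ψ u v := by
  rw [averagedKernel, averagedKernel]
  conv_rhs => rw [← integral_mul_left_eq_self (μ := haarSOsub d) _ a]
  refine integral_congr_ae (ae_of_all _ fun h => ?_)
  simp only [← rotate_mul, Subgroup.coe_mul, mul_inv_rev]

/-- The averaged kernel at `(g⁻¹ x, g⁻¹ y)` depends on `g` only through the point `g e^d`; this is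
why the choice of the rotations over the quadrature points does not matter. -/
theorem averagedKernel_congr (hd : 3 ≤ d) (Ψ : Sphere d → ℂ) {g g' : SO d}
    (hg : rotate g (pole d hd) = rotate g' (pole d hd)) (x y : Sphere d) :
    averagedKernel Ψ (rotate g⁻¹ x) (rotate g⁻¹ y) =
      averagedKernel Ψ (rotate g'⁻¹ x) (rotate g'⁻¹ y) := by
  have hmem : g⁻¹ * g' ∈ SOsub d := by
    rw [mem_SOsub_iff hd, rotate_mul, ← hg, rotate_inv_rotate]
  have h := averagedKernel_rotate_inv Ψ ⟨g⁻¹ * g', hmem⟩ (rotate g⁻¹ x) (rotate g⁻¹ y)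
  rw [← h]
  simp only [← rotate_mul, mul_inv_rev, inv_inv, mul_assoc, mul_inv_cancel, mul_one]

theorem continuous_SOsub_rotate_inv {Ψ : Sphere d → ℂ} (hΨ : Continuous Ψ) (u : Sphere d) :
    Continuous fun h : SOsub d => Ψ (rotate (h : SO d)⁻¹ u) := by
  have h1 : Continuous fun h : SOsub d => (((h : SO d)⁻¹ : SO d), u) :=
    Continuous.prodMk continuous_subtype_val.inv continuous_const
  have h2 : Continuous fun h : SOsub d => rotate (h : SO d)⁻¹ u := continuous_rotate_uncurry.comp h1
  exact hΨ.comp h2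

/-- As a function of the point `η = g e^d`, the averaged kernel at `(g⁻¹ x, g⁻¹ y)` is a spherical
polynomial of twice the degree. -/
theorem exists_sphericalPoly_averagedKernel (hd : 3 ≤ d) {N : ℕ} {Ψ : Sphere d → ℂ}
    (hΨ : Ψ ∈ sphericalPoly d N) :
    ∃ F : Sphere d → Sphere d → Sphere d → ℂ, (∀ x y, F x y ∈ sphericalPoly d (N + N)) ∧
      ∀ x y g, F x y (rotate g (pole d hd)) =
        averagedKernel Ψ (rotate g⁻¹ x) (rotate g⁻¹ y) := by
  -- An arbitrary, possibly discontinuous, choice of a rotation that takes the pole to `η`.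
  choose sec hsec using fun η => exists_rotate_eq hd (pole d hd) η
  have key : ∀ x y g, averagedKernel Ψ (rotate (sec (rotate g (pole d hd)))⁻¹ x)
      (rotate (sec (rotate g (pole d hd)))⁻¹ y) =
      averagedKernel Ψ (rotate g⁻¹ x) (rotate g⁻¹ y) :=
    fun x y g => averagedKernel_congr hd Ψ (hsec _) x y
  refine ⟨fun x y η => averagedKernel Ψ (rotate (sec η)⁻¹ x) (rotate (sec η)⁻¹ y),
    fun x y => ?_, key⟩
  apply mem_sphericalPoly_of_comp_rotate_pole hd
  simp only [key]
  have hΨc := continuous_of_mem_sphericalPoly hd hΨ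
  have := finiteDimensional_polyFun (v := entries (d := d)) (N + N)
  refine integral_mem_of_forall_mem (F := fun (h : SOsub d) (g : SO d) =>
    Ψ (rotate (h : SO d)⁻¹ (rotate g⁻¹ x)) *
      (starRingEnd ℂ) (Ψ (rotate (h : SO d)⁻¹ (rotate g⁻¹ y)))) (fun h => ?_) fun g => ?_
  · simp only [← rotate_mul, ← mul_inv_rev]
    exact mul_mem_polyFun (rotate_inv_mem_polyFun hd hΨ _ x)
      (conj_mem_polyFun (rotate_inv_mem_polyFun hd hΨ _ y))
  · exact integrable_of_continuous_SOsub ((continuous_SOsub_rotate_inv hΨc _).mul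
      (Complex.continuous_conj.comp (continuous_SOsub_rotate_inv hΨc _)))

/-- For exact quadratures the discretised kernel is a combination of the reproducing kernels of
degree at most `N`. -/
theorem exists_discreteKernel_eq (hd : 3 ≤ d) {N M : ℕ} {Ψ : Sphere d → ℂ}
    (hΨ : Ψ ∈ sphericalPoly d N)
    (hΨh : ∀ u, (fun h : SOsub d => Ψ (rotate (h : SO d)⁻¹ u)) ∈
      polyFun (fun h : SOsub d => entries (h : SO d)) M)
    {s r : ℕ} {η : Fin s → Sphere d} {w : Fin s → ℝ} (hη : IsSphereQuadrature d (2 * N) η w)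
    {h : Fin r → SOsub d} {μ : Fin r → ℝ} (hh : IsRotationQuadrature d (2 * M) h μ)
    {g : Fin s → SO d} (hg : ∀ l, rotate (g l) (pole d hd) = η l) :
    ∃ c : ℕ → ℂ, ∀ x y, ∑ l, ∑ m, (w l : ℂ) * μ m * (Ψ (rotate (g l * h m)⁻¹ x) *
      (starRingEnd ℂ) (Ψ (rotate (g l * h m)⁻¹ y))) =
        ∑ n ∈ Finset.range (N + 1), c n * harmonicKernel d n x y := by
  obtain ⟨F, hF, hFg⟩ := exists_sphericalPoly_averagedKernel hd hΨ
  have hE : ∀ x y, ∑ l, ∑ m, (w l : ℂ) * μ m * (Ψ (rotate (g l * h m)⁻¹ x) *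
      (starRingEnd ℂ) (Ψ (rotate (g l * h m)⁻¹ y))) =
      ∫ z, F x y z ∂(surfaceMeasure d) := by
    intro x y
    rw [← hη.2 (F x y) (by rw [two_mul]; exact hF x y)]
    refine Finset.sum_congr rfl fun l _ => ?_
    rw [← hg l, hFg, averagedKernel, ← hh.2 _ (by
      rw [two_mul]
      exact mul_mem_polyFun (hΨh (rotate (g l)⁻¹ x)) (conj_mem_polyFun (hΨh (rotate (g l)⁻¹ y)))),
      Finset.mul_sum]
    refine Finset.sum_congr rfl fun m _ => ?_
    rw [mul_inv_rev, rotate_mul, rotate_mul, mul_assoc]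
  refine exists_eq_sum_harmonicKernel hd (fun a x y => ?_) ?_
  -- The sum is an integral over the sphere, and a rotation of `x` and `y` amounts to a
  -- substitution in it.
  · rw [hE, hE, ← integral_comp_rotate a]
    refine integral_congr_ae (ae_of_all _ fun z => ?_)
    obtain ⟨b, rfl⟩ := exists_rotate_eq hd (pole d hd) z
    simp only
    rw [← rotate_mul, hFg, hFg]
    simp only [← rotate_mul, mul_inv_rev, mul_assoc, inv_mul_cancel, mul_one]
  · have h1 : (fun x => ∑ l, ∑ m, (w l : ℂ) * μ m * (Ψ (rotate (g l * h m)⁻¹ x) *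
        (starRingEnd ℂ) (Ψ (rotate (g l * h m)⁻¹ (pole d hd))))) =
        ∑ l, ∑ m, ((w l : ℂ) * μ m * (starRingEnd ℂ) (Ψ (rotate (g l * h m)⁻¹ (pole d hd)))) •
          fun x => Ψ (rotate (g l * h m)⁻¹ x) := by
      funext x
      simp only [Finset.sum_apply, Pi.smul_apply, smul_eq_mul]
      exact Finset.sum_congr rfl fun l _ => Finset.sum_congr rfl fun m _ => by ring
    rw [h1]
    exact Submodule.sum_mem _ fun l _ => Submodule.sum_mem _ fun m _ =>
      Submodule.smul_mem _ _ (rotate_mem_sphericalPoly hd hΨ _)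

/-- The quadratic form of a combination of reproducing kernels is diagonal in the degree. -/
theorem integral_mul_conj_sum_harmonicKernel (hd : 3 ≤ d) (N : ℕ) (c : ℕ → ℂ) {f : Sphere d → ℂ}
    (hf : Integrable f (surfaceMeasure d)) :
    ∫ x, f x * (starRingEnd ℂ) (∫ y, f y * ∑ n ∈ Finset.range (N + 1),
        c n * harmonicKernel d n x y ∂(surfaceMeasure d)) ∂(surfaceMeasure d) =
      ∑ n ∈ Finset.range (N + 1), (starRingEnd ℂ) (c n) *
        ((∑ k ∈ indexSet d n, ‖innerL2 d f (Y d n k)‖ ^ 2 : ℝ) : ℂ) := by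
  set I := (Finset.range (N + 1)).sigma (indexSet d) with hI
  have hY : ∀ i ∈ I, Continuous (Y d i.1 i.2) := fun i hi =>
    continuous_Y hd (Finset.mem_sigma.mp hi).2
  have h1 : ∀ x y, ∑ n ∈ Finset.range (N + 1), c n * harmonicKernel d n x y =
      ∑ i ∈ I, (c i.1 * Y d i.1 i.2 x) * (starRingEnd ℂ) (Y d i.1 i.2 y) := by
    intro x y
    rw [hI, Finset.sum_sigma]
    refine Finset.sum_congr rfl fun n _ => ?_
    rw [harmonicKernel, Finset.mul_sum]
    exact Finset.sum_congr rfl fun k _ => (mul_assoc _ _ _).symm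
  have h2 : ∀ x, (starRingEnd ℂ) (∫ y, f y * ∑ n ∈ Finset.range (N + 1),
        c n * harmonicKernel d n x y ∂(surfaceMeasure d)) =
      ∑ i ∈ I, ((starRingEnd ℂ) (c i.1) * (starRingEnd ℂ) (innerL2 d f (Y d i.1 i.2))) *
        (starRingEnd ℂ) (Y d i.1 i.2 x) := by
    intro x
    simp only [h1]
    rw [integral_mul_sum_kernel hY hf, map_sum]
    exact Finset.sum_congr rfl fun i _ => by rw [map_mul, map_mul]; ring
  simp only [h2]
  rw [integral_mul_sum_kernel hY hf, hI, Finset.sum_sigma]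
  refine Finset.sum_congr rfl fun n _ => ?_
  rw [Complex.ofReal_sum, Finset.mul_sum]
  refine Finset.sum_congr rfl fun k _ => ?_
  rw [mul_assoc, Complex.conj_mul', Complex.ofReal_pow]

/-- The discretised family resolves every degree `n ≤ N` with the weight `b n`, provided that the
projection of `Ψ` to the harmonics of degree `n` has squared norm `b n` times their dimension. -/
theorem sum_norm_sq_innerL2_discrete (hd : 3 ≤ d) {N M : ℕ} {Ψ : Sphere d → ℂ}
    (hΨ : Ψ ∈ sphericalPoly d N)
    (hΨh : ∀ u, (fun h : SOsub d => Ψ (rotate (h : SO d)⁻¹ u)) ∈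
      polyFun (fun h : SOsub d => entries (h : SO d)) M)
    {b : ℕ → ℝ} (hb : ∀ n ≤ N, ∑ k ∈ indexSet d n, ‖innerL2 d Ψ (Y d n k)‖ ^ 2 =
      (indexSet d n).card * b n)
    {s r : ℕ} {η : Fin s → Sphere d} {w : Fin s → ℝ} (hη : IsSphereQuadrature d (2 * N) η w)
    {h : Fin r → SOsub d} {μ : Fin r → ℝ} (hh : IsRotationQuadrature d (2 * M) h μ)
    {g : Fin s → SO d} (hg : ∀ l, rotate (g l) (pole d hd) = η l)
    {f : Sphere d → ℂ} (hf : Integrable f (surfaceMeasure d)) :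
    ∑ l, ∑ m, ‖innerL2 d f (fun x => (√(w l * μ m) : ℂ) * rotateFun (g l * (h m : SO d)) Ψ x)‖ ^ 2 =
      ∑ n ∈ Finset.range (N + 1), b n * ∑ k ∈ indexSet d n, ‖innerL2 d f (Y d n k)‖ ^ 2 := by
  have : NeZero d := ⟨by omega⟩
  have hΨc := continuous_of_mem_sphericalPoly hd hΨ
  set a : Fin s × Fin r → Sphere d → ℂ := fun i x =>
    (√(w i.1 * μ i.2) : ℂ) * rotateFun (g i.1 * (h i.2 : SO d)) Ψ x with ha
  have hrot : ∀ i : Fin s × Fin r, Continuous (rotateFun (g i.1 * (h i.2 : SO d)) Ψ) := fun i =>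
    hΨc.comp (continuous_rotate _)
  have hac : ∀ i, Continuous (a i) := fun i => continuous_const.mul (hrot i)
  have hwμ : ∀ i : Fin s × Fin r, 0 ≤ w i.1 * μ i.2 := fun i =>
    mul_nonneg (hη.1 _) (hh.1 _).le
  obtain ⟨c, hc⟩ := exists_discreteKernel_eq hd hΨ hΨh hη hh hg
  have hker : ∀ x y, ∑ i, a i x * (starRingEnd ℂ) (a i y) =
      ∑ n ∈ Finset.range (N + 1), c n * harmonicKernel d n x y := by
    intro x y
    rw [← hc, Fintype.sum_prod_type]
    refine Finset.sum_congr rfl fun l _ => Finset.sum_congr rfl fun m _ => ?_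
    have h1 : ((√(w l * μ m) : ℝ) : ℂ) * ((√(w l * μ m) : ℝ) : ℂ) = w l * μ m := by
      rw [← Complex.ofReal_mul, Real.mul_self_sqrt (hwμ (l, m)), Complex.ofReal_mul]
    rw [← h1]
    simp only [ha, rotateFun, map_mul, Complex.conj_ofReal]
    ring
  have hframe : ∀ f : Sphere d → ℂ, Integrable f (surfaceMeasure d) →
      ((∑ i, ‖innerL2 d f (a i)‖ ^ 2 : ℝ) : ℂ) = ∑ n ∈ Finset.range (N + 1),
        (starRingEnd ℂ) (c n) * ((∑ k ∈ indexSet d n, ‖innerL2 d f (Y d n k)‖ ^ 2 : ℝ) : ℂ) := by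
    intro f hf
    rw [sum_norm_sq_innerL2 (fun i _ => hac i) hf]
    simp only [hker]
    exact integral_mul_conj_sum_harmonicKernel hd N c hf
  -- Testing with the harmonics of degree `n` identifies the coefficient `c n`.
  have hcn : ∀ n ≤ N, (starRingEnd ℂ) (c n) = b n := by
    intro n hn
    have h1 : ∀ l ∈ indexSet d n,
        ((∑ i, ‖innerL2 d (Y d n l) (a i)‖ ^ 2 : ℝ) : ℂ) = (starRingEnd ℂ) (c n) := by
      intro l hl
      rw [hframe _ (integrable_of_continuous_sphere (continuous_Y hd hl)),
        Finset.sum_eq_single_of_mem n (Finset.mem_range.mpr (by omega))]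
      · rw [Finset.sum_eq_single_of_mem l hl]
        · rw [innerL2_Y hd hl hl]
          simp
        · intro k hk hkl
          rw [innerL2_Y hd hl hk, if_neg fun h => hkl h.2.symm]
          simp
      · intro m _ hm
        rw [Finset.sum_eq_zero, Complex.ofReal_zero, mul_zero]
        intro k hk
        rw [innerL2_Y hd hl hk, if_neg fun h => hm h.1.symm]
        simp
    have h2 : ∑ l ∈ indexSet d n, ∑ i, ‖innerL2 d (Y d n l) (a i)‖ ^ 2 =
        (indexSet d n).card * b n := by
      rw [Finset.sum_comm]
      have h3 : ∀ i, ∑ l ∈ indexSet d n, ‖innerL2 d (Y d n l) (a i)‖ ^ 2 =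
          w i.1 * μ i.2 * ((indexSet d n).card * b n) := by
        intro i
        rw [← hb n hn, ← sum_norm_sq_innerL2_Y_rotateFun hd n (g i.1 * (h i.2 : SO d)) hΨc, Finset.mul_sum]
        refine Finset.sum_congr rfl fun l _ => ?_
        rw [← conj_innerL2, RCLike.norm_conj]
        have h4 : innerL2 d (a i) (Y d n l) =
            (√(w i.1 * μ i.2) : ℂ) * innerL2 d (rotateFun (g i.1 * (h i.2 : SO d)) Ψ) (Y d n l) := by
          rw [innerL2, innerL2, ← integral_const_mul]
          simp only [ha, mul_assoc]
        rw [h4, norm_mul, mul_pow, Complex.norm_real, Real.norm_eq_abs, sq_abs,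
          Real.sq_sqrt (hwμ i)]
      -- The quadratures integrate the constant `1`.
      have hw : ∑ l, w l = 1 := by
        have h4 := hη.2 (fun _ => 1) (by
          rw [sphericalPoly_eq_polyFun hd]
          exact const_mem_polyFun _ _)
        simp only [mul_one, integral_const, probReal_univ, one_smul] at h4
        exact_mod_cast h4
      have hμ : ∑ m, μ m = 1 := by
        have h4 := hh.2 (fun _ => 1) (const_mem_polyFun (v := fun h : SOsub d =>
          entries (h : SO d)) 1 _)
        simp only [mul_one, integral_const, probReal_univ, one_smul] at h4
        exact_mod_cast h4
      rw [Finset.sum_congr rfl fun i _ => h3 i, ← Finset.sum_mul, Fintype.sum_prod_type,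
        ← Finset.sum_mul_sum, hw, hμ, one_mul, one_mul]
    have h3 : ((indexSet d n).card : ℂ) ≠ 0 := Nat.cast_ne_zero.mpr
      (Finset.card_ne_zero_of_mem (zero_mem_indexSet d n))
    apply mul_left_cancel₀ h3
    have h4 := congrArg (fun t : ℝ => (t : ℂ)) h2
    simp only [Complex.ofReal_sum] at h4
    rw [Finset.sum_congr rfl fun l hl => by
      rw [← Complex.ofReal_sum, h1 l hl], Finset.sum_const, nsmul_eq_mul] at h4
    rw [h4]
    push_cast
    rfl
  have h1 := hframe f hf
  have h2 : ∑ n ∈ Finset.range (N + 1), (starRingEnd ℂ) (c n) *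
      ((∑ k ∈ indexSet d n, ‖innerL2 d f (Y d n k)‖ ^ 2 : ℝ) : ℂ) =
      ((∑ n ∈ Finset.range (N + 1), b n * ∑ k ∈ indexSet d n, ‖innerL2 d f (Y d n k)‖ ^ 2 : ℝ) :
        ℂ) := by
    rw [Complex.ofReal_sum]
    refine Finset.sum_congr rfl fun n hn => ?_
    rw [hcn n (by rw [Finset.mem_range] at hn; omega), Complex.ofReal_mul]
  rw [h2, Complex.ofReal_inj, Fintype.sum_prod_type] at h1
  exact h1

end frame

/-! ### The window functions -/

section window

variable {φ : ℝ → ℝ}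

theorem phi_nonneg (hanti : AntitoneOn φ (Ici 0)) (hzero : ∀ t, 1 ≤ t → φ t = 0) {t : ℝ}
    (ht : 0 ≤ t) : 0 ≤ φ t := by
  rcases le_total 1 t with h | h
  · rw [hzero t h]
  · rw [← hzero 1 le_rfl]
    exact hanti ht (mem_Ici.mpr zero_le_one) h

theorem kappa_sq (hanti : AntitoneOn φ (Ici 0)) (hzero : ∀ t, 1 ≤ t → φ t = 0) {t : ℝ}
    (ht : 0 ≤ t) : kappa φ t ^ 2 = φ (t / 2) ^ 2 - φ t ^ 2 := by
  refine Real.sq_sqrt (sub_nonneg.mpr ?_)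
  exact pow_le_pow_left₀ (phi_nonneg hanti hzero ht)
    (hanti (div_nonneg ht zero_le_two) ht (half_le_self ht)) 2

theorem kappa_eq_zero (hzero : ∀ t, 1 ≤ t → φ t = 0) {t : ℝ} (ht : 2 ≤ t) : kappa φ t = 0 := by
  rw [kappa, hzero t (by linarith), hzero (t / 2) (by linarith)]
  simp

theorem kappa_zero : kappa φ 0 = 0 := by simp [kappa]

theorem div_two_zpow (t : ℝ) (i : ℕ) : t / (2 : ℝ) ^ (((i + 1 : ℕ) : ℤ) - 1) = t / 2 ^ i := by
  rw [show ((i + 1 : ℕ) : ℤ) - 1 = (i : ℤ) by push_cast; ring, zpow_natCast]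

theorem two_le_div_two_pow {n i : ℕ} (h : 2 ^ (i + 1) ≤ n) : (2 : ℝ) ≤ (n : ℝ) / 2 ^ i := by
  rw [le_div_iff₀ (by positivity), ← pow_succ']
  exact_mod_cast h

/-- The sum over the scales of the squared windows telescopes. -/
theorem sum_scales (hanti : AntitoneOn φ (Ici 0)) (hone : ∀ t ∈ Icc (0 : ℝ) (1 / 2), φ t = 1)
    (hzero : ∀ t, 1 ≤ t → φ t = 0) (a : ℕ → ℝ) (J : ℕ) :
    a 0 + ∑ i ∈ Finset.range J, ∑ n ∈ Finset.range (2 ^ (i + 1) + 1),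
      kappa φ ((n : ℝ) / 2 ^ i) ^ 2 * a n =
      ∑ n ∈ Finset.range (2 ^ J + 1), φ ((n : ℝ) / 2 ^ J) ^ 2 * a n := by
  induction J with
  | zero =>
    have h0 : φ 0 = 1 := hone 0 ⟨le_rfl, by norm_num⟩
    have h1 : φ 1 = 0 := hzero 1 le_rfl
    simp [Finset.sum_range_succ, h0, h1]
  | succ J ih =>
    rw [Finset.sum_range_succ, ← add_assoc, ih]
    have h1 : ∑ n ∈ Finset.range (2 ^ J + 1), φ ((n : ℝ) / 2 ^ J) ^ 2 * a n =
        ∑ n ∈ Finset.range (2 ^ (J + 1) + 1), φ ((n : ℝ) / 2 ^ J) ^ 2 * a n := by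
      refine Finset.sum_subset (Finset.range_mono ?_) fun n _ hn => ?_
      · rw [pow_succ]
        have := Nat.one_le_two_pow (n := J)
        omega
      · rw [Finset.mem_range, not_lt] at hn
        rw [hzero]
        · ring
        · rw [le_div_iff₀ (by positivity), one_mul]
          exact_mod_cast (Nat.le_succ _).trans hn
    rw [h1, ← Finset.sum_add_distrib]
    refine Finset.sum_congr rfl fun n _ => ?_
    rw [kappa_sq hanti hzero (by positivity), div_div, ← pow_succ]
    ring

/-- The telescoped sums `∑_n φ(n / 2^J)² a_n` lie between `∑_{n ≤ 2^J / 2} a_n` and `∑_n a_n`. -/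
theorem hasSum_scales (hanti : AntitoneOn φ (Ici 0)) (hone : ∀ t ∈ Icc (0 : ℝ) (1 / 2), φ t = 1)
    (hzero : ∀ t, 1 ≤ t → φ t = 0) {a : ℕ → ℝ} (ha : ∀ n, 0 ≤ a n) {A : ℝ} (hA : HasSum a A)
    {t : ℕ → ℝ} (h0 : t 0 = a 0) (ht : ∀ i, t (i + 1) = ∑ n ∈ Finset.range (2 ^ (i + 1) + 1),
      kappa φ ((n : ℝ) / 2 ^ i) ^ 2 * a n) : HasSum t A := by
  have hnn : ∀ j, 0 ≤ t j := by
    rintro (_ | i)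
    · rw [h0]
      exact ha 0
    · rw [ht]
      exact Finset.sum_nonneg fun n _ => mul_nonneg (sq_nonneg _) (ha n)
  rw [hasSum_iff_tendsto_nat_of_nonneg hnn, ← Filter.tendsto_add_atTop_iff_nat 2]
  have hsum : ∀ J, ∑ i ∈ Finset.range (J + 2), t i =
      ∑ n ∈ Finset.range (2 ^ (J + 1) + 1), φ ((n : ℝ) / 2 ^ (J + 1)) ^ 2 * a n := by
    intro J
    rw [← sum_scales hanti hone hzero, Finset.sum_range_succ', h0, add_comm]
    simp only [ht]
  have hle : ∀ x : ℝ, 0 ≤ x → φ x ^ 2 ≤ 1 := fun x hx => by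
    have h1 := phi_nonneg hanti hzero hx
    have h2 : φ x ≤ φ 0 := hanti self_mem_Ici hx hx
    rw [hone 0 ⟨le_rfl, by norm_num⟩] at h2
    exact pow_le_one₀ h1 h2
  have hlim : Filter.Tendsto (fun J : ℕ => ∑ n ∈ Finset.range (2 ^ J + 1), a n) Filter.atTop
      (nhds A) := by
    refine hA.tendsto_sum_nat.comp (Filter.tendsto_add_atTop_nat 1 |>.comp ?_)
    exact tendsto_pow_atTop_atTop_of_one_lt one_lt_two
  refine tendsto_of_tendsto_of_tendsto_of_le_of_le hlim tendsto_const_nhds (fun J => ?_) fun J => ?_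
  · simp only
    rw [hsum]
    have h1 : Finset.range (2 ^ J + 1) ⊆ Finset.range (2 ^ (J + 1) + 1) := by
      refine Finset.range_mono ?_
      rw [pow_succ]
      have := Nat.one_le_two_pow (n := J)
      omega
    refine le_trans (Finset.sum_le_sum fun n hn => ?_) (Finset.sum_le_sum_of_subset_of_nonneg h1
      fun n _ _ => mul_nonneg (sq_nonneg _) (ha n))
    rw [Finset.mem_range] at hn
    rw [hone _ ⟨by positivity, ?_⟩, one_pow, one_mul]
    rw [div_le_div_iff₀ (by positivity) two_pos, pow_succ, one_mul]
    have : (n : ℝ) ≤ 2 ^ J := by exact_mod_cast Nat.lt_succ_iff.mp hn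
    linarith
  · simp only
    rw [hsum]
    refine le_trans (Finset.sum_le_sum fun n _ => ?_) (sum_le_hasSum _ (fun n _ => ha n) hA)
    exact mul_le_of_le_one_left (ha n) (hle _ (by positivity))

end window

/-! ### The wavelets of one scale -/

section scale

variable {d : ℕ} {φ : ℝ → ℝ} {ζ : ℕ → (Fin (d - 2) → ℤ) → ℂ}

theorem finrank_harmonicSpace (hd : 3 ≤ d) (n : ℕ) :
    Module.finrank ℂ (harmonicSpace d n) = (indexSet d n).card := by
  have hspan : harmonicSpace d n =
      Submodule.span ℂ (range fun k : indexSet d n => Y d n (k : Fin (d - 2) → ℤ)) := by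
    rw [harmonicSpace]
    congr 1
    ext f
    constructor
    · rintro ⟨k, hk, rfl⟩
      exact ⟨⟨k, hk⟩, rfl⟩
    · rintro ⟨k, rfl⟩
      exact ⟨k, k.2, rfl⟩
  have : NeZero d := ⟨by omega⟩
  have hli : LinearIndependent ℂ fun k : indexSet d n => Y d n (k : Fin (d - 2) → ℤ) := by
    rw [Fintype.linearIndependent_iff]
    intro a ha l
    set b : ℕ → (Fin (d - 2) → ℤ) → ℂ := fun m k =>
      if hk : m = n ∧ k ∈ indexSet d n then a ⟨k, hk.2⟩ else 0 with hb
    have h1 := innerL2_sum_Y hd (n + 1) b l.2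
    rw [if_pos n.lt_succ_self] at h1
    have h2 : ∀ x, ∑ m ∈ Finset.range (n + 1), ∑ k ∈ indexSet d m, b m k * Y d m k x = 0 := by
      intro x
      rw [Finset.sum_eq_single_of_mem n (Finset.self_mem_range_succ n)]
      · refine Eq.trans ?_ (congrFun ha x)
        rw [← Finset.sum_coe_sort, Finset.sum_apply]
        refine Finset.sum_congr rfl fun k _ => ?_
        simp [hb]
      · intro m _ hm
        refine Finset.sum_eq_zero fun k _ => ?_
        simp [hb, hm]
    simp only [h2] at h1
    have h3 : b n l = a l := by simp [hb]
    rw [← h3, ← h1, innerL2]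
    simp
  rw [hspan, finrank_span_eq_card hli, Fintype.card_coe]

/-- The coefficients of the wavelet of scale `i + 1`. -/
def waveletCoeff (d : ℕ) (φ : ℝ → ℝ) (ζ : ℕ → (Fin (d - 2) → ℤ) → ℂ) (i n : ℕ)
    (k : Fin (d - 2) → ℤ) : ℂ :=
  ((√(Module.finrank ℂ (harmonicSpace d n)) * kappa φ ((n : ℝ) / 2 ^ i) : ℝ) : ℂ) * ζ n k

theorem waveletCoeff_eq_zero (hzero : ∀ t, 1 ≤ t → φ t = 0) {i n : ℕ} (hn : 2 ^ (i + 1) ≤ n)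
    (k : Fin (d - 2) → ℤ) : waveletCoeff d φ ζ i n k = 0 := by
  rw [waveletCoeff, kappa_eq_zero hzero (two_le_div_two_pow hn)]
  simp

theorem wavelet_eq_sum (hzero : ∀ t, 1 ≤ t → φ t = 0) (i : ℕ) :
    wavelet d φ ζ (i + 1) = fun x => ∑ n ∈ Finset.range (2 ^ (i + 1) + 1), ∑ k ∈ indexSet d n,
      waveletCoeff d φ ζ i n k * Y d n k x := by
  funext x
  have h1 : wavelet d φ ζ (i + 1) x =
      ∑' n : ℕ, ∑ k ∈ indexSet d n, waveletCoeff d φ ζ i n k * Y d n k x := by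
    simp only [wavelet, waveletCoeff, div_two_zpow]
  rw [h1]
  refine tsum_eq_sum fun n hn => Finset.sum_eq_zero fun k _ => ?_
  rw [Finset.mem_range] at hn
  rw [waveletCoeff_eq_zero hzero (by omega), zero_mul]

theorem wavelet_mem_sphericalPoly (hzero : ∀ t, 1 ≤ t → φ t = 0) (i : ℕ) :
    wavelet d φ ζ (i + 1) ∈ sphericalPoly d (2 ^ (i + 1)) := by
  have h : wavelet d φ ζ (i + 1) = ∑ n ∈ Finset.range (2 ^ (i + 1) + 1), ∑ k ∈ indexSet d n,
      waveletCoeff d φ ζ i n k • Y d n k := by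
    rw [wavelet_eq_sum hzero]
    funext x
    simp [Finset.sum_apply]
  rw [h]
  exact Submodule.sum_mem _ fun n hn => Submodule.sum_mem _ fun k hk =>
    Submodule.smul_mem _ _ (Y_mem_sphericalPoly (by rw [Finset.mem_range] at hn; omega) hk)

/-- As a function of `h ∈ SO(d-1)`, the rotated wavelet has degree at most `min(K, 2^j)`, since
only the orders with `|k_1| ≤ K` occur. -/
theorem wavelet_rotate_inv_mem (hd : 3 ≤ d) (hzero : ∀ t, 1 ≤ t → φ t = 0) {K : ℕ}
    (hζ : IsDirectionality d K ζ) (i : ℕ) (u : Sphere d) :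
    (fun h : SOsub d => wavelet d φ ζ (i + 1) (rotate (h : SO d)⁻¹ u)) ∈
      polyFun (fun h : SOsub d => entries (h : SO d)) (min K (2 ^ (i + 1))) := by
  have h : (fun h : SOsub d => wavelet d φ ζ (i + 1) (rotate (h : SO d)⁻¹ u)) =
      ∑ n ∈ Finset.range (2 ^ (i + 1) + 1), ∑ k ∈ indexSet d n,
        waveletCoeff d φ ζ i n k • fun h : SOsub d => Y d n k (rotate (h : SO d)⁻¹ u) := by
    rw [wavelet_eq_sum hzero]
    funext h
    simp [Finset.sum_apply]
  rw [h]
  refine Submodule.sum_mem _ fun n hn => Submodule.sum_mem _ fun k hk => ?_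
  rcases lt_or_ge (K : ℤ) |extIndex n k 1| with hK | hK
  · rw [waveletCoeff, hζ.vanish n k hk hK, mul_zero, zero_smul]
    exact Submodule.zero_mem _
  · refine Submodule.smul_mem _ _ (polyFun_mono (le_min ?_ ?_) (Y_rotate_inv_mem hd hk u))
    · rw [Int.abs_eq_natAbs] at hK
      exact_mod_cast hK
    · have h1 := mem_indexSet.mp hk 0 (by omega)
      rw [Finset.mem_range] at hn
      rw [Int.abs_eq_natAbs] at h1
      change ((extIndex n k 1).natAbs : ℤ) ≤ (n : ℤ) at h1
      omega

/-- The projection of the wavelet to the harmonics of degree `n` has squared norm `dim · κ²`. In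
degree `0`, where the directionality component need not be normalised, both sides vanish because
`κ(0) = 0`. -/
theorem sum_norm_sq_innerL2_wavelet (hd : 3 ≤ d) (hzero : ∀ t, 1 ≤ t → φ t = 0) {K : ℕ}
    (hζ : IsDirectionality d K ζ) (i : ℕ) {n : ℕ} (hn : n ≤ 2 ^ (i + 1)) :
    ∑ k ∈ indexSet d n, ‖innerL2 d (wavelet d φ ζ (i + 1)) (Y d n k)‖ ^ 2 =
      (indexSet d n).card * kappa φ ((n : ℝ) / 2 ^ i) ^ 2 := by
  have : NeZero d := ⟨by omega⟩
  have h1 : ∀ k ∈ indexSet d n, ‖innerL2 d (wavelet d φ ζ (i + 1)) (Y d n k)‖ ^ 2 =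
      (indexSet d n).card * kappa φ ((n : ℝ) / 2 ^ i) ^ 2 * ‖ζ n k‖ ^ 2 := by
    intro k hk
    rw [wavelet_eq_sum hzero, innerL2_sum_Y hd _ _ hk, if_pos (by omega), waveletCoeff, norm_mul,
      mul_pow, Complex.norm_real, Real.norm_eq_abs, sq_abs, mul_pow,
      Real.sq_sqrt (Nat.cast_nonneg _), finrank_harmonicSpace hd]
  rw [Finset.sum_congr rfl h1, ← Finset.mul_sum]
  rcases Nat.eq_zero_or_pos n with rfl | hn0
  · simp [kappa_zero]
  · rw [hζ.normalized n hn0, mul_one]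

theorem indexSet_zero (d : ℕ) : indexSet d 0 = {0} := by
  refine Finset.eq_singleton_iff_unique_mem.mpr ⟨zero_mem_indexSet d 0, fun k hk => ?_⟩
  by_contra hk0
  have h1 : 0 < d - 2 := by
    by_contra h
    refine hk0 (funext fun i => ?_)
    exact absurd i.2 (by omega)
  have h2 := mem_indexSet.mp hk 0 h1
  exact extIndex_one_ne_zero hk hk0 (abs_nonpos_iff.mp h2)

/-- The only harmonic of degree `0` is the constant `1`, the function of scale `0`. -/
theorem sum_norm_sq_innerL2_Y_degree_zero (hd : 3 ≤ d) (f : Sphere d → ℂ) :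
    ∑ k ∈ indexSet d 0, ‖innerL2 d f (Y d 0 k)‖ ^ 2 = ‖innerL2 d f fun _ => 1‖ ^ 2 := by
  have : NeZero d := ⟨by omega⟩
  have hlam : 0 < ((d : ℝ) - 2) / 2 := by
    have : (3 : ℝ) ≤ d := by exact_mod_cast hd
    linarith
  have hY : Y d 0 0 = fun _ => (normConst d 0 0 : ℂ) := by
    funext x
    rw [Y_zero_eq hd, gegenbauerPoly_zero hlam]
    simp
  have h1 := innerL2_Y hd (zero_mem_indexSet d 0) (zero_mem_indexSet d 0)
  rw [if_pos ⟨rfl, rfl⟩, hY, innerL2, Complex.conj_ofReal, integral_const, probReal_univ,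
    one_smul, ← Complex.ofReal_mul] at h1
  have h2 : normConst d 0 0 * normConst d 0 0 = 1 := by exact_mod_cast h1
  rw [indexSet_zero, Finset.sum_singleton, hY, innerL2, innerL2]
  simp only [Complex.conj_ofReal, map_one]
  rw [integral_mul_const, norm_mul, mul_pow, Complex.norm_real, Real.norm_eq_abs, sq_abs,
    sq (normConst d 0 0), h2, mul_one]
  simp only [mul_one]

theorem rotate_pole_eq_of_mulVec (hd : 3 ≤ d) {g : SO d} {η : Sphere d}
    (hg : (g : Matrix (Fin d) (Fin d) ℝ).mulVec (lastBasis d) =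
      (η : EuclideanSpace ℝ (Fin d)).ofLp) : rotate g (pole d hd) = η :=
  Subtype.ext (WithLp.ofLp_injective 2 hg)

theorem continuous_discreteWavelet (hd : 3 ≤ d) (hzero : ∀ t, 1 ≤ t → φ t = 0) (j : ℕ)
    (w u : ℝ) (g : SO d) (h : SOsub d) : Continuous (discreteWavelet d φ ζ j w u g h) := by
  rcases j with _ | i
  · exact continuous_const
  · exact continuous_const.mul ((continuous_of_mem_sphericalPoly hd
      (wavelet_mem_sphericalPoly hzero i)).comp (continuous_rotate _))

end scale

end SphereWavelet

end

theorem mainTheorem2 (d : ℕ) (hd : 3 ≤ d)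
    (q : ℕ) (φ : ℝ → ℝ) (hφ : ContDiffOn ℝ q φ (Set.Ici 0)) (hφ_anti : AntitoneOn φ (Set.Ici 0))
    (hφ_one : ∀ t ∈ Set.Icc (0 : ℝ) (1 / 2), φ t = 1) (hφ_zero : ∀ t, 1 ≤ t → φ t = 0)
    (K : ℕ) (ζ : ℕ → (Fin (d - 2) → ℤ) → ℂ) (hζ : IsDirectionality d K ζ)
    (s r : ℕ → ℕ) (hs : s 0 = 1) (hr : r 0 = 1)
    (η : (j : ℕ) → Fin (s j) → Sphere d) (ω : (j : ℕ) → Fin (s j) → ℝ)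
    (hη : ∀ j, 1 ≤ j → IsSphereQuadrature d (2 ^ (j + 1)) (η j) (ω j))
    (h : (j : ℕ) → Fin (r j) → SOsub d) (μ : (j : ℕ) → Fin (r j) → ℝ)
    (hh : ∀ j, 1 ≤ j → IsRotationQuadrature d (2 * min K (2 ^ j)) (h j) (μ j))
    (g : (j : ℕ) → Fin (s j) → SO d)
    (hg : ∀ j, 1 ≤ j → ∀ l, (g j l : Matrix (Fin d) (Fin d) ℝ).mulVec (lastBasis d) =
      (η j l : EuclideanSpace ℝ (Fin d)).ofLp) :
    (∀ j l m, MemLp (discreteWavelet d φ ζ j (ω j l) (μ j m) (g j l) (h j m)) 2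
      (surfaceMeasure d)) ∧
    ∀ f : Sphere d → ℂ, MemLp f 2 (surfaceMeasure d) →
      HasSum (fun j : ℕ => ∑ l : Fin (s j), ∑ m : Fin (r j),
          ‖innerL2 d f (discreteWavelet d φ ζ j (ω j l) (μ j m) (g j l) (h j m))‖ ^ 2)
        (∫ x, ‖f x‖ ^ 2 ∂(surfaceMeasure d)) := by
  have : NeZero d := ⟨by omega⟩
  refine ⟨fun j l m => ?_, fun f hf => ?_⟩
  · have hc := continuous_discreteWavelet (ζ := ζ) hd hφ_zero j (ω j l) (μ j m) (g j l) (h j m)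
    exact hc.memLp_of_hasCompactSupport (HasCompactSupport.of_compactSpace _)
  · refine hasSum_scales hφ_anti hφ_one hφ_zero
      (fun n => Finset.sum_nonneg fun k _ => sq_nonneg _) (hasSum_norm_innerL2_Y hd hf) ?_ fun i => ?_
    · have h1 : ∀ l m, discreteWavelet d φ ζ 0 (ω 0 l) (μ 0 m) (g 0 l) (h 0 m) = fun _ => 1 :=
        fun l m => if_pos rfl
      simp only [h1, Finset.sum_const, Finset.card_univ, Fintype.card_fin, hs, hr, one_smul]
      exact (sum_norm_sq_innerL2_Y_degree_zero hd f).symm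
    · have h1 : 1 ≤ i + 1 := by omega
      have hη' := hη (i + 1) h1
      -- `2^{j+1} = 2 · 2^j` is twice the bound for the degree of the wavelet.
      rw [pow_succ' 2 (i + 1)] at hη'
      exact sum_norm_sq_innerL2_discrete hd (wavelet_mem_sphericalPoly hφ_zero i)
        (wavelet_rotate_inv_mem hd hφ_zero hζ i)
        (fun n hn => sum_norm_sq_innerL2_wavelet hd hφ_zero hζ i hn) hη' (hh (i + 1) h1)
        (fun l => rotate_pole_eq_of_mulVec hd (hg (i + 1) h1 l)) (hf.integrable one_le_two)
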